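/- \textbf{Setting.} For integers $b\ge 2$ and $l$, let $n=\frac{b^l-1}{b-1}$ and identify the coordinates of $\mathbb R^n$ with the nodes of the full $b$-ary tree with $l$ levels, numbered level by level starting at the root. For $K\ge 1$, let $\mathcal T_K\subset\mathbb R^n$ be the set of vectors whose support is contained in some set $S$ of at most $K$ nodes that contains the root and is connected in the tree. Algorithms are programs for the real RAM (unit-cost exact arithmetic $+,-,\times,/$ and comparisons on reals, natural-number counters and addresses with $+,-,\times$ and comparisons, random-access memory, rational constants, no rounding and no integer division). The algorithm is given $b,l,n,K$, the number of rows $m$ and the entries of the measurement matrix $A$ in memory, together with the sketch $Ax$, and outputs a vector in $\mathbb R^n$. \textbf{Theorem.} There are an absolute constant $C>1$, an algorithm, and a constant $c$ such that for every fixed arity $b\ge 2$ there are a constant $M$ (depending only on $b$) and constants $D_a$, $a\in\mathbb N$ (depending only on $b$ and $a$), for which the following holds. For all $l$ and $K$ with $1\le K<n/2$, where $n=\frac{b^l-1}{b-1}$, there exists a real matrix $A$ with $n$ columns and at most $MK$ rows such that for every $x\in\mathbb R^n$ the algorithm, given $Ax$, halts and returns a vector $x^*$ with \[ \|x-x^*\|_1\le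 C\sqrt{\log(n/K)}\,\min_{x'\in\mathcal T_K}\|x-x'\|_1 . \] Moreover, for every $a\in\mathbb N$, if all coordinates of $x$ are integers of absolute value at most $n^{a}$, then the algorithm halts on input $Ax$ after at most $D_a\,K^2\,n\,\log^{c}n$ steps. -/

import Mathlib

/-! ### The tree-sparse signal model -/

/-- The number `n = (b^l - 1)/(b - 1)` of nodes of the full `b`-ary tree with `l` levels
(the division is exact for `2 ≤ b`, see `treeSize_eq_sum`). -/
def treeSize (b l : ℕ) : ℕ := (b ^ l - 1) / (b - 1)

theorem treeSize_eq_sum (b l : ℕ) (hb : 2 ≤ b) :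
    treeSize b l = ∑ i ∈ Finset.range l, b ^ i :=
  (Nat.geomSum_eq hb l).symm

/-- The full `b`-ary tree with `l` levels as a graph on the coordinates `0, …, n - 1`. The nodes are
numbered level by level, from left to right: the root is `0`, and the parent of `j ≠ 0` is
`(j - 1) / b`, so that the children of `i` are `b * i + 1, …, b * i + b`. -/
def fullTree (b l : ℕ) : SimpleGraph (Fin (treeSize b l)) :=
  SimpleGraph.fromRel (fun i j => j.val ≠ 0 ∧ i.val = (j.val - 1) / b)

/-- The family of all sets of at most `K` nodes that contain the root and are connected in the
full `b`-ary tree. -/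
def rootedSubtrees (b l K : ℕ) : Set (Finset (Fin (treeSize b l))) :=
  {S | S.card ≤ K ∧ (∃ r ∈ S, r.val = 0) ∧
    ((fullTree b l).induce (S : Set (Fin (treeSize b l)))).Connected}

/-- The `K`-tree-sparse vectors: those supported in a rooted subtree of at most `K` nodes. -/
def treeSparse (b l K : ℕ) : Set (Fin (treeSize b l) → ℝ) :=
  {x | ∃ S ∈ rootedSubtrees b l K, Function.support x ⊆ (S : Set (Fin (treeSize b l)))}

/-- The `ℓ1` norm. -/
def l1Norm {n : ℕ} (x : Fin n → ℝ) : ℝ := ∑ i, |x i|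

/-! ### The real RAM

A machine with random-access memory for natural numbers and for real numbers, running structured
programs. The real operations are the four exact field operations and comparison; natural numbers
serve as counters and addresses. There is no rounding of reals and no integer division. A program is
a finite object that mentions rational constants only. -/

namespace RealRAM

/-- A memory configuration: `nat a i` is cell `i` of the array `a` of natural numbers, `real a i` is
cell `i` of the array `a` of real numbers. -/
structure State where
  nat : ℕ → ℕ → ℕ
  real : ℕ → ℕ → ℝ

/-- Expressions for natural numbers. Array names are fixed in the program, addresses are computed. -/
inductive NExp where
  | const (k : ℕ) : NExp
  | load (a : ℕ) (i : NExp) : NExp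
  | add (e f : NExp) : NExp
  | sub (e f : NExp) : NExp
  | mul (e f : NExp) : NExp

/-- Expressions for real numbers. -/
inductive RExp where
  | const (q : ℚ) : RExp
  | load (a : ℕ) (i : NExp) : RExp
  | cast (e : NExp) : RExp
  | add (e f : RExp) : RExp
  | sub (e f : RExp) : RExp
  | mul (e f : RExp) : RExp
  | div (e f : RExp) : RExp

/-- Tests. -/
inductive Test where
  | natLE (e f : NExp) : Test
  | realLE (e f : RExp) : Test
  | neg (c : Test) : Test
  | conj (c d : Test) : Test

/-- The value of an expression; subtraction of natural numbers is truncated at `0`. -/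
def NExp.eval (s : State) : NExp → ℕ
  | .const k => k
  | .load a i => s.nat a (i.eval s)
  | .add e f => e.eval s + f.eval s
  | .sub e f => e.eval s - f.eval s
  | .mul e f => e.eval s * f.eval s

/-- The value of an expression; division by zero returns `0`. -/
noncomputable def RExp.eval (s : State) : RExp → ℝ
  | .const q => (q : ℝ)
  | .load a i => s.real a (i.eval s)
  | .cast e => (e.eval s : ℝ)
  | .add e f => e.eval s + f.eval s
  | .sub e f => e.eval s - f.eval s
  | .mul e f => e.eval s * f.eval s
  | .div e f => e.eval s / f.eval s

/-- The truth value of a test. -/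
def Test.eval (s : State) : Test → Prop
  | .natLE e f => e.eval s ≤ f.eval s
  | .realLE e f => e.eval s ≤ f.eval s
  | .neg c => ¬ c.eval s
  | .conj c d => c.eval s ∧ d.eval s

/-- The number of steps to evaluate an expression: one for every constant, memory access and
operation in it. -/
def NExp.cost : NExp → ℕ
  | .const _ => 1
  | .load _ i => i.cost + 1
  | .add e f => e.cost + f.cost + 1
  | .sub e f => e.cost + f.cost + 1
  | .mul e f => e.cost + f.cost + 1

/-- The number of steps to evaluate an expression. -/
def RExp.cost : RExp → ℕ
  | .const _ => 1
  | .load _ i => i.cost + 1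
  | .cast e => e.cost + 1
  | .add e f => e.cost + f.cost + 1
  | .sub e f => e.cost + f.cost + 1
  | .mul e f => e.cost + f.cost + 1
  | .div e f => e.cost + f.cost + 1

/-- The number of steps to evaluate a test. -/
def Test.cost : Test → ℕ
  | .natLE e f => e.cost + f.cost + 1
  | .realLE e f => e.cost + f.cost + 1
  | .neg c => c.cost + 1
  | .conj c d => c.cost + d.cost + 1

/-- Programs: no operation, assignment to a cell of an array of natural numbers or of real numbers
(`setNat a i e` is `a[i] := e`), sequential composition, case distinction, and `while` loops. -/
inductive Program where
  | skip : Program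
  | setNat (a : ℕ) (i e : NExp) : Program
  | setReal (a : ℕ) (i : NExp) (e : RExp) : Program
  | seq (p q : Program) : Program
  | cond (c : Test) (p q : Program) : Program
  | loop (c : Test) (p : Program) : Program

/-- The state after writing `v` into cell `i` of the natural-number array `a`. -/
def State.writeNat (s : State) (a i v : ℕ) : State :=
  { s with nat := Function.update s.nat a (Function.update (s.nat a) i v) }

/-- The state after writing `v` into cell `i` of the real array `a`. -/
noncomputable def State.writeReal (s : State) (a i : ℕ) (v : ℝ) : State :=
  { s with real := Function.update s.real a (Function.update (s.real a) i v) }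

/-- `Runs p s t s'`: started in state `s`, the program `p` halts after `t` steps in state `s'`. -/
inductive Runs : Program → State → ℕ → State → Prop where
  | skip (s : State) : Runs .skip s 1 s
  | setNat (s : State) (a : ℕ) (i e : NExp) :
      Runs (.setNat a i e) s (i.cost + e.cost + 1) (s.writeNat a (i.eval s) (e.eval s))
  | setReal (s : State) (a : ℕ) (i : NExp) (e : RExp) :
      Runs (.setReal a i e) s (i.cost + e.cost + 1) (s.writeReal a (i.eval s) (e.eval s))
  | seq (p q : Program) (s s₁ s₂ : State) (t₁ t₂ : ℕ) (h₁ : Runs p s t₁ s₁)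
      (h₂ : Runs q s₁ t₂ s₂) : Runs (.seq p q) s (t₁ + t₂) s₂
  | condTrue (c : Test) (p q : Program) (s s' : State) (t : ℕ) (hc : c.eval s)
      (h : Runs p s t s') : Runs (.cond c p q) s (c.cost + t) s'
  | condFalse (c : Test) (p q : Program) (s s' : State) (t : ℕ) (hc : ¬ c.eval s)
      (h : Runs q s t s') : Runs (.cond c p q) s (c.cost + t) s'
  | loopTrue (c : Test) (p : Program) (s s₁ s₂ : State) (t₁ t₂ : ℕ) (hc : c.eval s)
      (h₁ : Runs p s t₁ s₁) (h₂ : Runs (.loop c p) s₁ t₂ s₂) :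
      Runs (.loop c p) s (c.cost + t₁ + t₂) s₂
  | loopFalse (c : Test) (p : Program) (s : State) (hc : ¬ c.eval s) :
      Runs (.loop c p) s c.cost s

/-- The input of a recovery algorithm for tree-sparse signals. The natural-number array `0` holds
`b, l, n, K, m`; the real array `0` holds the measurement matrix row by row (the entry in row `i` and
column `j` is cell `i * n + j`); the real array `1` holds the sketch. All other cells are `0`. -/
noncomputable def input (b l K : ℕ) {m : ℕ} (A : Matrix (Fin m) (Fin (treeSize b l)) ℝ)
    (y : Fin m → ℝ) : State where
  nat := fun a i => if a = 0 then [b, l, treeSize b l, K, m].getD i 0 else 0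
  real := fun a i =>
    if a = 0 then
      if h : i < m * treeSize b l then
        A (Fin.divNat (⟨i, h⟩ : Fin (m * treeSize b l)))
          (Fin.modNat (⟨i, h⟩ : Fin (m * treeSize b l)))
      else 0
    else if a = 1 then
      if h : i < m then y ⟨i, h⟩ else 0
    else 0

/-- The output vector: the first `n` cells of the real array `2`. -/
def output (n : ℕ) (s : State) : Fin n → ℝ := fun i => s.real 2 i

end RealRAM

/-!
# Recovery of tree-sparse signals from `O(K)` measurements

*The matrix.* Let `S₀` be the top levels of the tree with at most `K` nodes in total, and let `L`
be the number of further levels, which is of order `log (n / K)`; since a subtree with `K` nodes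
has depth at most `K`, levels more than `K` below `S₀` are ignored. On the remaining columns the
matrix is a sign matrix with `O(K)` rows. There are only `2 ^ (b N)` rooted subtrees with at most
`N` nodes (`card_trees_le`), so that Rademacher concentration and a net argument give a sign
matrix with the restricted isometry property for all subtrees with `N = (8 + b) K` nodes
(`exists_treeRIP`).

*The algorithm.* `recoveryProg` runs a projected gradient iteration in which the projection is
penalised: with `u` the gradient step, the next candidate is the restriction of `u` to the subtree
`U` that maximises `∑ p ∈ U, (u p ^ 2 - λ)`. This subtree is found by one pass over the tree,
because the value of the best subtree at `p` is determined by the positive values at the children.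
The penalty `λ` is halved in each stage, and the iteration stops when the candidate is too large
or its residual exceeds `16 m K λ`; the output is the last candidate that passed.

*The error.* Write the sketch as `A x̄ + η` with `x̄` supported in a tree. As long as `m K λ`
dominates `‖η‖²`, the optimality of `U` and the restricted isometry property imply that the next
candidate passes as well (`pass_next`): a large part of `U` outside of the support of `x̄` would
contain a branch with between `K` and `b K` nodes (`exists_branch`), whose removal would pay off.
So the residual of the output is `O(‖η‖)`. For a subtree `S`, the vector `x̄` is the restriction
of `x` to `S`, to `S₀`, and to the paths from the `K / L` largest other entries up to `S₀`.
Cutting the rest of `x` into blocks of decreasing size bounds `‖η‖` by `√(m L / K)` times the `ℓ1`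
norm of `x` off `S` (`TreeRIP.nrm_app_le_of_abs_le`), and the factor `√L` is the one in the
theorem (`sum_abs_sub_le`).

*The running time.* The iteration need not stop by itself if the sketch can be fitted exactly, so
at the stages `0, 1, 3, 7, …` the program also solves the least squares problem on the current
support and stops if its residual vanishes. For integer signals the least squares residual,
multiplied by the Gram determinant, is an integer vector (`defect`), and the determinant is at
most `(4 K m) ^ (4 K)`; therefore an exact solution exists once `λ` has been halved `O(K log n)`
times (`enoughHalvings_of_int`). A stage takes `O(K n)` steps and a least squares problem takes
`O(K² n)` steps, but only logarithmically many of the latter are solved. For arbitrary real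
signals, a finite number of halvings suffices, since there are finitely many supports
(`exists_enoughHalvings`).
-/

/-! ### Total correctness with running times for the real RAM -/

namespace RealRAM

/-- The arrays of natural numbers to which a program may write. -/
def Program.modNat : Program → List ℕ
  | .skip => []
  | .setNat a _ _ => [a]
  | .setReal _ _ _ => []
  | .seq p q => p.modNat ++ q.modNat
  | .cond _ p q => p.modNat ++ q.modNat
  | .loop _ p => p.modNat

/-- The arrays of real numbers to which a program may write. -/
def Program.modReal : Program → List ℕ
  | .skip => []
  | .setNat _ _ _ => []
  | .setReal a _ _ => [a]
  | .seq p q => p.modReal ++ q.modReal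
  | .cond _ p q => p.modReal ++ q.modReal
  | .loop _ p => p.modReal

/-- `Agree N R s s'`: the states agree, except possibly on the arrays of natural numbers listed
in `N` and on the arrays of real numbers listed in `R`. -/
def Agree (N R : List ℕ) (s s' : State) : Prop :=
  (∀ a, a ∉ N → s'.nat a = s.nat a) ∧ (∀ a, a ∉ R → s'.real a = s.real a)

theorem Agree.refl (N R : List ℕ) (s : State) : Agree N R s s :=
  ⟨fun _ _ => rfl, fun _ _ => rfl⟩

theorem Agree.trans {N R : List ℕ} {s s' s'' : State} (h : Agree N R s s')
    (h' : Agree N R s' s'') : Agree N R s s'' :=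
  ⟨fun a ha => (h'.1 a ha).trans (h.1 a ha), fun a ha => (h'.2 a ha).trans (h.2 a ha)⟩

theorem Agree.mono {N R N' R' : List ℕ} {s s' : State} (h : Agree N R s s') (hN : N ⊆ N')
    (hR : R ⊆ R') : Agree N' R' s s' :=
  ⟨fun a ha => h.1 a fun h' => ha (hN h'), fun a ha => h.2 a fun h' => ha (hR h')⟩

theorem agree_writeNat (s : State) (a i v : ℕ) : Agree [a] [] s (s.writeNat a i v) := by
  refine ⟨fun c hc => ?_, fun _ _ => rfl⟩
  simp only [List.mem_singleton] at hc
  simp [State.writeNat, hc]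

theorem agree_writeReal (s : State) (a i : ℕ) (v : ℝ) : Agree [] [a] s (s.writeReal a i v) := by
  refine ⟨fun _ _ => rfl, fun c hc => ?_⟩
  simp only [List.mem_singleton] at hc
  simp [State.writeReal, hc]

theorem Runs.agree {p : Program} {s s' : State} {t : ℕ} (h : Runs p s t s') :
    Agree p.modNat p.modReal s s' := by
  induction h with
  | skip s => exact Agree.refl _ _ _
  | setNat s a i e => exact agree_writeNat _ _ _ _
  | setReal s a i e => exact agree_writeReal _ _ _ _
  | seq p q s s₁ s₂ t₁ t₂ h₁ h₂ ih₁ ih₂ =>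
    exact (ih₁.mono (by simp [Program.modNat]) (by simp [Program.modReal])).trans
      (ih₂.mono (by simp [Program.modNat]) (by simp [Program.modReal]))
  | condTrue c p q s s' t hc h ih =>
    exact ih.mono (by simp [Program.modNat]) (by simp [Program.modReal])
  | condFalse c p q s s' t hc h ih =>
    exact ih.mono (by simp [Program.modNat]) (by simp [Program.modReal])
  | loopTrue c p s s₁ s₂ t₁ t₂ hc h₁ h₂ ih₁ ih₂ => exact ih₁.trans ih₂
  | loopFalse c p s hc => exact Agree.refl _ _ _

/-- Started in `s`, the program `p` halts after at most `T` steps in a state satisfying `Q`. -/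
def Halts (p : Program) (s : State) (T : ℕ) (Q : State → Prop) : Prop :=
  ∃ t s', Runs p s t s' ∧ t ≤ T ∧ Q s'

theorem Halts.weaken {p : Program} {s : State} {T T' : ℕ} {Q Q' : State → Prop}
    (h : Halts p s T Q) (hT : T ≤ T')
    (hQ : ∀ s', Agree p.modNat p.modReal s s' → Q s' → Q' s') : Halts p s T' Q' := by
  obtain ⟨t, s', hr, ht, hq⟩ := h
  exact ⟨t, s', hr, ht.trans hT, hQ s' hr.agree hq⟩

theorem halts_skip {s : State} {T : ℕ} {Q : State → Prop} (hT : 1 ≤ T) (h : Q s) :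
    Halts .skip s T Q :=
  ⟨1, s, .skip s, hT, h⟩

theorem halts_setNat {s : State} {Q : State → Prop} {a T : ℕ} {i e : NExp}
    (hT : i.cost + e.cost + 1 ≤ T) (h : Q (s.writeNat a (i.eval s) (e.eval s))) :
    Halts (.setNat a i e) s T Q :=
  ⟨_, _, .setNat s a i e, hT, h⟩

theorem halts_setReal {s : State} {Q : State → Prop} {a T : ℕ} {i : NExp} {e : RExp}
    (hT : i.cost + e.cost + 1 ≤ T) (h : Q (s.writeReal a (i.eval s) (e.eval s))) :
    Halts (.setReal a i e) s T Q :=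
  ⟨_, _, .setReal s a i e, hT, h⟩

theorem halts_seq {p q : Program} {s : State} {T₁ T : ℕ} {Q R : State → Prop}
    (h₁ : Halts p s T₁ Q) (T₂ : ℕ) (hT : T₁ + T₂ ≤ T)
    (h₂ : ∀ s', Agree p.modNat p.modReal s s' → Q s' → Halts q s' T₂ R) :
    Halts (.seq p q) s T R := by
  obtain ⟨t₁, s₁, hr₁, ht₁, hq⟩ := h₁
  obtain ⟨t₂, s₂, hr₂, ht₂, hR⟩ := h₂ s₁ hr₁.agree hq
  exact ⟨_, s₂, .seq _ _ _ _ _ _ _ hr₁ hr₂, by omega, hR⟩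

/-- Assigning to a real variable, followed by another program. -/
theorem halts_setReal_seq {q : Program} {s : State} {T : ℕ} {R : State → Prop} {a : ℕ} {i : NExp}
    {e : RExp} (T₂ : ℕ) (hT : i.cost + e.cost + 1 + T₂ ≤ T)
    (h₂ : ∀ s', Agree [] [a] s s' →
      s'.real a = Function.update (s.real a) (i.eval s) (e.eval s) → Halts q s' T₂ R) :
    Halts (.seq (.setReal a i e) q) s T R :=
  halts_seq (halts_setReal le_rfl (Q := fun s' => s'.real a =
    Function.update (s.real a) (i.eval s) (e.eval s)) (by simp [State.writeReal])) T₂ hT h₂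

/-- Assigning to a variable for natural numbers, followed by another program. -/
theorem halts_setNat_seq {q : Program} {s : State} {T : ℕ} {R : State → Prop} {a : ℕ} {i : NExp}
    {e : NExp} (T₂ : ℕ) (hT : i.cost + e.cost + 1 + T₂ ≤ T)
    (h₂ : ∀ s', Agree [a] [] s s' →
      s'.nat a = Function.update (s.nat a) (i.eval s) (e.eval s) → Halts q s' T₂ R) :
    Halts (.seq (.setNat a i e) q) s T R :=
  halts_seq (halts_setNat le_rfl (Q := fun s' => s'.nat a =
    Function.update (s.nat a) (i.eval s) (e.eval s)) (by simp [State.writeNat])) T₂ hT h₂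

theorem halts_cond {c : Test} {p q : Program} {s : State} {T' : ℕ} {Q : State → Prop} (T : ℕ)
    (hT : c.cost + T ≤ T') (h₁ : c.eval s → Halts p s T Q) (h₂ : ¬ c.eval s → Halts q s T Q) :
    Halts (.cond c p q) s T' Q := by
  by_cases hc : c.eval s
  · obtain ⟨t, s', hr, ht, hq⟩ := h₁ hc
    exact ⟨_, s', .condTrue _ _ _ _ _ _ hc hr, by omega, hq⟩
  · obtain ⟨t, s', hr, ht, hq⟩ := h₂ hc
    exact ⟨_, s', .condFalse _ _ _ _ _ _ hc hr, by omega, hq⟩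

/-- The scalar variable of natural-number type named `a`: cell `0` of the array `a`. -/
abbrev nvar (a : ℕ) : NExp := .load a (.const 0)

/-- The scalar variable of real type named `a`: cell `0` of the array `a`. -/
abbrev rvar (a : ℕ) : RExp := .load a (.const 0)

/-- `for v = 0, …, e - 1 do p`; the loop counter `v` is a scalar variable. -/
def forLoop (v : ℕ) (e : NExp) (p : Program) : Program :=
  .seq (.setNat v (.const 0) (.const 0))
    (.loop (.natLE (.add (nvar v) (.const 1)) e)
      (.seq p (.setNat v (.const 0) (.add (nvar v) (.const 1)))))

/-- The invariant `I k` has to hold before the `k`-th iteration. It may not depend on the loop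
counter itself, whence the quantification over states that differ in the array `v`. -/
theorem halts_forLoop {v : ℕ} {e : NExp} {p : Program} {s : State} {N : ℕ} (T : ℕ)
    (I : ℕ → State → Prop) (hv : v ∉ p.modNat)
    (he : ∀ s', Agree (v :: p.modNat) p.modReal s s' → e.eval s' = N)
    (h0 : ∀ s', Agree [v] [] s s' → I 0 s')
    (hstep : ∀ k < N, ∀ s', Agree (v :: p.modNat) p.modReal s s' → s'.nat v 0 = k → I k s' →
      Halts p s' T (fun s'' => ∀ s₃, Agree [v] [] s'' s₃ → I (k + 1) s₃)) :
    Halts (forLoop v e p) s ((N + 1) * (T + e.cost + 20)) (I N) := by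
  have key : ∀ d k s', k + d = N → Agree (v :: p.modNat) p.modReal s s' → s'.nat v 0 = k →
      I k s' → Halts (.loop (.natLE (.add (nvar v) (.const 1)) e)
        (.seq p (.setNat v (.const 0) (.add (nvar v) (.const 1))))) s'
        ((d + 1) * (T + e.cost + 15)) (I N) := by
    intro d
    induction d with
    | zero =>
      intro k s' hk ha hvk hI
      refine ⟨_, s', .loopFalse _ _ _ ?_, ?_, ?_⟩
      · simp only [Test.eval, NExp.eval, he s' ha, hvk]; omega
      · simp only [Test.cost, NExp.cost]; omega
      · obtain rfl : k = N := by omega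
        exact hI
    | succ d ih =>
      intro k s' hk ha hvk hI
      obtain ⟨t, s₁, hr, ht, hq⟩ := hstep k (by omega) s' ha hvk hI
      have hv1 : s₁.nat v 0 = k := by rw [hr.agree.1 v hv, hvk]
      set s₂ := s₁.writeNat v 0 (k + 1) with hs₂
      have hr₂ : Runs (.setNat v (.const 0) (.add (nvar v) (.const 1))) s₁ 6 s₂ := by
        have := Runs.setNat s₁ v (.const 0) (.add (nvar v) (.const 1))
        simpa only [NExp.eval, hv1, NExp.cost] using this
      have ha₂ : Agree [v] [] s₁ s₂ := agree_writeNat _ _ _ _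
      obtain ⟨t', s₃, hr₃, ht₃, hI₃⟩ := ih (k + 1) s₂ (by omega)
        ((ha.trans (hr.agree.mono (by simp) (by simp))).trans (ha₂.mono (by simp) (by simp)))
        (by simp [hs₂, State.writeNat]) (hq s₂ ha₂)
      refine ⟨_, s₃, .loopTrue _ _ _ _ _ _ _ ?_ (.seq _ _ _ _ _ _ _ hr hr₂) hr₃, ?_, hI₃⟩
      · simp only [Test.eval, NExp.eval, he s' ha, hvk]; omega
      · simp only [Test.cost, NExp.cost]
        have : (d + 1 + 1) * (T + e.cost + 15) =
          (d + 1) * (T + e.cost + 15) + (T + e.cost + 15) := by ring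
        omega
  have hw : Halts (.setNat v (.const 0) (.const 0)) s 3
      (fun s' => s'.nat v 0 = 0) := halts_setNat le_rfl (by simp [State.writeNat, NExp.eval])
  refine halts_seq hw _ ?_ fun s' ha hs' => key N 0 s' (by omega)
    (ha.mono (by simp [Program.modNat]) (by simp [Program.modReal])) hs' (h0 s' ha)
  nlinarith

/-- `acc := acc + ∑ v < bound, e`. -/
def sumLoop (v : ℕ) (bound : NExp) (acc : ℕ) (e : RExp) : Program :=
  forLoop v bound (.setReal acc (.const 0) (.add (rvar acc) e))

theorem halts_sumLoop {v acc N : ℕ} {bound : NExp} {e : RExp} {s : State} (f : ℕ → ℝ)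
    (hb : ∀ s', Agree [v] [acc] s s' → bound.eval s' = N)
    (he : ∀ k < N, ∀ s', Agree [v] [acc] s s' → s'.nat v 0 = k → e.eval s' = f k) :
    Halts (sumLoop v bound acc e) s ((N + 1) * (e.cost + bound.cost + 30))
      (fun s' => s'.real acc 0 = s.real acc 0 + ∑ k ∈ Finset.range N, f k) := by
  refine (halts_forLoop (e.cost + 5)
    (fun k s' => s'.real acc 0 = s.real acc 0 + ∑ k ∈ Finset.range k, f k)
    (by simp [Program.modNat]) hb ?_ ?_).weaken ?_ fun _ _ h => h
  · intro s' h
    simp [h.2 acc (by simp)]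
  · intro k hk s' ha hv hI
    refine Halts.weaken (halts_setReal (Q := fun s'' =>
      s''.real acc 0 = s.real acc 0 + ∑ k ∈ Finset.range (k + 1), f k) le_rfl ?_) ?_ ?_
    · simp only [State.writeReal, NExp.eval, RExp.eval, Function.update_self]
      rw [hI, he k hk s' ha hv, Finset.sum_range_succ]; ring
    · simp only [NExp.cost, RExp.cost]; omega
    · intro s'' _ hq s₃ h₃
      rw [h₃.2 acc (by simp), hq]
  · apply Nat.mul_le_mul_left; omega

/-- A loop whose `k`-th iteration sets cell `off + k` of the array `arr` to `g k`. -/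
theorem halts_mapLoop {v arr N : ℕ} {bound : NExp} {p : Program} {s : State} (T off : ℕ)
    (g : ℕ → ℝ) (hv : v ∉ p.modNat)
    (hb : ∀ s', Agree (v :: p.modNat) p.modReal s s' → bound.eval s' = N)
    (hp : ∀ k < N, ∀ s', Agree (v :: p.modNat) p.modReal s s' → s'.nat v 0 = k →
      (∀ i, off + k ≤ i → s'.real arr i = s.real arr i) →
      Halts p s' T (fun s'' => s''.real arr = Function.update (s'.real arr) (off + k) (g k))) :
    Halts (forLoop v bound p) s ((N + 1) * (T + bound.cost + 20))
      (fun s' => (∀ k < N, s'.real arr (off + k) = g k) ∧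
        (∀ i, (i < off ∨ off + N ≤ i) → s'.real arr i = s.real arr i)) := by
  refine (halts_forLoop T (fun n s' => (∀ k < n, s'.real arr (off + k) = g k) ∧
        (∀ i, (i < off ∨ off + n ≤ i) → s'.real arr i = s.real arr i))
    hv hb ?_ ?_)
  · intro s' h
    refine ⟨fun k hk => by omega, fun i _ => by rw [h.2 arr (by simp)]⟩
  · intro k hk s' ha hvk hI
    refine (hp k hk s' ha hvk fun i hi => hI.2 i (.inr hi)).weaken le_rfl ?_
    intro s'' _ hq s₃ h₃
    rw [h₃.2 arr (by simp), hq]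
    refine ⟨fun j hj => ?_, fun i hi => ?_⟩
    · rcases Nat.lt_succ_iff_lt_or_eq.mp hj with hj | rfl
      · rw [Function.update_of_ne (by omega), hI.1 j hj]
      · rw [Function.update_self]
    · rw [Function.update_of_ne (by omega), hI.2 i (by omega)]

/-- `arr[ix] := e` for `v < bound`, where `ix` is `off + v`. -/
theorem halts_assignLoop {v arr N : ℕ} {bound ix : NExp} {e : RExp} {s : State} (off : ℕ)
    (g : ℕ → ℝ)
    (hb : ∀ s', Agree [v] [arr] s s' → bound.eval s' = N)
    (hix : ∀ k < N, ∀ s', Agree [v] [arr] s s' → s'.nat v 0 = k → ix.eval s' = off + k)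
    (he : ∀ k < N, ∀ s', Agree [v] [arr] s s' → s'.nat v 0 = k →
      (∀ i, off + k ≤ i → s'.real arr i = s.real arr i) → e.eval s' = g k) :
    Halts (forLoop v bound (.setReal arr ix e)) s
      ((N + 1) * (ix.cost + e.cost + bound.cost + 21))
      (fun s' => (∀ k < N, s'.real arr (off + k) = g k) ∧
        (∀ i, (i < off ∨ off + N ≤ i) → s'.real arr i = s.real arr i)) := by
  refine (halts_mapLoop (arr := arr) (ix.cost + e.cost + 1) off g
    (by simp [Program.modNat]) hb ?_).weaken ?_ fun _ _ h => h
  · intro k hk s' ha hvk hI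
    refine halts_setReal le_rfl ?_
    simp only [State.writeReal, Function.update_self, hix k hk s' ha hvk, he k hk s' ha hvk hI]
  · apply Nat.mul_le_mul_left; omega

end RealRAM

/-! ### The recovery program: residual, gradient step and tree projection -/

namespace RealRAM

/-- The arity of the tree, as stored in the input. -/
abbrev inB : NExp := .load 0 (.const 0)
/-- The number of nodes of the tree, as stored in the input. -/
abbrev inN : NExp := .load 0 (.const 2)
/-- The sparsity, as stored in the input. -/
abbrev inK : NExp := .load 0 (.const 3)
/-- The number of rows of the matrix, as stored in the input. -/
abbrev inM : NExp := .load 0 (.const 4)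

/-- The input cells of `s` hold the parameters `b, n, K, m`, the matrix `a` and the sketch `y`. -/
structure HasInput (b n K m : ℕ) (a : ℕ → ℕ → ℝ) (y : ℕ → ℝ) (s : State) : Prop where
  nb : s.nat 0 0 = b
  nn : s.nat 0 2 = n
  nK : s.nat 0 3 = K
  nm : s.nat 0 4 = m
  ra : ∀ i < m, ∀ j < n, s.real 0 (i * n + j) = a i j
  ry : ∀ i < m, s.real 1 i = y i

theorem HasInput.of_agree {b n K m : ℕ} {a : ℕ → ℕ → ℝ} {y : ℕ → ℝ} {s s' : State} {N R : List ℕ}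
    (h : HasInput b n K m a y s) (ha : Agree N R s s') (hN : 0 ∉ N) (h0 : 0 ∉ R) (h1 : 1 ∉ R) :
    HasInput b n K m a y s' := by
  constructor
  · rw [ha.1 0 hN, h.nb]
  · rw [ha.1 0 hN, h.nn]
  · rw [ha.1 0 hN, h.nK]
  · rw [ha.1 0 hN, h.nm]
  · rw [ha.2 0 h0]; exact h.ra
  · rw [ha.2 1 h1]; exact h.ry

/-- Computes the residual `y - A x` of the candidate `x` (real array `6`) in the real array `3`
and its squared norm in the real variable `12`. -/
def residualProg : Program :=
  .seq
    (forLoop 1 inM (.seq (.setReal 8 (.const 0) (.const 0))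
      (.seq (sumLoop 2 inN 8 (.mul (.load 0 (.add (.mul (nvar 1) inN) (nvar 2))) (.load 6 (nvar 2))))
        (.setReal 3 (nvar 1) (.sub (.load 1 (nvar 1)) (rvar 8))))))
    (.seq (.setReal 12 (.const 0) (.const 0))
      (sumLoop 1 inM 12 (.mul (.load 3 (nvar 1)) (.load 3 (nvar 1)))))

theorem halts_residualProg {b n K m : ℕ} {a : ℕ → ℕ → ℝ} {y : ℕ → ℝ} {s : State}
    (h : HasInput b n K m a y s) :
    Halts residualProg s (400 * (m + 1) * (n + 1)) (fun s' =>
      (∀ i < m, s'.real 3 i = y i - ∑ j ∈ Finset.range n, a i j * s.real 6 j) ∧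
      s'.real 12 0 =
        ∑ i ∈ Finset.range m, (y i - ∑ j ∈ Finset.range n, a i j * s.real 6 j) ^ 2) := by
  have inp : ∀ {s₁ s₂ N R}, HasInput b n K m a y s₁ → Agree N R s₁ s₂ → 0 ∉ N → 0 ∉ R → 1 ∉ R →
    HasInput b n K m a y s₂ := fun h ha => h.of_agree ha
  refine halts_seq (halts_mapLoop (N := m) (arr := 3) ((n + 1) * 60 + 20) 0
    (fun i => y i - ∑ j ∈ Finset.range n, a i j * s.real 6 j) (by decide)
    (fun s' ha => (inp h ha (by decide) (by decide) (by decide)).nm) ?_)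
    ((m + 1) * 100) ?_ ?_
  · intro k hk s' ha hv _
    have hin := inp h ha (by decide) (by decide) (by decide)
    refine halts_setReal_seq ((n + 1) * 60 + 15) (by simp only [NExp.cost, RExp.cost]; omega)
      fun s₁ ha₁ h8 => ?_
    have hin₁ := inp hin ha₁ (by decide) (by decide) (by decide)
    refine halts_seq (halts_sumLoop (N := n) (fun j => a k j * s.real 6 j)
      (fun s₂ ha₂ => (inp hin₁ ha₂ (by decide) (by decide) (by decide)).nn) ?_) 10
      (by simp only [NExp.cost, RExp.cost]; omega)
      fun s₂ ha₂ hs₂ => halts_setReal (by simp only [NExp.cost, RExp.cost]; omega) ?_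
    · intro j hj s₂ ha₂ hv₂
      have hin₂ := inp hin₁ ha₂ (by decide) (by decide) (by decide)
      simp only [RExp.eval, NExp.eval, hv₂]
      rw [ha₂.1 1 (by decide), ha₁.1 1 (by decide), hv, hin₂.nn, hin₂.ra k hk j hj,
        ha₂.2 6 (by decide), ha₁.2 6 (by decide), ha.2 6 (by decide)]
    · have hin₂ := inp hin₁ ha₂ (by decide) (by decide) (by decide)
      simp only [State.writeReal, Function.update_self, RExp.eval, NExp.eval]
      rw [ha₂.1 1 (by decide), ha₁.1 1 (by decide), hv, hin₂.ry k hk, hs₂, h8, zero_add,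
        ha₂.2 3 (by decide), ha₁.2 3 (by decide)]
      simp [NExp.eval, RExp.eval]
  · simp only [NExp.cost]; nlinarith
  · intro s' ha hs'
    have hin := inp h ha (by decide) (by decide) (by decide)
    have hr : ∀ i < m, s'.real 3 i = y i - ∑ j ∈ Finset.range n, a i j * s.real 6 j := by
      intro i hi
      simpa using hs'.1 i hi
    refine halts_setReal_seq ((m + 1) * 60) (by simp only [NExp.cost, RExp.cost]; omega)
      fun s₁ ha₁ h12 => ?_
    have hin₁ := inp hin ha₁ (by decide) (by decide) (by decide)
    refine Halts.weaken (halts_sumLoop (N := m) (fun i => s'.real 3 i * s'.real 3 i)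
      (fun s₂ ha₂ => (inp hin₁ ha₂ (by decide) (by decide) (by decide)).nm) ?_) ?_ ?_
    · intro k hk s₂ ha₂ hv₂
      simp only [RExp.eval, NExp.eval, hv₂]
      rw [ha₂.2 3 (by decide), ha₁.2 3 (by decide)]
    · simp only [NExp.cost, RExp.cost]; omega
    · intro s₂ ha₂ hs₂
      refine ⟨fun i hi => ?_, ?_⟩
      · rw [ha₂.2 3 (by decide), ha₁.2 3 (by decide), hr i hi]
      · rw [hs₂, h12]
        simp only [NExp.eval, RExp.eval, Function.update_self, Rat.cast_zero, zero_add]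
        refine Finset.sum_congr rfl fun i hi => ?_
        rw [hr i (Finset.mem_range.mp hi), sq]

/-- Computes the gradient step `u = x + Aᵀ r / m` in the real array `4`, where `x` is the candidate
and `r` its residual. -/
def gradientProg : Program :=
  forLoop 1 inN (.seq (.setReal 8 (.const 0) (.const 0))
    (.seq (sumLoop 2 inM 8 (.mul (.load 0 (.add (.mul (nvar 2) inN) (nvar 1))) (.load 3 (nvar 2))))
      (.setReal 4 (nvar 1) (.add (.load 6 (nvar 1)) (.div (rvar 8) (.cast inM))))))

theorem halts_gradientProg {b n K m : ℕ} {a : ℕ → ℕ → ℝ} {y : ℕ → ℝ} {s : State}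
    (h : HasInput b n K m a y s) :
    Halts gradientProg s (200 * (m + 1) * (n + 1)) (fun s' => ∀ j < n,
      s'.real 4 j = s.real 6 j + (∑ i ∈ Finset.range m, a i j * s.real 3 i) / m) := by
  have inp : ∀ {s₁ s₂ N R}, HasInput b n K m a y s₁ → Agree N R s₁ s₂ → 0 ∉ N → 0 ∉ R → 1 ∉ R →
    HasInput b n K m a y s₂ := fun h ha => h.of_agree ha
  refine Halts.weaken (halts_mapLoop (N := n) (arr := 4) ((m + 1) * 60 + 40) 0
    (fun j => s.real 6 j + (∑ i ∈ Finset.range m, a i j * s.real 3 i) / m) (by decide)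
    (fun s' ha => (inp h ha (by decide) (by decide) (by decide)).nn) ?_) ?_
    (fun s' _ hs' j hj => by simpa using hs'.1 j hj)
  · intro k hk s' ha hv _
    have hin := inp h ha (by decide) (by decide) (by decide)
    refine halts_setReal_seq ((m + 1) * 60 + 25) (by simp only [NExp.cost, RExp.cost]; omega)
      fun s₁ ha₁ h8 => ?_
    have hin₁ := inp hin ha₁ (by decide) (by decide) (by decide)
    refine halts_seq (halts_sumLoop (N := m) (fun i => a i k * s.real 3 i)
      (fun s₂ ha₂ => (inp hin₁ ha₂ (by decide) (by decide) (by decide)).nm) ?_) 20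
      (by simp only [NExp.cost, RExp.cost]; omega)
      fun s₂ ha₂ hs₂ => halts_setReal (by simp only [NExp.cost, RExp.cost]; omega) ?_
    · intro j hj s₂ ha₂ hv₂
      have hin₂ := inp hin₁ ha₂ (by decide) (by decide) (by decide)
      simp only [RExp.eval, NExp.eval, hv₂]
      rw [ha₂.1 1 (by decide), ha₁.1 1 (by decide), hv, hin₂.nn, hin₂.ra j hj k hk,
        ha₂.2 3 (by decide), ha₁.2 3 (by decide), ha.2 3 (by decide)]
    · have hin₂ := inp hin₁ ha₂ (by decide) (by decide) (by decide)
      simp only [State.writeReal, Function.update_self, RExp.eval, NExp.eval]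
      rw [ha₂.1 1 (by decide), ha₁.1 1 (by decide), hv, hin₂.nm, hs₂, h8,
        ha₂.2 4 (by decide), ha₁.2 4 (by decide), ha₂.2 6 (by decide), ha₁.2 6 (by decide),
        ha.2 6 (by decide)]
      simp [NExp.eval, RExp.eval]
  · simp only [NExp.cost]; nlinarith

/-- The node visited in the `v`-th iteration of the bottom-up pass over the tree. -/
abbrev upNode : NExp := .sub (.sub inN (.const 1)) (nvar 1)

/-- The child number `j` (the scalar variable `2`) of the node `p`. -/
abbrev childOf (p : NExp) : NExp := .add (.add (.mul inB p) (.const 1)) (nvar 2)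

/-- The bottom-up pass: the value of a node is its gain `u p ^ 2 - λ` plus the positive values of
its children. -/
def valueProg : Program :=
  forLoop 1 inN (.seq
    (.setReal 8 (.const 0) (.sub (.mul (.load 4 upNode) (.load 4 upNode)) (rvar 7)))
    (.seq (forLoop 2 inB (.cond (.conj (.natLE (.add (childOf upNode) (.const 1)) inN)
        (.neg (.realLE (.load 5 (childOf upNode)) (.const 0))))
      (.setReal 8 (.const 0) (.add (rvar 8) (.load 5 (childOf upNode)))) .skip))
      (.setReal 5 upNode (rvar 8))))

theorem halts_valueProg {b n K m : ℕ} {a : ℕ → ℕ → ℝ} {y : ℕ → ℝ} {s : State}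
    (h : HasInput b n K m a y s) :
    Halts valueProg s (400 * (b + 1) * (n + 1)) (fun s' => ∀ p < n,
      s'.real 5 p = s.real 4 p ^ 2 - s.real 7 0 + ∑ c ∈ Finset.range b,
        if b * p + 1 + c < n then max 0 (s'.real 5 (b * p + 1 + c)) else 0) := by
  have inp : ∀ {s₁ s₂ N R}, HasInput b n K m a y s₁ → Agree N R s₁ s₂ → 0 ∉ N → 0 ∉ R → 1 ∉ R →
    HasInput b n K m a y s₂ := fun h ha => h.of_agree ha
  refine Halts.weaken (halts_forLoop (N := n) ((b + 1) * 120 + 60)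
    (fun k s' => ∀ p, n ≤ p + k → p < n →
      s'.real 5 p = s.real 4 p ^ 2 - s.real 7 0 + ∑ c ∈ Finset.range b,
        if b * p + 1 + c < n then max 0 (s'.real 5 (b * p + 1 + c)) else 0) (by decide)
    (fun s' ha => (inp h ha (by decide) (by decide) (by decide)).nn)
    (fun s' _ p hp hp' => by omega) ?_) ?_ (fun s' _ hs' p hp => hs' p (by omega) hp)
  · intro k hk s' ha hv hI
    obtain ⟨p, hp⟩ : ∃ p, p = n - 1 - k := ⟨_, rfl⟩
    have hpn : p < n := by omega
    have hin := inp h ha (by decide) (by decide) (by decide)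
    refine halts_setReal_seq ((b + 1) * 120 + 30) (by simp only [NExp.cost, RExp.cost]; omega)
      fun s₁ ha₁ h8 => ?_
    have hin₁ := inp hin ha₁ (by decide) (by decide) (by decide)
    have h8' : s₁.real 8 0 = s.real 4 p ^ 2 - s.real 7 0 := by
      rw [h8]
      simp only [NExp.eval, RExp.eval, Function.update_self]
      rw [hin.nn, hv, ha.2 4 (by decide), ha.2 7 (by decide), ← hp, sq]
    refine halts_seq (halts_forLoop (N := b) 80
      (fun j s₂ => s₂.real 8 0 = s.real 4 p ^ 2 - s.real 7 0 + ∑ c ∈ Finset.range j,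
        if b * p + 1 + c < n then max 0 (s'.real 5 (b * p + 1 + c)) else 0) (by decide)
      (fun s₂ ha₂ => (inp hin₁ ha₂ (by decide) (by decide) (by decide)).nb) ?_ ?_) 20
      (by simp only [NExp.cost]; omega)
      fun s₂ ha₂ hs₂ => halts_setReal (by simp only [NExp.cost, RExp.cost]; omega) ?_
    · intro s₂ ha₂
      rw [ha₂.2 8 (by decide), h8']; simp
    · intro j hj s₂ ha₂ hv₂ hI₂
      have hin₂ := inp hin₁ ha₂ (by decide) (by decide) (by decide)
      have hnode : upNode.eval s₂ = p := by
        simp only [NExp.eval]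
        rw [hin₂.nn, ha₂.1 1 (by decide), ha₁.1 1 (by decide), hv, hp]
      have hchild : (childOf upNode).eval s₂ = b * p + 1 + j := by
        simp only [NExp.eval] at hnode ⊢
        rw [hnode, hin₂.nb, hv₂]
      have hw : s₂.real 5 = s'.real 5 := by rw [ha₂.2 5 (by decide), ha₁.2 5 (by decide)]
      have htest : Test.eval s₂ (.conj (.natLE (.add (childOf upNode) (.const 1)) inN)
          (.neg (.realLE (.load 5 (childOf upNode)) (.const 0)))) ↔
          b * p + 1 + j < n ∧ 0 < s'.real 5 (b * p + 1 + j) := by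
        have e1 : NExp.eval s₂ (.add (childOf upNode) (.const 1)) = b * p + 1 + j + 1 := by
          rw [NExp.eval, hchild]; rfl
        have e2 : RExp.eval s₂ (.load 5 (childOf upNode)) = s'.real 5 (b * p + 1 + j) := by
          rw [RExp.eval, hchild, hw]
        have e3 : NExp.eval s₂ inN = n := hin₂.nn
        simp only [Test.eval]
        rw [e1, e2, e3]
        simp [RExp.eval]
      refine halts_cond 40 (by simp only [NExp.cost, RExp.cost, Test.cost]; omega)
        (fun hc => halts_setReal (by simp only [NExp.cost, RExp.cost]; omega) ?_)
        fun hc => halts_skip (by omega) ?_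
      · rw [htest] at hc
        intro s₃ ha₃
        rw [ha₃.2 8 (by decide), RExp.eval, RExp.eval, RExp.eval, hchild, hw,
          Finset.sum_range_succ, if_pos hc.1, max_eq_right hc.2.le, ← add_assoc, ← hI₂]
        simp [State.writeReal, NExp.eval]
      · rw [htest] at hc
        intro s₃ ha₃
        rw [ha₃.2 8 (by decide), hI₂, Finset.sum_range_succ]
        split_ifs with hlt
        · rw [max_eq_left (not_lt.mp fun h => hc ⟨hlt, h⟩), add_zero]
        · rw [add_zero]
    · have hin₂ := inp hin₁ ha₂ (by decide) (by decide) (by decide)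
      have hnode : upNode.eval s₂ = p := by
        simp only [NExp.eval]
        rw [hin₂.nn, ha₂.1 1 (by decide), ha₁.1 1 (by decide), hv, hp]
      intro s₃ ha₃ q hq hqn
      have h5 : s₃.real 5 = Function.update (s'.real 5) p (s.real 4 p ^ 2 - s.real 7 0 +
          ∑ c ∈ Finset.range b,
            if b * p + 1 + c < n then max 0 (s'.real 5 (b * p + 1 + c)) else 0) := by
        rw [ha₃.2 5 (by decide), hnode]
        simp only [State.writeReal, Function.update_self, RExp.eval, NExp.eval]
        rw [hs₂, ha₂.2 5 (by decide), ha₁.2 5 (by decide)]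
      have hb : ∀ q c, p ≤ q → c ∈ Finset.range b → b * q + 1 + c ≠ p := by
        intro q c hq hc
        have : 1 * q ≤ b * q := Nat.mul_le_mul_right _ (by
          have := Finset.mem_range.mp hc; omega)
        omega
      rw [h5]
      rcases eq_or_ne q p with rfl | hne
      · rw [Function.update_self]
        congr 1
        refine Finset.sum_congr rfl fun c hc => ?_
        rw [Function.update_of_ne (hb q c le_rfl hc)]
      · rw [Function.update_of_ne hne, hI q (by omega) hqn]
        congr 1
        refine Finset.sum_congr rfl fun c hc => ?_
        rw [Function.update_of_ne (hb q c (by omega) hc)]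
  · simp only [NExp.cost]; nlinarith

/-- The top-down pass: a node is selected (flag in the array `4` of natural numbers) if its value
and the values of all its ancestors are positive. -/
def selectProg : Program :=
  .seq (.cond (.realLE (.load 5 (.const 0)) (.const 0)) (.setNat 4 (.const 0) (.const 0))
      (.setNat 4 (.const 0) (.const 1)))
    (forLoop 1 inN (forLoop 2 inB (.cond (.conj (.natLE (.const 1) (.load 4 (nvar 1)))
        (.conj (.natLE (.add (childOf (nvar 1)) (.const 1)) inN)
          (.neg (.realLE (.load 5 (childOf (nvar 1))) (.const 0)))))
      (.setNat 4 (childOf (nvar 1)) (.const 1)) (.setNat 4 (childOf (nvar 1)) (.const 0)))))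

theorem halts_selectProg {b n K m : ℕ} {a : ℕ → ℕ → ℝ} {y : ℕ → ℝ} {s : State}
    (h : HasInput b n K m a y s) :
    Halts selectProg s (400 * (b + 1) * (n + 1)) (fun s' =>
      (1 ≤ s'.nat 4 0 ↔ 0 < s.real 5 0) ∧ ∀ p < n, ∀ c < b, (1 ≤ s'.nat 4 (b * p + 1 + c) ↔
        1 ≤ s'.nat 4 p ∧ b * p + 1 + c < n ∧ 0 < s.real 5 (b * p + 1 + c))) := by
  have inp : ∀ {s₁ s₂ N R}, HasInput b n K m a y s₁ → Agree N R s₁ s₂ → 0 ∉ N → 0 ∉ R → 1 ∉ R →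
    HasInput b n K m a y s₂ := fun h ha => h.of_agree ha
  refine halts_seq (Q := fun s' => 1 ≤ s'.nat 4 0 ↔ 0 < s.real 5 0) (T₁ := 20)
    (halts_cond 10 (by simp only [NExp.cost, RExp.cost, Test.cost]; omega)
    (fun hc => halts_setNat (by simp only [NExp.cost]; omega) ?_)
    fun hc => halts_setNat (by simp only [NExp.cost]; omega) ?_)
    ((n + 1) * ((b + 1) * 150 + 40)) (by nlinarith) ?_
  · simp only [Test.eval, RExp.eval, NExp.eval, Rat.cast_zero] at hc
    simp [State.writeNat, NExp.eval, hc]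
  · simp only [Test.eval, RExp.eval, NExp.eval, Rat.cast_zero] at hc
    simpa [State.writeNat, NExp.eval] using hc
  intro s₀ ha₀ hs₀
  have hin₀ := inp h ha₀ (by decide) (by decide) (by decide)
  have hw₀ : s₀.real 5 = s.real 5 := ha₀.2 5 (by decide)
  refine Halts.weaken (halts_forLoop (N := n) ((b + 1) * 150)
    (fun k s' => (1 ≤ s'.nat 4 0 ↔ 0 < s.real 5 0) ∧ ∀ p < k, ∀ c < b,
      (1 ≤ s'.nat 4 (b * p + 1 + c) ↔
        1 ≤ s'.nat 4 p ∧ b * p + 1 + c < n ∧ 0 < s.real 5 (b * p + 1 + c))) (by decide)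
    (fun s' ha => (inp hin₀ ha (by decide) (by decide) (by decide)).nn)
    (fun s' ha => ⟨by rw [ha.1 4 (by decide), hs₀], fun p hp => by omega⟩) ?_) ?_
    (fun s' _ hs' => hs')
  · intro k hk s' ha hv hI
    have hin := inp hin₀ ha (by decide) (by decide) (by decide)
    refine Halts.weaken (halts_forLoop (N := b) 80
      (fun j s₂ => (1 ≤ s₂.nat 4 0 ↔ 0 < s.real 5 0) ∧ (∀ p < k, ∀ c < b,
      (1 ≤ s₂.nat 4 (b * p + 1 + c) ↔
        1 ≤ s₂.nat 4 p ∧ b * p + 1 + c < n ∧ 0 < s.real 5 (b * p + 1 + c))) ∧ ∀ c < j,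
      (1 ≤ s₂.nat 4 (b * k + 1 + c) ↔
        1 ≤ s₂.nat 4 k ∧ b * k + 1 + c < n ∧ 0 < s.real 5 (b * k + 1 + c))) (by decide)
      (fun s₂ ha₂ => (inp hin ha₂ (by decide) (by decide) (by decide)).nb)
      (fun s₂ ha₂ => ⟨by rw [ha₂.1 4 (by decide), hI.1],
        by rw [ha₂.1 4 (by decide)]; exact hI.2, fun c hc => by omega⟩) ?_) ?_ ?_
    · intro j hj s₂ ha₂ hv₂ hI₂
      have hin₂ := inp hin ha₂ (by decide) (by decide) (by decide)
      have hnode : s₂.nat 1 0 = k := by rw [ha₂.1 1 (by decide), hv]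
      have hchild : (childOf (nvar 1)).eval s₂ = b * k + 1 + j := by
        simp only [NExp.eval]
        rw [hnode, hin₂.nb, hv₂]
      have htest : Test.eval s₂ (.conj (.natLE (.const 1) (.load 4 (nvar 1)))
        (.conj (.natLE (.add (childOf (nvar 1)) (.const 1)) inN)
          (.neg (.realLE (.load 5 (childOf (nvar 1))) (.const 0))))) ↔
          1 ≤ s₂.nat 4 k ∧ b * k + 1 + j < n ∧ 0 < s.real 5 (b * k + 1 + j) := by
        have e1 : NExp.eval s₂ (.add (childOf (nvar 1)) (.const 1)) = b * k + 1 + j + 1 := by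
          rw [NExp.eval, hchild]; rfl
        have e2 : RExp.eval s₂ (.load 5 (childOf (nvar 1))) = s.real 5 (b * k + 1 + j) := by
          rw [RExp.eval, hchild, ha₂.2 5 (by decide), ha.2 5 (by decide), hw₀]
        have e3 : NExp.eval s₂ inN = n := hin₂.nn
        have e4 : NExp.eval s₂ (.load 4 (nvar 1)) = s₂.nat 4 k := by
          simp only [NExp.eval]; rw [hnode]
        simp only [Test.eval]
        rw [e1, e2, e3, e4]
        simp [RExp.eval, NExp.eval, Nat.succ_le_iff]
      have hb1 : k ≤ b * k := Nat.le_mul_of_pos_left _ (by omega)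
      have hb2 : ∀ p < k, b * p + b ≤ b * k := fun p hp => by
        calc b * p + b = b * (p + 1) := by ring
          _ ≤ b * k := Nat.mul_le_mul_left _ hp
      have main : ∀ (f : ℕ → ℕ) (x : ℕ),
          f = Function.update (s₂.nat 4) (b * k + 1 + j) x →
          (1 ≤ x ↔ 1 ≤ s₂.nat 4 k ∧ b * k + 1 + j < n ∧ 0 < s.real 5 (b * k + 1 + j)) →
          (1 ≤ f 0 ↔ 0 < s.real 5 0) ∧ (∀ p < k, ∀ c < b,
          (1 ≤ f (b * p + 1 + c) ↔
            1 ≤ f p ∧ b * p + 1 + c < n ∧ 0 < s.real 5 (b * p + 1 + c))) ∧ ∀ c < j + 1,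
          (1 ≤ f (b * k + 1 + c) ↔
            1 ≤ f k ∧ b * k + 1 + c < n ∧ 0 < s.real 5 (b * k + 1 + c)) := by
        rintro f x rfl hx
        refine ⟨?_, fun p hp c hc => ?_, fun c hc => ?_⟩
        · rw [Function.update_of_ne (by omega), hI₂.1]
        · have := hb2 p hp
          rw [Function.update_of_ne (by omega), Function.update_of_ne (by omega),
            hI₂.2.1 p hp c hc]
        · rw [Function.update_of_ne (show k ≠ b * k + 1 + j by omega)]
          rcases Nat.lt_succ_iff_lt_or_eq.mp hc with hc | rfl
          · rw [Function.update_of_ne (by omega), hI₂.2.2 c hc]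
          · rw [Function.update_self, hx]
      refine halts_cond 40 (by simp only [NExp.cost, RExp.cost, Test.cost]; omega)
        (fun hc => halts_setNat (by simp only [NExp.cost]; omega) ?_)
        fun hc => halts_setNat (by simp only [NExp.cost]; omega) ?_
      · intro s₃ ha₃
        refine main _ 1 ?_ (by simpa using htest.mp hc)
        rw [ha₃.1 4 (by decide), hchild]
        simp [State.writeNat, NExp.eval]
      · intro s₃ ha₃
        refine main _ 0 ?_ ⟨fun h => by omega, fun h => absurd (htest.mpr h) hc⟩
        rw [ha₃.1 4 (by decide), hchild]
        simp [State.writeNat, NExp.eval]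
    · simp only [NExp.cost]; omega
    · intro s₂ ha₂ hs₂ s₃ ha₃
      rw [ha₃.1 4 (by decide)]
      refine ⟨hs₂.1, fun p hp => ?_⟩
      rcases Nat.lt_succ_iff_lt_or_eq.mp hp with hp | rfl
      · exact hs₂.2.1 p hp
      · exact hs₂.2.2
  · simp only [NExp.cost]; apply Nat.mul_le_mul_left; omega

/-- Collects the selected nodes in the list `5` of length `6` and writes the new candidate, which
is the restriction of the gradient step to the selected nodes. -/
def collectProg : Program :=
  .seq (.setNat 6 (.const 0) (.const 0))
    (forLoop 1 inN (.cond (.natLE (.const 1) (.load 4 (nvar 1)))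
      (.seq (.setReal 6 (nvar 1) (.load 4 (nvar 1)))
        (.seq (.setNat 5 (nvar 6) (nvar 1)) (.setNat 6 (.const 0) (.add (nvar 6) (.const 1)))))
      (.setReal 6 (nvar 1) (.const 0))))

/-- The list `5` of length `6` enumerates the finite set `U`. -/
structure Lists (U : Finset ℕ) (s : State) : Prop where
  card : s.nat 6 0 = U.card
  mem : ∀ k < U.card, s.nat 5 k ∈ U
  surj : ∀ p ∈ U, ∃ k < U.card, s.nat 5 k = p

theorem Lists.of_agree {U : Finset ℕ} {s s' : State} {N R : List ℕ} (h : Lists U s)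
    (ha : Agree N R s s') (h5 : 5 ∉ N) (h6 : 6 ∉ N) : Lists U s' := by
  constructor
  · rw [ha.1 6 h6, h.card]
  · rw [ha.1 5 h5]; exact h.mem
  · rw [ha.1 5 h5]; exact h.surj

theorem halts_collectProg {b n K m : ℕ} {a : ℕ → ℕ → ℝ} {y : ℕ → ℝ} {s : State}
    (h : HasInput b n K m a y s) :
    Halts collectProg s (100 * (n + 1)) (fun s' =>
      Lists ((Finset.range n).filter fun p => 1 ≤ s.nat 4 p) s' ∧
      ∀ p < n, s'.real 6 p = if 1 ≤ s.nat 4 p then s.real 4 p else 0) := by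
  have inp : ∀ {s₁ s₂ N R}, HasInput b n K m a y s₁ → Agree N R s₁ s₂ → 0 ∉ N → 0 ∉ R → 1 ∉ R →
    HasInput b n K m a y s₂ := fun h ha => h.of_agree ha
  refine halts_setNat_seq ((n + 1) * 80) (by simp only [NExp.cost]; omega) fun s₀ ha₀ h6 => ?_
  have hin₀ := inp h ha₀ (by decide) (by decide) (by decide)
  refine Halts.weaken (halts_forLoop (N := n) 50
    (fun k s' => Lists ((Finset.range k).filter fun p => 1 ≤ s.nat 4 p) s' ∧
      ∀ p < k, s'.real 6 p = if 1 ≤ s.nat 4 p then s.real 4 p else 0) (by decide)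
    (fun s' ha => (inp hin₀ ha (by decide) (by decide) (by decide)).nn)
    (fun s' ha => ⟨⟨?_, by simp, by simp⟩, fun p hp => by omega⟩) ?_) ?_
    (fun s' _ hs' => hs')
  · rw [ha.1 6 (by decide), h6]; simp [NExp.eval]
  · intro k hk s' ha hv hI
    have hin := inp hin₀ ha (by decide) (by decide) (by decide)
    have h4 : s'.nat 4 = s.nat 4 := by rw [ha.1 4 (by decide), ha₀.1 4 (by decide)]
    have hu : s'.real 4 = s.real 4 := by rw [ha.2 4 (by decide), ha₀.2 4 (by decide)]
    have htest : Test.eval s' (.natLE (.const 1) (.load 4 (nvar 1))) ↔ 1 ≤ s.nat 4 k := by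
      simp only [Test.eval, NExp.eval]; rw [hv, h4]
    have hx : ∀ x : ℝ, x = (if 1 ≤ s.nat 4 k then s.real 4 k else 0) → ∀ p < k + 1,
        Function.update (s'.real 6) k x p = if 1 ≤ s.nat 4 p then s.real 4 p else 0 := by
      rintro x rfl p hp
      rcases Nat.lt_succ_iff_lt_or_eq.mp hp with hp | rfl
      · rw [Function.update_of_ne (by omega), hI.2 p hp]
      · rw [Function.update_self]
    refine halts_cond 40 (by simp only [NExp.cost, Test.cost]; omega)
      (fun hc => halts_setReal_seq 30 (by simp only [NExp.cost, RExp.cost]; omega)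
        fun s₁ ha₁ h₁ => halts_setNat_seq 15 (by simp only [NExp.cost]; omega)
        fun s₂ ha₂ h₂ => halts_setNat (by simp only [NExp.cost]; omega) ?_)
      fun hc => halts_setReal (by simp only [NExp.cost, RExp.cost]; omega) ?_
    · rw [htest] at hc
      have hcard := hI.1.card
      set U := (Finset.range k).filter fun p => 1 ≤ s.nat 4 p with hU
      have hU' : ((Finset.range (k + 1)).filter fun p => 1 ≤ s.nat 4 p) = insert k U := by
        rw [Finset.range_add_one, Finset.filter_insert, if_pos hc]
      have hkU : k ∉ U := by simp [hU]
      intro s₃ ha₃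
      have e5 : s₃.nat 5 = Function.update (s'.nat 5) U.card k := by
        rw [ha₃.1 5 (by decide), (agree_writeNat _ _ _ _).1 5 (by decide), h₂]
        simp only [NExp.eval]
        rw [ha₁.1 5 (by decide), ha₁.1 6 (by decide), ha₁.1 1 (by decide), hcard, hv]
      refine ⟨⟨?_, ?_, ?_⟩, ?_⟩
      · rw [hU', Finset.card_insert_of_notMem hkU, ha₃.1 6 (by decide), ← hcard]
        simp only [State.writeNat, Function.update_self, NExp.eval]
        rw [ha₂.1 6 (by decide), ha₁.1 6 (by decide)]
      · intro j hj
        rw [hU', Finset.card_insert_of_notMem hkU] at hj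
        rw [hU', e5]
        rcases Nat.lt_succ_iff_lt_or_eq.mp hj with hj | rfl
        · rw [Function.update_of_ne (by omega)]
          exact Finset.mem_insert_of_mem (hI.1.mem j hj)
        · rw [Function.update_self]; exact Finset.mem_insert_self _ _
      · intro p hp
        rw [hU', Finset.card_insert_of_notMem hkU, e5]
        rw [hU', Finset.mem_insert] at hp
        rcases hp with rfl | hp
        · exact ⟨U.card, by omega, Function.update_self _ _ _⟩
        · obtain ⟨j, hj, rfl⟩ := hI.1.surj p hp
          exact ⟨j, by omega, Function.update_of_ne (by omega) _ _⟩
      · rw [ha₃.2 6 (by decide), (agree_writeNat _ _ _ _).2 6 (by decide), ha₂.2 6 (by decide), h₁]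
        simp only [NExp.eval, RExp.eval]
        rw [hv, hu]
        exact hx _ (by rw [if_pos hc])
    · rw [htest] at hc
      have hU' : ((Finset.range (k + 1)).filter fun p => 1 ≤ s.nat 4 p) =
          (Finset.range k).filter fun p => 1 ≤ s.nat 4 p := by
        rw [Finset.range_add_one, Finset.filter_insert, if_neg hc]
      intro s₃ ha₃
      rw [hU']
      refine ⟨(hI.1.of_agree (agree_writeReal _ _ _ _) (by decide) (by decide)).of_agree ha₃
        (by decide) (by decide), ?_⟩
      rw [ha₃.2 6 (by decide)]
      simp only [State.writeReal, Function.update_self, NExp.eval, RExp.eval]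
      rw [hv]
      exact hx _ (by rw [if_neg hc]; simp)
  · simp only [NExp.cost]; omega

end RealRAM

/-! ### The recovery program: exact least squares -/

namespace RealRAM

/-- Entry `j` (the scalar variable `2`) of row number `k` of the array `9`, whose rows have length
`m + n`. -/
abbrev rowEntry (k : NExp) : RExp :=
  .load 9 (.add (.mul k (.add inM inN)) (nvar 2))

/-- Makes the first `m` entries of the current vector (array `10`) orthogonal to those of the rows
of the array `9` with number less than `e`, by one pass of Gram-Schmidt elimination. The remaining
`n` entries follow along and record which linear combination was formed. -/
def reduceProg (e : NExp) : Program :=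
  forLoop 3 e (.seq (.setReal 11 (.const 0) (.const 0))
    (.seq (sumLoop 2 inM 11 (.mul (.load 10 (nvar 2)) (rowEntry (nvar 3))))
    (.seq (.setReal 13 (.const 0) (.const 0))
    (.seq (sumLoop 2 inM 13 (.mul (rowEntry (nvar 3)) (rowEntry (nvar 3))))
      (forLoop 2 (.add inM inN) (.setReal 10 (nvar 2)
        (.sub (.load 10 (nvar 2)) (.mul (.div (rvar 11) (rvar 13)) (rowEntry (nvar 3))))))))))

theorem halts_reduceProg {b n K m N : ℕ} {a : ℕ → ℕ → ℝ} {y : ℕ → ℝ} {s : State} {e : NExp}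
    (h : HasInput b n K m a y s) (v : ℕ → ℕ → ℝ) (hcost : e.cost ≤ 2)
    (he : ∀ s', Agree [3, 2] [11, 13, 10] s s' → e.eval s' = N)
    (hv : ∀ k < N, ∀ i < m + n, s.real 9 (k * (m + n) + i) = v k i)
    (horth : ∀ k < N, ∀ k' < k, ∑ i ∈ Finset.range m, v k i * v k' i = 0) :
    Halts (reduceProg e) s ((N + 1) * (400 * (m + n + 1))) (fun s' =>
      (∃ γ : ℕ → ℝ, ∀ i < m + n,
        s'.real 10 i = s.real 10 i - ∑ k ∈ Finset.range N, γ k * v k i) ∧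
      ∀ k < N, ∑ i ∈ Finset.range m, s'.real 10 i * v k i = 0) := by
  have inp : ∀ {s₁ s₂ N R}, HasInput b n K m a y s₁ → Agree N R s₁ s₂ → 0 ∉ N → 0 ∉ R → 1 ∉ R →
    HasInput b n K m a y s₂ := fun h ha => h.of_agree ha
  refine Halts.weaken (halts_forLoop (N := N) (300 * (m + n + 1))
    (fun j s' => (∃ γ : ℕ → ℝ, ∀ i < m + n,
        s'.real 10 i = s.real 10 i - ∑ k ∈ Finset.range j, γ k * v k i) ∧
      ∀ k < j, ∑ i ∈ Finset.range m, s'.real 10 i * v k i = 0) (by decide)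
    (fun s' ha => he s' (ha.mono (by decide) (by decide))) ?_ ?_) ?_ (fun _ _ h => h)
  · intro s' ha
    refine ⟨⟨fun _ => 0, fun i _ => ?_⟩, fun k hk => by omega⟩
    rw [ha.2 10 (by decide)]; simp
  · rintro k hk s' ha hvk ⟨⟨γ, hγ⟩, ho⟩
    have hin := inp h ha (by decide) (by decide) (by decide)
    have row : ∀ s₂ N R, Agree N R s' s₂ → 9 ∉ R → 0 ∉ N → 3 ∉ N → 0 ∉ R → 1 ∉ R →
        ∀ i < m + n, s₂.nat 2 0 = i → (rowEntry (nvar 3)).eval s₂ = v k i := by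
      intro s₂ N R ha₂ h9 h0 h3 h0' h1' i hi hi2
      have hin₂ := inp hin ha₂ h0 h0' h1'
      simp only [RExp.eval, NExp.eval]
      rw [hin₂.nm, hin₂.nn, hi2, ha₂.1 3 h3, hvk, ha₂.2 9 h9, ha.2 9 (by decide), hv k hk i hi]
    refine halts_setReal_seq (290 * (m + n + 1)) (by simp only [NExp.cost, RExp.cost]; omega)
      fun s₁ ha₁ h11 => ?_
    have hin₁ := inp hin ha₁ (by decide) (by decide) (by decide)
    refine halts_seq (halts_sumLoop (N := m) (fun i => s'.real 10 i * v k i)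
      (fun s₂ ha₂ => (inp hin₁ ha₂ (by decide) (by decide) (by decide)).nm) ?_)
      (200 * (m + n + 1)) (by simp only [NExp.cost, RExp.cost]; omega) fun s₂ ha₂ h₂ => ?_
    · intro i hi s₂ ha₂ hi2
      rw [RExp.eval, row s₂ [2] [11] ((ha₁.mono (by decide) (by decide)).trans
        (ha₂.mono (by decide) (by decide)))
        (by decide) (by decide) (by decide) (by decide) (by decide) i (by omega) hi2]
      simp only [RExp.eval, NExp.eval]
      rw [hi2, ha₂.2 10 (by decide), ha₁.2 10 (by decide)]
    have hin₂ := inp hin₁ ha₂ (by decide) (by decide) (by decide)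
    have hα : s₂.real 11 0 = ∑ i ∈ Finset.range m, s'.real 10 i * v k i := by
      rw [h₂, h11]; simp [NExp.eval, RExp.eval]
    have ha2 : Agree [2] [11] s' s₂ :=
      (ha₁.mono (by decide) (by decide)).trans (ha₂.mono (by decide) (by decide))
    refine halts_setReal_seq (190 * (m + n + 1)) (by simp only [NExp.cost, RExp.cost]; omega)
      fun s₃ ha₃ h13 => ?_
    have hin₃ := inp hin₂ ha₃ (by decide) (by decide) (by decide)
    have ha3 : Agree [2] [11, 13] s' s₃ :=
      (ha2.mono (by decide) (by decide)).trans (ha₃.mono (by decide) (by decide))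
    refine halts_seq (halts_sumLoop (N := m) (fun i => v k i * v k i)
      (fun s₄ ha₄ => (inp hin₃ ha₄ (by decide) (by decide) (by decide)).nm) ?_)
      (100 * (m + n + 1)) (by simp only [NExp.cost, RExp.cost]; omega) fun s₄ ha₄ h₄ => ?_
    · intro i hi s₄ ha₄ hi2
      rw [RExp.eval, row s₄ [2] [11, 13] (ha3.trans (ha₄.mono (by decide) (by decide)))
        (by decide) (by decide) (by decide) (by decide) (by decide) i (by omega) hi2]
    have hin₄ := inp hin₃ ha₄ (by decide) (by decide) (by decide)
    have ha4 : Agree [2] [11, 13] s' s₄ := ha3.trans (ha₄.mono (by decide) (by decide))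
    have hβ : s₄.real 13 0 = ∑ i ∈ Finset.range m, v k i * v k i := by
      rw [h₄, h13]; simp [NExp.eval, RExp.eval]
    have hα' : s₄.real 11 0 = ∑ i ∈ Finset.range m, s'.real 10 i * v k i := by
      rw [ha₄.2 11 (by decide), ha₃.2 11 (by decide), hα]
    set α := ∑ i ∈ Finset.range m, s'.real 10 i * v k i with hαdef
    set β := ∑ i ∈ Finset.range m, v k i * v k i with hβdef
    refine Halts.weaken (halts_assignLoop (N := m + n) 0 (fun i => s'.real 10 i - α / β * v k i)
      (fun s₅ ha₅ => ?_) (fun i _ s₅ _ hi5 => by simp only [NExp.eval]; rw [hi5, zero_add]) ?_)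
      (by simp only [NExp.cost, RExp.cost]; omega) ?_
    · have hin₅ := inp hin₄ ha₅ (by decide) (by decide) (by decide)
      simp only [NExp.eval]
      rw [hin₅.nm, hin₅.nn]
    · intro i hi s₅ ha₅ hi5 h10
      have ha5 : Agree [2] [11, 13, 10] s' s₅ :=
        (ha4.mono (by decide) (by decide)).trans (ha₅.mono (by decide) (by decide))
      rw [RExp.eval, RExp.eval.eq_6, row s₅ [2] [11, 13, 10] ha5
        (by decide) (by decide) (by decide) (by decide) (by decide) i hi hi5]
      simp only [RExp.eval, NExp.eval]
      rw [hi5, h10 i (by omega), ha4.2 10 (by decide), ha₅.2 11 (by decide),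
        ha₅.2 13 (by decide), hα', hβ]
    · rintro s₅ _ ⟨h5, _⟩ s₆ ha₆
      have h5' : ∀ i < m + n, s₆.real 10 i = s'.real 10 i - α / β * v k i := by
        intro i hi
        rw [ha₆.2 10 (by decide)]
        simpa using h5 i hi
      refine ⟨⟨Function.update γ k (α / β), fun i hi => ?_⟩, fun k' hk' => ?_⟩
      · rw [h5' i hi, hγ i hi, Finset.sum_range_succ, Function.update_self, ← sub_sub]
        congr 2
        refine Finset.sum_congr rfl fun j hj => ?_
        rw [Function.update_of_ne (Finset.mem_range.mp hj).ne]
      · have hexp : ∑ i ∈ Finset.range m, s₆.real 10 i * v k' i =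
            ∑ i ∈ Finset.range m, s'.real 10 i * v k' i -
              α / β * ∑ i ∈ Finset.range m, v k i * v k' i := by
          rw [Finset.mul_sum, ← Finset.sum_sub_distrib]
          refine Finset.sum_congr rfl fun i hi => ?_
          rw [h5' i (by have := Finset.mem_range.mp hi; omega)]
          ring
        rw [hexp]
        rcases Nat.lt_succ_iff_lt_or_eq.mp hk' with hk' | rfl
        · rw [ho k' hk', horth k hk k' hk']; simp
        · rw [← hαdef, ← hβdef]
          -- if the row vanishes, the quotient is `0`, and so is the inner product
          by_cases hβ0 : β = 0
          · have hz : ∀ i ∈ Finset.range m, v k' i = 0 := by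
              intro i hi
              have := (Finset.sum_eq_zero_iff_of_nonneg
                fun i _ => mul_self_nonneg (v k' i)).mp (hβdef ▸ hβ0) i hi
              exact mul_self_eq_zero.mp this
            rw [hβ0, mul_zero, sub_zero, hαdef]
            exact Finset.sum_eq_zero fun i hi => by rw [hz i hi, mul_zero]
          · field_simp; ring
  · have : 300 * (m + n + 1) + e.cost + 20 ≤ 400 * (m + n + 1) := by omega
    exact Nat.mul_le_mul_left _ this

/-- A vector of length `m + n` whose first part is the image of its second part under `a`, and
whose second part is supported in `U`. -/
structure Lifted (n m : ℕ) (a : ℕ → ℕ → ℝ) (U : Finset ℕ) (v : ℕ → ℝ) : Prop where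
  image : ∀ i < m, v i = ∑ j ∈ Finset.range n, a i j * v (m + j)
  supp : ∀ p < n, p ∉ U → v (m + p) = 0

theorem Lifted.sub_sum {n m N : ℕ} {a : ℕ → ℕ → ℝ} {U : Finset ℕ} {u w : ℕ → ℝ}
    {v : ℕ → ℕ → ℝ} {γ : ℕ → ℝ} (hu : Lifted n m a U u) (hv : ∀ k < N, Lifted n m a U (v k))
    (hw : ∀ i < m + n, w i = u i - ∑ k ∈ Finset.range N, γ k * v k i) : Lifted n m a U w := by
  constructor
  · intro i hi
    rw [hw i (by omega), hu.image i hi]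
    have : ∀ j ∈ Finset.range n, a i j * w (m + j) =
        a i j * u (m + j) - ∑ k ∈ Finset.range N, γ k * (a i j * v k (m + j)) := by
      intro j hj
      rw [hw (m + j) (by have := Finset.mem_range.mp hj; omega), mul_sub, Finset.mul_sum]
      congr 1
      exact Finset.sum_congr rfl fun k _ => by ring
    rw [Finset.sum_congr rfl this, Finset.sum_sub_distrib, Finset.sum_comm]
    congr 1
    refine Finset.sum_congr rfl fun k hk => ?_
    rw [(hv k (Finset.mem_range.mp hk)).image i hi, Finset.mul_sum]
  · intro p hp hpU
    rw [hw (m + p) (by omega), hu.supp p hp hpU, zero_sub, neg_eq_zero]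
    refine Finset.sum_eq_zero fun k hk => ?_
    rw [(hv k (Finset.mem_range.mp hk)).supp p hp hpU, mul_zero]

/-- Loads the selected column number `1` (a scalar variable), followed by the unit vector that
selects it, into the array `10`. -/
def loadColumnProg : Program :=
  .seq (forLoop 2 inM (.setReal 10 (nvar 2)
      (.load 0 (.add (.mul (nvar 2) inN) (.load 5 (nvar 1))))))
    (.seq (forLoop 2 inN (.setReal 10 (.add inM (nvar 2)) (.const 0)))
    (.setReal 10 (.add inM (.load 5 (nvar 1))) (.const 1)))

theorem halts_loadColumnProg {b n K m p : ℕ} {a : ℕ → ℕ → ℝ} {y : ℕ → ℝ} {s : State}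
    (h : HasInput b n K m a y s) (hp : s.nat 5 (s.nat 1 0) = p) (hpn : p < n) :
    Halts loadColumnProg s (100 * (m + n + 1)) (fun s' =>
      (∀ i < m, s'.real 10 i = a i p) ∧ ∀ j < n, s'.real 10 (m + j) = if j = p then 1 else 0) := by
  have inp : ∀ {s₁ s₂ N R}, HasInput b n K m a y s₁ → Agree N R s₁ s₂ → 0 ∉ N → 0 ∉ R → 1 ∉ R →
    HasInput b n K m a y s₂ := fun h ha => h.of_agree ha
  refine halts_seq (halts_assignLoop (N := m) 0 (fun i => a i p)
    (fun s₁ ha₁ => (inp h ha₁ (by decide) (by decide) (by decide)).nm)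
    (fun i _ s₁ _ hi1 => by simp only [NExp.eval]; rw [hi1, zero_add]) ?_)
    (50 * (n + 1) + 10)
    (by simp only [NExp.cost, RExp.cost]; omega) fun s₁ ha₁ h₁ => ?_
  · intro i hi s₁ ha₁ hi1 _
    have hin₁ := inp h ha₁ (by decide) (by decide) (by decide)
    simp only [RExp.eval, NExp.eval]
    rw [ha₁.1 5 (by decide), ha₁.1 1 (by decide), hp, hi1, hin₁.nn, hin₁.ra i hi _ hpn]
  have hin₁ := inp h ha₁ (by decide) (by decide) (by decide)
  refine halts_seq (halts_assignLoop (N := n) m (fun i => 0)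
    (fun s₂ ha₂ => (inp hin₁ ha₂ (by decide) (by decide) (by decide)).nn)
    (fun i _ s₂ ha₂ hi2 => ?_) (fun i _ s₂ _ _ _ => by simp [RExp.eval])) 10
    (by simp only [NExp.cost, RExp.cost]; omega) fun s₂ ha₂ h₂ =>
      halts_setReal (by simp only [NExp.cost, RExp.cost]; omega) ?_
  · simp only [NExp.eval]
    rw [hi2, (inp hin₁ ha₂ (by decide) (by decide) (by decide)).nm]
  have hin₂ := inp hin₁ ha₂ (by decide) (by decide) (by decide)
  simp only [State.writeReal, Function.update_self, NExp.eval, RExp.eval]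
  rw [hin₂.nm, ha₂.1 5 (by decide), ha₂.1 1 (by decide), ha₁.1 5 (by decide),
    ha₁.1 1 (by decide), hp]
  refine ⟨fun i hi => ?_, fun j hj => ?_⟩
  · rw [Function.update_of_ne (by omega), h₂.2 i (.inl hi)]
    simpa using h₁.1 i hi
  · split_ifs with hj'
    · rw [hj', Function.update_self]; simp
    · rw [Function.update_of_ne (by omega), h₂.1 j hj]

/-- Stores the current vector as the row of the array `9` with number `1` (a scalar variable). -/
def storeRowProg : Program :=
  forLoop 2 (.add inM inN) (.setReal 9 (.add (.mul (nvar 1) (.add inM inN)) (nvar 2))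
    (.load 10 (nvar 2)))

theorem halts_storeRowProg {b n K m k : ℕ} {a : ℕ → ℕ → ℝ} {y : ℕ → ℝ} {s : State}
    (h : HasInput b n K m a y s) (hk : s.nat 1 0 = k) :
    Halts storeRowProg s (100 * (m + n + 1)) (fun s' =>
      (∀ i < m + n, s'.real 9 (k * (m + n) + i) = s.real 10 i) ∧
      ∀ i < k * (m + n), s'.real 9 i = s.real 9 i) := by
  have inp : ∀ {s₁ s₂ N R}, HasInput b n K m a y s₁ → Agree N R s₁ s₂ → 0 ∉ N → 0 ∉ R → 1 ∉ R →
    HasInput b n K m a y s₂ := fun h ha => h.of_agree ha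
  refine Halts.weaken (halts_assignLoop (N := m + n) (k * (m + n)) (s.real 10)
    (fun s₅ ha₅ => ?_) (fun i _ s₅ ha₅ hi5 => ?_) ?_)
    (by simp only [NExp.cost, RExp.cost]; omega) fun s' _ hs' => ⟨hs'.1, fun i hi => hs'.2 i (.inl hi)⟩
  · have hin₅ := inp h ha₅ (by decide) (by decide) (by decide)
    simp only [NExp.eval]
    rw [hin₅.nm, hin₅.nn]
  · have hin₅ := inp h ha₅ (by decide) (by decide) (by decide)
    simp only [NExp.eval]
    rw [hin₅.nm, hin₅.nn, hi5, ha₅.1 1 (by decide), hk]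
  · intro i hi s₅ ha₅ hi5 _
    simp only [RExp.eval, NExp.eval]
    rw [hi5, ha₅.2 10 (by decide)]

/-- Orthogonalizes the selected columns of the matrix. Row `k` of the array `9` becomes the `k`-th
selected column followed by the unit vector that selects it, reduced by the rows before it. -/
def orthogonalizeProg : Program :=
  forLoop 1 (nvar 6) (.seq loadColumnProg (.seq (reduceProg (nvar 1)) storeRowProg))

/-- The first `N` rows `v` are lifted, mutually orthogonal in their first `m` entries, and span the
columns of `a` with numbers `idx 0, …, idx (N - 1)`. -/
structure Ortho (n m : ℕ) (a : ℕ → ℕ → ℝ) (U : Finset ℕ) (idx : ℕ → ℕ) (N : ℕ)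
    (v : ℕ → ℕ → ℝ) : Prop where
  lifted : ∀ k < N, Lifted n m a U (v k)
  orth : ∀ k < N, ∀ k' < k, ∑ i ∈ Finset.range m, v k i * v k' i = 0
  span : ∀ k < N, ∃ γ : ℕ → ℝ, ∀ i < m, a i (idx k) = ∑ k' ∈ Finset.range N, γ k' * v k' i

theorem Ortho.snoc {n m N : ℕ} {a : ℕ → ℕ → ℝ} {U : Finset ℕ} {idx : ℕ → ℕ} {v : ℕ → ℕ → ℝ}
    {c w γ : ℕ → ℝ} (hO : Ortho n m a U idx N v) (hc : Lifted n m a U c)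
    (hc' : ∀ i < m, c i = a i (idx N))
    (hγ : ∀ i < m + n, w i = c i - ∑ k ∈ Finset.range N, γ k * v k i)
    (horth : ∀ k < N, ∑ i ∈ Finset.range m, w i * v k i = 0) :
    Ortho n m a U idx (N + 1) (Function.update v N w) := by
  have hw := Lifted.sub_sum hc hO.lifted hγ
  refine ⟨?_, ?_, ?_⟩
  · intro k hk
    rcases Nat.lt_succ_iff_lt_or_eq.mp hk with hk | rfl
    · rw [Function.update_of_ne hk.ne]; exact hO.lifted k hk
    · rw [Function.update_self]; exact hw
  · intro k hk k' hk'
    rcases Nat.lt_succ_iff_lt_or_eq.mp hk with hk | rfl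
    · rw [Function.update_of_ne hk.ne, Function.update_of_ne (hk'.trans hk).ne]
      exact hO.orth k hk k' hk'
    · rw [Function.update_self, Function.update_of_ne hk'.ne]
      exact horth k' hk'
  · intro k hk
    rcases Nat.lt_succ_iff_lt_or_eq.mp hk with hk | rfl
    · obtain ⟨γ', hγ'⟩ := hO.span k hk
      refine ⟨Function.update γ' N 0, fun i hi => ?_⟩
      rw [Finset.sum_range_succ, Function.update_self, zero_mul, add_zero, hγ' i hi]
      refine Finset.sum_congr rfl fun j hj => ?_
      have := (Finset.mem_range.mp hj).ne
      rw [Function.update_of_ne this, Function.update_of_ne this]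
    · refine ⟨Function.update γ k 1, fun i hi => ?_⟩
      rw [Finset.sum_range_succ, Function.update_self, Function.update_self, one_mul,
        hγ i (by omega), hc' i hi]
      have : ∑ x ∈ Finset.range k, Function.update γ k 1 x * Function.update v k w x i =
          ∑ x ∈ Finset.range k, γ x * v x i := by
        refine Finset.sum_congr rfl fun j hj => ?_
        have := (Finset.mem_range.mp hj).ne
        rw [Function.update_of_ne this, Function.update_of_ne this]
      rw [this]; ring

theorem halts_orthogonalizeProg {b n K m : ℕ} {a : ℕ → ℕ → ℝ} {y : ℕ → ℝ} {s : State}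
    {U : Finset ℕ} (h : HasInput b n K m a y s) (hU : Lists U s) (hUn : ∀ p ∈ U, p < n) :
    Halts orthogonalizeProg s (1000 * (U.card + 2) ^ 2 * (m + n + 1)) (fun s' =>
      ∃ v, (∀ k < U.card, ∀ i < m + n, s'.real 9 (k * (m + n) + i) = v k i) ∧
        Ortho n m a U (s.nat 5) U.card v) := by
  have inp : ∀ {s₁ s₂ N R}, HasInput b n K m a y s₁ → Agree N R s₁ s₂ → 0 ∉ N → 0 ∉ R → 1 ∉ R →
    HasInput b n K m a y s₂ := fun h ha => h.of_agree ha
  set idx := s.nat 5 with hidx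
  refine Halts.weaken (halts_forLoop (N := U.card) ((U.card + 1) * (600 * (m + n + 1)))
    (fun N s' => ∃ v, (∀ k < N, ∀ i < m + n, s'.real 9 (k * (m + n) + i) = v k i) ∧
        Ortho n m a U idx N v) (by decide)
    (fun s' ha => (hU.of_agree ha (by decide) (by decide)).card) ?_ ?_) ?_ (fun _ _ h => h)
  · intro s' ha
    exact ⟨fun _ _ => 0, by simp, ⟨by simp, by simp, by simp⟩⟩
  · rintro N hN s' ha hv1 ⟨v, hv, hO⟩
    have hin := inp h ha (by decide) (by decide) (by decide)
    have h5 : s'.nat 5 = idx := ha.1 5 (by decide)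
    have hmem := hU.mem N hN
    rw [← hidx] at hmem
    have hcol := hUn _ hmem
    refine halts_seq (halts_loadColumnProg hin (p := idx N) (by rw [hv1, h5]) hcol)
      ((N + 1) * (400 * (m + n + 1)) + 100 * (m + n + 1)) ?_ fun s₁ ha₁ h₁ => ?_
    · calc _ = (N + 1) * (400 * (m + n + 1)) + 200 * (m + n + 1) := by ring
        _ ≤ (U.card + 1) * (400 * (m + n + 1)) + (U.card + 1) * (200 * (m + n + 1)) :=
          add_le_add (Nat.mul_le_mul_right _ (by omega)) (Nat.le_mul_of_pos_left _ (by omega))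
        _ = _ := by ring
    obtain ⟨c1, c2⟩ := h₁
    have hin₁ := inp hin ha₁ (by decide) (by decide) (by decide)
    have hlift : Lifted n m a U (s₁.real 10) := by
      constructor
      · intro i hi
        rw [c1 i hi, Finset.sum_eq_single (idx N)]
        · rw [c2 _ hcol, if_pos rfl, mul_one]
        · intro j hj hne
          rw [c2 j (Finset.mem_range.mp hj), if_neg hne, mul_zero]
        · intro hj
          exact absurd (Finset.mem_range.mpr hcol) hj
      · intro p hp hpU
        rw [c2 p hp, if_neg]
        rintro rfl
        exact hpU hmem
    refine halts_seq (halts_reduceProg (N := N) hin₁ v (by simp only [NExp.cost]; omega)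
      (fun s₂ ha₂ => ?_) ?_ hO.orth) (100 * (m + n + 1)) le_rfl fun s₂ ha₂ h₂ => ?_
    · simp only [NExp.eval]
      rw [ha₂.1 1 (by decide), ha₁.1 1 (by decide), hv1]
    · intro k hk i hi
      rw [ha₁.2 9 (by decide), hv k hk i hi]
    obtain ⟨⟨γ, hγ⟩, horth⟩ := h₂
    have hin₂ := inp hin₁ ha₂ (by decide) (by decide) (by decide)
    refine Halts.weaken (halts_storeRowProg hin₂ (k := N)
      (by rw [ha₂.1 1 (by decide), ha₁.1 1 (by decide), hv1])) le_rfl ?_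
    rintro s₃ _ ⟨h3a, h3b⟩ s₄ ha₄
    refine ⟨Function.update v N (s₂.real 10), ?_, hO.snoc hlift c1 hγ horth⟩
    intro k hk i hi
    rw [ha₄.2 9 (by decide)]
    rcases Nat.lt_succ_iff_lt_or_eq.mp hk with hk | rfl
    · have : (k + 1) * (m + n) ≤ N * (m + n) := Nat.mul_le_mul_right _ hk
      rw [h3b _ (by rw [add_mul] at this; omega), Function.update_of_ne hk.ne,
        ha₂.2 9 (by decide), ha₁.2 9 (by decide), hv k hk i hi]
    · rw [Function.update_self, h3a i hi]
  · simp only [NExp.cost]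
    nlinarith

end RealRAM

namespace RealRAM

/-- Solves `a z = y` exactly for `z` supported in the listed nodes, if this is possible. In this
case `z` becomes the output and the program is done. -/
def exactProg : Program :=
  .seq orthogonalizeProg
  (.seq (forLoop 2 inM (.setReal 10 (nvar 2) (.load 1 (nvar 2))))
  (.seq (forLoop 2 inN (.setReal 10 (.add inM (nvar 2)) (.const 0)))
  (.seq (reduceProg (nvar 6))
  (.seq (.setReal 11 (.const 0) (.const 0))
  (.seq (sumLoop 2 inM 11 (.mul (.load 10 (nvar 2)) (.load 10 (nvar 2))))
    (.cond (.realLE (rvar 11) (.const 0))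
      (.seq (forLoop 2 inN (.setReal 2 (nvar 2)
          (.sub (.const 0) (.load 10 (.add inM (nvar 2)))))) (.setNat 9 (.const 0) (.const 1)))
      .skip))))))

/-- If the residual of `y`, reduced by an orthogonal family that spans the listed columns, is not
zero, then `y` is not a combination of these columns. -/
theorem Ortho.not_exact {n m : ℕ} {a : ℕ → ℕ → ℝ} {U : Finset ℕ} {idx : ℕ → ℕ}
    {v : ℕ → ℕ → ℝ} {y w γ : ℕ → ℝ} (hO : Ortho n m a U idx U.card v)
    (hidx : ∀ p ∈ U, ∃ k < U.card, idx k = p)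
    (hγ : ∀ i < m, w i = y i - ∑ k ∈ Finset.range U.card, γ k * v k i)
    (horth : ∀ k < U.card, ∑ i ∈ Finset.range m, w i * v k i = 0) {z : ℕ → ℝ}
    (hz : ∀ p < n, p ∉ U → z p = 0)
    (hzy : ∀ i < m, ∑ j ∈ Finset.range n, a i j * z j = y i) :
    ∑ i ∈ Finset.range m, w i * w i = 0 := by
  have h1 : ∑ i ∈ Finset.range m, w i * w i = ∑ i ∈ Finset.range m, w i * y i := by
    have : ∀ i ∈ Finset.range m, w i * w i =
        w i * y i - ∑ k ∈ Finset.range U.card, γ k * (w i * v k i) := by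
      intro i hi
      have e : w i = y i - ∑ k ∈ Finset.range U.card, γ k * v k i := hγ i (Finset.mem_range.mp hi)
      calc w i * w i = w i * (y i - ∑ k ∈ Finset.range U.card, γ k * v k i) := by rw [← e]
        _ = _ := by
          rw [mul_sub, Finset.mul_sum]
          congr 1
          exact Finset.sum_congr rfl fun k _ => by ring
    rw [Finset.sum_congr rfl this, Finset.sum_sub_distrib, Finset.sum_comm]
    rw [Finset.sum_eq_zero (s := Finset.range U.card), sub_zero]
    intro k hk
    rw [← Finset.mul_sum, horth k (Finset.mem_range.mp hk), mul_zero]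
  have h2 : ∀ p ∈ U, ∑ i ∈ Finset.range m, w i * a i p = 0 := by
    intro p hp
    obtain ⟨k, hk, rfl⟩ := hidx p hp
    obtain ⟨δ, hδ⟩ := hO.span k hk
    have : ∀ i ∈ Finset.range m, w i * a i (idx k) =
        ∑ k' ∈ Finset.range U.card, δ k' * (w i * v k' i) := by
      intro i hi
      rw [hδ i (Finset.mem_range.mp hi), Finset.mul_sum]
      exact Finset.sum_congr rfl fun k _ => by ring
    rw [Finset.sum_congr rfl this, Finset.sum_comm]
    refine Finset.sum_eq_zero fun k' hk' => ?_
    rw [← Finset.mul_sum, horth k' (Finset.mem_range.mp hk'), mul_zero]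
  have h3 : ∀ i ∈ Finset.range m, w i * y i = ∑ j ∈ Finset.range n, z j * (w i * a i j) := by
    intro i hi
    rw [← hzy i (Finset.mem_range.mp hi), Finset.mul_sum]
    exact Finset.sum_congr rfl fun k _ => by ring
  rw [h1, Finset.sum_congr rfl h3, Finset.sum_comm]
  refine Finset.sum_eq_zero fun j hj => ?_
  rw [← Finset.mul_sum]
  by_cases hjU : j ∈ U
  · rw [h2 j hjU, mul_zero]
  · rw [hz j (Finset.mem_range.mp hj) hjU, zero_mul]

theorem halts_exactProg {b n K m : ℕ} {a : ℕ → ℕ → ℝ} {y : ℕ → ℝ} {s : State}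
    {U : Finset ℕ} (h : HasInput b n K m a y s) (hU : Lists U s) (hUn : ∀ p ∈ U, p < n) :
    Halts exactProg s (2000 * (U.card + 2) ^ 2 * (m + n + 1)) (fun s' =>
      (s'.nat 9 0 = 1 ∧ (∀ p < n, p ∉ U → s'.real 2 p = 0) ∧
        ∀ i < m, ∑ j ∈ Finset.range n, a i j * s'.real 2 j = y i) ∨
      (s'.nat 9 = s.nat 9 ∧ s'.real 2 = s.real 2 ∧ ∀ z : ℕ → ℝ, (∀ p < n, p ∉ U → z p = 0) →
        ¬ ∀ i < m, ∑ j ∈ Finset.range n, a i j * z j = y i)) := by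
  have inp : ∀ {s₁ s₂ N R}, HasInput b n K m a y s₁ → Agree N R s₁ s₂ → 0 ∉ N → 0 ∉ R → 1 ∉ R →
    HasInput b n K m a y s₂ := fun h ha => h.of_agree ha
  refine halts_seq (halts_orthogonalizeProg h hU hUn) ((U.card + 1) * (400 * (m + n + 1)) +
    500 * (m + n + 1)) ?_ fun s₁ ha₁ h₁ => ?_
  · have : (m + n + 1) * ((U.card + 1) * 400 + 500) ≤
      (m + n + 1) * (1000 * (U.card + 2) ^ 2) := Nat.mul_le_mul_left _ (by nlinarith)
    nlinarith
  obtain ⟨v, hv, hO⟩ := h₁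
  have hin₁ := inp h ha₁ (by decide) (by decide) (by decide)
  refine halts_seq (halts_assignLoop (N := m) 0 y
    (fun s₂ ha₂ => (inp hin₁ ha₂ (by decide) (by decide) (by decide)).nm)
    (fun i _ s₂ _ hi2 => by simp only [NExp.eval]; rw [hi2, zero_add])
    (fun i hi s₂ ha₂ hi2 _ => ?_)) ((U.card + 1) * (400 * (m + n + 1)) + 400 * (m + n + 1))
    (by simp only [NExp.cost, RExp.cost]; omega) fun s₂ ha₂ h₂ => ?_
  · simp only [NExp.eval, RExp.eval]
    rw [hi2, (inp hin₁ ha₂ (by decide) (by decide) (by decide)).ry i hi]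
  have hin₂ := inp hin₁ ha₂ (by decide) (by decide) (by decide)
  refine halts_seq (halts_assignLoop (N := n) m (fun i => 0)
    (fun s₃ ha₃ => (inp hin₂ ha₃ (by decide) (by decide) (by decide)).nn)
    (fun i _ s₃ ha₃ hi3 => ?_) (fun i _ s₃ _ _ _ => by simp [RExp.eval]))
    ((U.card + 1) * (400 * (m + n + 1)) + 300 * (m + n + 1))
    (by simp only [NExp.cost, RExp.cost]; omega) fun s₃ ha₃ h₃ => ?_
  · simp only [NExp.eval]
    rw [hi3, (inp hin₂ ha₃ (by decide) (by decide) (by decide)).nm]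
  have hin₃ := inp hin₂ ha₃ (by decide) (by decide) (by decide)
  have hy : ∀ i < m, s₃.real 10 i = y i := by
    intro i hi
    rw [h₃.2 i (.inl hi)]
    simpa using h₂.1 i hi
  have hU₃ : Lists U s₃ := ((hU.of_agree ha₁ (by decide) (by decide)).of_agree ha₂ (by decide)
    (by decide)).of_agree ha₃ (by decide) (by decide)
  refine halts_seq (halts_reduceProg (N := U.card) hin₃ v (by simp only [NExp.cost]; omega)
    (fun s₄ ha₄ => (hU₃.of_agree ha₄ (by decide) (by decide)).card) ?_ hO.orth)
    (300 * (m + n + 1)) le_rfl fun s₄ ha₄ h₄ => ?_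
  · intro k hk i hi
    rw [ha₃.2 9 (by decide), ha₂.2 9 (by decide), hv k hk i hi]
  obtain ⟨⟨γ, hγ⟩, horth⟩ := h₄
  have hin₄ := inp hin₃ ha₄ (by decide) (by decide) (by decide)
  have hγ1 : ∀ i < m, s₄.real 10 i = y i - ∑ k ∈ Finset.range U.card, γ k * v k i := by
    intro i hi
    rw [hγ i (by omega), hy i hi]
  have hγ2 : ∀ p < n, s₄.real 10 (m + p) = - ∑ k ∈ Finset.range U.card, γ k * v k (m + p) := by
    intro p hp
    rw [hγ _ (by omega), h₃.1 p hp, zero_sub]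
  refine halts_setReal_seq (280 * (m + n + 1)) (by simp only [NExp.cost, RExp.cost]; omega)
    fun s₅ ha₅ h₅ => ?_
  have hin₅ := inp hin₄ ha₅ (by decide) (by decide) (by decide)
  refine halts_seq (halts_sumLoop (N := m) (fun i => s₄.real 10 i * s₄.real 10 i)
    (fun s₆ ha₆ => (inp hin₅ ha₆ (by decide) (by decide) (by decide)).nm)
    (fun i hi s₆ ha₆ hi6 => ?_)) (200 * (m + n + 1))
    (by simp only [NExp.cost, RExp.cost]; omega) fun s₆ ha₆ h₆ => ?_
  · simp only [NExp.eval, RExp.eval]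
    rw [hi6, ha₆.2 10 (by decide), ha₅.2 10 (by decide)]
  have hin₆ := inp hin₅ ha₆ (by decide) (by decide) (by decide)
  have h11 : s₆.real 11 0 = ∑ i ∈ Finset.range m, s₄.real 10 i * s₄.real 10 i := by
    rw [h₆, h₅]; simp [NExp.eval, RExp.eval]
  refine halts_cond (100 * (m + n + 1)) (by simp only [Test.cost, NExp.cost, RExp.cost]; omega)
    (fun hc => ?_) fun hc => halts_skip (by omega) (.inr ⟨?_, ?_, fun z hz hzy => hc ?_⟩)
  · simp only [Test.eval, RExp.eval, NExp.eval, Rat.cast_zero] at hc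
    rw [h11] at hc
    have hzero : ∀ i < m, s₄.real 10 i = 0 := by
      intro i hi
      have := (Finset.sum_eq_zero_iff_of_nonneg fun i _ => mul_self_nonneg (s₄.real 10 i)).mp
        (le_antisymm hc (Finset.sum_nonneg fun i _ => mul_self_nonneg (s₄.real 10 i))) i
        (Finset.mem_range.mpr hi)
      exact mul_self_eq_zero.mp this
    refine halts_seq (halts_assignLoop (N := n) 0 (fun p => 0 - s₄.real 10 (m + p))
      (fun s₇ ha₇ => (inp hin₆ ha₇ (by decide) (by decide) (by decide)).nn)
      (fun i _ s₇ _ hi7 => by simp only [NExp.eval]; rw [hi7, zero_add])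
      (fun i _ s₇ ha₇ hi7 _ => ?_)) 10 (by simp only [NExp.cost, RExp.cost]; omega)
      fun s₇ ha₇ h₇ => halts_setNat (by simp only [NExp.cost]; omega) (.inl ⟨?_, ?_, ?_⟩)
    · have hin₇ := inp hin₆ ha₇ (by decide) (by decide) (by decide)
      simp only [NExp.eval, RExp.eval]
      rw [hi7, hin₇.nm, ha₇.2 10 (by decide), ha₆.2 10 (by decide), ha₅.2 10 (by decide)]
      simp
    · simp [State.writeNat, NExp.eval]
    · intro p hp hpU
      have := h₇.1 p hp
      rw [zero_add] at this
      rw [show (s₇.writeNat 9 _ _).real = s₇.real from rfl, this, hγ2 p hp, zero_sub, neg_neg]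
      refine Finset.sum_eq_zero fun k hk => ?_
      rw [(hO.lifted k (Finset.mem_range.mp hk)).supp p hp hpU, mul_zero]
    · intro i hi
      have h1 := hγ1 i hi
      rw [hzero i hi] at h1
      have h2 : ∀ j ∈ Finset.range n, a i j * (s₇.writeNat 9 ((NExp.const 0).eval s₇)
          ((NExp.const 1).eval s₇)).real 2 j =
          ∑ k ∈ Finset.range U.card, γ k * (a i j * v k (m + j)) := by
        intro j hj
        have := h₇.1 j (Finset.mem_range.mp hj)
        rw [zero_add] at this
        rw [show (s₇.writeNat 9 _ _).real = s₇.real from rfl, this, hγ2 j (Finset.mem_range.mp hj),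
          zero_sub, neg_neg, Finset.mul_sum]
        exact Finset.sum_congr rfl fun k _ => by ring
      rw [Finset.sum_congr rfl h2, Finset.sum_comm, eq_comm, ← sub_eq_zero, h1]
      congr 1
      refine Finset.sum_congr rfl fun k hk => ?_
      rw [← Finset.mul_sum, (hO.lifted k (Finset.mem_range.mp hk)).image i hi]
  · rw [ha₆.1 9 (by decide), ha₅.1 9 (by decide), ha₄.1 9 (by decide), ha₃.1 9 (by decide),
      ha₂.1 9 (by decide), ha₁.1 9 (by decide)]
  · rw [ha₆.2 2 (by decide), ha₅.2 2 (by decide), ha₄.2 2 (by decide), ha₃.2 2 (by decide),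
      ha₂.2 2 (by decide), ha₁.2 2 (by decide)]
  · simp only [Test.eval, RExp.eval, NExp.eval, Rat.cast_zero]
    rw [h11, hO.not_exact hU.surj hγ1 horth hz hzy]

end RealRAM

/-! ### The recovery program: the main loop -/

namespace RealRAM

/-- The residual `y - a x`. -/
noncomputable def resid (n : ℕ) (a : ℕ → ℕ → ℝ) (y x : ℕ → ℝ) (i : ℕ) : ℝ :=
  y i - ∑ j ∈ Finset.range n, a i j * x j

/-- The gradient step `x + aᵀ (y - a x) / m`. -/
noncomputable def gradStep (n m : ℕ) (a : ℕ → ℕ → ℝ) (y x : ℕ → ℝ) (p : ℕ) : ℝ :=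
  x p + (∑ i ∈ Finset.range m, a i p * resid n a y x i) / m

/-- `w p` is the largest value of `∑ (u q ^ 2 - lam)` over the subtrees hanging at `p`. -/
def TreeValue (b n : ℕ) (u : ℕ → ℝ) (lam : ℝ) (w : ℕ → ℝ) : Prop :=
  ∀ p < n, w p = u p ^ 2 - lam + ∑ c ∈ Finset.range b,
    if b * p + 1 + c < n then max 0 (w (b * p + 1 + c)) else 0

/-- `U` consists of the nodes all of whose ancestors, themselves included, have a positive value. -/
structure Selected (b n : ℕ) (w : ℕ → ℝ) (U : Finset ℕ) : Prop where
  lt : ∀ p ∈ U, p < n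
  root : 0 < n → (0 ∈ U ↔ 0 < w 0)
  child : ∀ p < n, ∀ c < b, b * p + 1 + c < n →
    (b * p + 1 + c ∈ U ↔ p ∈ U ∧ 0 < w (b * p + 1 + c))

/-- One stage of the iteration, with penalty `lam` per node: `x'` is the restriction of the gradient
step at `x` to the optimal subtree `U'`. -/
def Step (b n m : ℕ) (a : ℕ → ℕ → ℝ) (y : ℕ → ℝ) (lam : ℝ) (x x' : ℕ → ℝ) (U' : Finset ℕ) : Prop :=
  ∃ w, TreeValue b n (gradStep n m a y x) lam w ∧ Selected b n w U' ∧
    ∀ p < n, x' p = if p ∈ U' then gradStep n m a y x p else 0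

/-- The test that a candidate `x` with support in `U` has to pass at penalty `lam`. -/
def Pass (n m K : ℕ) (a : ℕ → ℕ → ℝ) (y : ℕ → ℝ) (lam : ℝ) (x : ℕ → ℝ) (U : Finset ℕ) : Prop :=
  U.card ≤ 4 * K ∧ ∑ i ∈ Finset.range m, resid n a y x i ^ 2 ≤ 16 * m * K * lam

/-- What the program guarantees about its output `x`: either `x` fits the sketch exactly, or it
passed the test at some penalty `lam`, but its successor failed at `lam / 2`. -/
def Good (b n m K : ℕ) (a : ℕ → ℕ → ℝ) (y : ℕ → ℝ) (Adm : Finset ℕ → Prop) (x : ℕ → ℝ) : Prop :=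
  ∃ U, Adm U ∧ U.card ≤ 4 * K ∧ (∀ p < n, p ∉ U → x p = 0) ∧
    ((∀ i < m, resid n a y x i = 0) ∨
      ∃ lam > 0, Pass n m K a y lam x U ∧
        ∃ x' U', Step b n m a y lam x x' U' ∧ ¬ Pass n m K a y (lam / 2) x' U')

/-- One stage: the candidate becomes the output, an exact solution is tried at stages that double,
and the next candidate is computed. -/
def stageProg : Program :=
  .seq (forLoop 1 inN (.setReal 2 (nvar 1) (.load 6 (nvar 1))))
  (.seq (.cond (.natLE (nvar 8) (nvar 7))
    (.seq (.setNat 8 (.const 0) (.add (.mul (.const 2) (nvar 7)) (.const 1))) exactProg) .skip)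
  (.seq gradientProg (.seq valueProg (.seq selectProg (.seq collectProg
    (.seq (.setReal 7 (.const 0) (.div (rvar 7) (.const 2)))
      (.setNat 7 (.const 0) (.add (nvar 7) (.const 1)))))))))

/-- The body of the main loop: run a stage if the candidate passes the test, and stop otherwise. -/
def bodyProg : Program :=
  .seq residualProg (.cond (.conj (.natLE (nvar 6) (.mul (.const 4) inK))
      (.realLE (rvar 12) (.mul (.mul (.mul (.const 16) (.cast inM)) (.cast inK)) (rvar 7))))
    stageProg (.setNat 9 (.const 0) (.const 1)))

/-- The main loop runs until the variable `9` is set. -/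
def mainLoop : Program := .loop (.natLE (nvar 9) (.const 0)) bodyProg

/-- The recovery algorithm: iterative thresholding with a penalty `λ` for each node of the tree,
which is halved in each stage, starting from the squared norm of the sketch. -/
def recoveryProg : Program :=
  .seq residualProg (.seq (.setReal 7 (.const 0) (rvar 12)) mainLoop)

/-- The loop invariant: `x` is the candidate, `U` its support, `lam` the penalty, `j` the stage. -/
structure Inv (b n K m : ℕ) (a : ℕ → ℕ → ℝ) (y : ℕ → ℝ) (Adm : Finset ℕ → Prop) (lam0 : ℝ)
    (j next : ℕ) (s : State) : Prop where
  inp : HasInput b n K m a y s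
  undone : s.nat 9 0 = 0
  stage : s.nat 7 0 = j
  next_eq : s.nat 8 0 = next
  pen : s.real 7 0 = lam0 / 2 ^ j
  cand : ∃ U, Lists U s ∧ Adm U ∧ (∀ p ∈ U, p < n) ∧ (∀ p < n, p ∉ U → s.real 6 p = 0) ∧
    ((j = 0 ∧ next = 0 ∧ U = ∅) ∨
      (0 < lam0 ∧ ∃ U₀, Adm U₀ ∧ (∀ p < n, p ∉ U₀ → s.real 2 p = 0) ∧
        Pass n m K a y (2 * s.real 7 0) (s.real 2) U₀ ∧
        Step b n m a y (2 * s.real 7 0) (s.real 2) (s.real 6) U))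

theorem resid_congr {n : ℕ} {a : ℕ → ℕ → ℝ} {y x x' : ℕ → ℝ} (h : ∀ p < n, x p = x' p) :
    resid n a y x = resid n a y x' := by
  funext i
  unfold resid
  congr 1
  exact Finset.sum_congr rfl fun j hj => by rw [h j (Finset.mem_range.mp hj)]

/-- The part of a stage that computes the next candidate. -/
theorem halts_nextCandidate {b n K m : ℕ} {a : ℕ → ℕ → ℝ} {y : ℕ → ℝ} {s : State}
    (hb : 1 ≤ b) (h : HasInput b n K m a y s)
    (hr : ∀ i < m, s.real 3 i = resid n a y (s.real 6) i) :
    Halts (.seq gradientProg (.seq valueProg (.seq selectProg (.seq collectProg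
      (.seq (.setReal 7 (.const 0) (.div (rvar 7) (.const 2)))
        (.setNat 7 (.const 0) (.add (nvar 7) (.const 1)))))))) s
      (1100 * (m + b + 1) * (n + 1)) (fun s' =>
        s'.real 7 0 = s.real 7 0 / 2 ∧ s'.nat 7 0 = s.nat 7 0 + 1 ∧ ∃ U, Lists U s' ∧
          Step b n m a y (s.real 7 0) (s.real 6) (s'.real 6) U) := by
  have inp : ∀ {s₁ s₂ N R}, HasInput b n K m a y s₁ → Agree N R s₁ s₂ → 0 ∉ N → 0 ∉ R → 1 ∉ R →
    HasInput b n K m a y s₂ := fun h ha => h.of_agree ha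
  refine halts_seq (halts_gradientProg h) ((900 * b + 900) * (n + 1)) (by nlinarith)
    fun s₁ ha₁ h₁ => ?_
  have hin₁ := inp h ha₁ (by decide) (by decide) (by decide)
  refine halts_seq (halts_valueProg hin₁) ((500 * b + 500) * (n + 1)) (by nlinarith)
    fun s₂ ha₂ h₂ => ?_
  have hin₂ := inp hin₁ ha₂ (by decide) (by decide) (by decide)
  refine halts_seq (halts_selectProg hin₂) (120 * (n + 1)) (by nlinarith) fun s₃ ha₃ h₃ => ?_
  have hin₃ := inp hin₂ ha₃ (by decide) (by decide) (by decide)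
  refine halts_seq (halts_collectProg hin₃) 20 (by omega) fun s₄ ha₄ h₄ => ?_
  refine halts_setReal_seq 10 (by simp only [NExp.cost, RExp.cost]; omega) fun s₅ ha₅ h₅ =>
    halts_setNat (by simp only [NExp.cost]; omega) ?_
  have hu : ∀ p < n, s₁.real 4 p = gradStep n m a y (s.real 6) p := by
    intro p hp
    rw [h₁ p hp, gradStep]
    congr 2
    exact Finset.sum_congr rfl fun i hi => by rw [hr i (Finset.mem_range.mp hi)]
  have h7 : s₂.real 7 = s.real 7 := by rw [ha₂.2 7 (by decide), ha₁.2 7 (by decide)]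
  refine ⟨?_, ?_, (Finset.range n).filter fun p => 1 ≤ s₃.nat 4 p, ?_, s₂.real 5, ?_, ?_, ?_⟩
  · rw [show (s₅.writeNat 7 _ _).real = s₅.real from rfl, h₅]
    simp only [NExp.eval, RExp.eval, Function.update_self]
    rw [ha₄.2 7 (by decide), ha₃.2 7 (by decide), h7]
    norm_num
  · simp only [State.writeNat, Function.update_self, NExp.eval]
    rw [ha₅.1 7 (by decide), ha₄.1 7 (by decide), ha₃.1 7 (by decide), ha₂.1 7 (by decide),
      ha₁.1 7 (by decide)]
  · exact (h₄.1.of_agree ha₅ (by decide) (by decide)).of_agree (agree_writeNat _ _ _ _)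
      (by decide) (by decide)
  · intro p hp
    rw [h₂ p hp, hu p hp, ha₁.2 7 (by decide)]
  · refine ⟨fun p hp => by simpa using (Finset.mem_filter.mp hp).1, fun hn => ?_,
      fun p hp c hc hpc => ?_⟩
    · rw [Finset.mem_filter, Finset.mem_range, h₃.1]
      exact and_iff_right hn
    · have := h₃.2 p hp c hc
      simp only [Finset.mem_filter, Finset.mem_range, this]
      tauto
  · intro p hp
    rw [show (s₅.writeNat 7 _ _).real = s₅.real from rfl, ha₅.2 6 (by decide), h₄.2 p hp,
      ha₃.2 4 (by decide), ha₂.2 4 (by decide), hu p hp]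
    simp [hp]

theorem halts_stageProg {b n K m : ℕ} {a : ℕ → ℕ → ℝ} {y : ℕ → ℝ} {s : State}
    {U : Finset ℕ} {j next : ℕ} (hb : 1 ≤ b) (h : HasInput b n K m a y s) (hU : Lists U s)
    (hUn : ∀ p ∈ U, p < n) (hUK : U.card ≤ 4 * K) (hj : s.nat 7 0 = j) (hnext : s.nat 8 0 = next)
    (hr : ∀ i < m, s.real 3 i = resid n a y (s.real 6) i) :
    Halts stageProg s (1200 * (m + b + 1) * (n + 1) +
        if next ≤ j then 2001 * (4 * K + 2) ^ 2 * (m + n + 1) else 0) (fun s' =>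
      (s'.nat 9 0 = 1 ∧ (∀ p < n, p ∉ U → s'.real 2 p = 0) ∧
        ∀ i < m, resid n a y (s'.real 2) i = 0) ∨
      (s'.nat 9 = s.nat 9 ∧ (∀ p < n, s'.real 2 p = s.real 6 p) ∧
        (next ≤ j → ∀ z : ℕ → ℝ, (∀ p < n, p ∉ U → z p = 0) → ¬ ∀ i < m, resid n a y z i = 0) ∧
        s'.real 7 0 = s.real 7 0 / 2 ∧ s'.nat 7 0 = j + 1 ∧
        s'.nat 8 0 = (if next ≤ j then 2 * j + 1 else next) ∧ ∃ U', Lists U' s' ∧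
          Step b n m a y (s.real 7 0) (s.real 6) (s'.real 6) U')) := by
  have inp : ∀ {s₁ s₂ N R}, HasInput b n K m a y s₁ → Agree N R s₁ s₂ → 0 ∉ N → 0 ∉ R → 1 ∉ R →
    HasInput b n K m a y s₂ := fun h ha => h.of_agree ha
  have hres : ∀ x i, resid n a y x i = 0 ↔ ∑ j ∈ Finset.range n, a i j * x j = y i := by
    intro x i
    rw [resid, sub_eq_zero, eq_comm]
  refine halts_seq (halts_assignLoop (N := n) 0 (s.real 6)
    (fun s₁ ha₁ => (inp h ha₁ (by decide) (by decide) (by decide)).nn)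
    (fun i _ s₁ _ hi1 => by simp only [NExp.eval]; rw [hi1, zero_add])
    (fun i _ s₁ ha₁ hi1 _ => by
      simp only [NExp.eval, RExp.eval]; rw [hi1, ha₁.2 6 (by decide)]))
    (1100 * (m + b + 1) * (n + 1) + 30 +
      if next ≤ j then 2001 * (4 * K + 2) ^ 2 * (m + n + 1) else 0)
    (by simp only [NExp.cost, RExp.cost]; nlinarith) fun s₁ ha₁ h₁ => ?_
  have hin₁ := inp h ha₁ (by decide) (by decide) (by decide)
  have hout : ∀ p < n, s₁.real 2 p = s.real 6 p := fun p hp => by simpa using h₁.1 p hp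
  have htest : Test.eval s₁ (.natLE (nvar 8) (nvar 7)) ↔ next ≤ j := by
    simp only [Test.eval, NExp.eval]
    rw [ha₁.1 8 (by decide), ha₁.1 7 (by decide), hj, hnext]
  refine halts_seq (T₁ := 30 + if next ≤ j then 2001 * (4 * K + 2) ^ 2 * (m + n + 1) else 0)
    (Q := fun s₂ => s₂.nat 8 0 = (if next ≤ j then 2 * j + 1 else next) ∧
      ((s₂.nat 9 0 = 1 ∧ (∀ p < n, p ∉ U → s₂.real 2 p = 0) ∧
        ∀ i < m, resid n a y (s₂.real 2) i = 0) ∨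
      (s₂.nat 9 = s.nat 9 ∧ (∀ p < n, s₂.real 2 p = s.real 6 p) ∧
        (next ≤ j → ∀ z : ℕ → ℝ, (∀ p < n, p ∉ U → z p = 0) →
          ¬ ∀ i < m, resid n a y z i = 0))))
    (halts_cond (20 + if next ≤ j then 2001 * (4 * K + 2) ^ 2 * (m + n + 1) else 0)
      (by simp only [Test.cost, NExp.cost]; omega) (fun hc => ?_)
      fun hc => halts_skip (by omega) ?_)
    (1100 * (m + b + 1) * (n + 1)) (by omega) fun s₂ ha₂ h₂ => ?_
  · rw [htest] at hc
    rw [if_pos hc]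
    refine halts_setNat_seq (2001 * (4 * K + 2) ^ 2 * (m + n + 1))
      (by simp only [NExp.cost]; omega) fun s₂ ha₂ h8 => ?_
    have hin₂ := inp hin₁ ha₂ (by decide) (by decide) (by decide)
    refine Halts.weaken (halts_exactProg hin₂ ((hU.of_agree ha₁ (by decide) (by decide)).of_agree
      ha₂ (by decide) (by decide)) hUn) ?_ fun s₃ ha₃ h₃ => ?_
    · exact Nat.mul_le_mul_right _ (Nat.mul_le_mul (by omega) (Nat.pow_le_pow_left (by omega) 2))
    · refine ⟨?_, ?_⟩
      · rw [if_pos hc, ha₃.1 8 (by decide), h8]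
        simp only [NExp.eval, Function.update_self]
        rw [ha₁.1 7 (by decide), hj]
      · simp only [hres]
        rcases h₃ with h₃ | h₃
        · exact .inl h₃
        · refine .inr ⟨?_, ?_, fun _ => h₃.2.2⟩
          · rw [h₃.1, ha₂.1 9 (by decide), ha₁.1 9 (by decide)]
          · rw [h₃.2.1, ha₂.2 2 (by decide)]; exact hout
  · rw [htest] at hc
    rw [if_neg hc, ha₁.1 8 (by decide), ha₁.1 9 (by decide)]
    exact ⟨hnext, .inr ⟨rfl, hout, fun h => absurd h hc⟩⟩
  · have hin₂ := inp hin₁ ha₂ (by decide) (by decide) (by decide)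
    have h6 : s₂.real 6 = s.real 6 := by rw [ha₂.2 6 (by decide), ha₁.2 6 (by decide)]
    have h3 : s₂.real 3 = s.real 3 := by rw [ha₂.2 3 (by decide), ha₁.2 3 (by decide)]
    have h7 : s₂.real 7 = s.real 7 := by rw [ha₂.2 7 (by decide), ha₁.2 7 (by decide)]
    have h7' : s₂.nat 7 = s.nat 7 := by rw [ha₂.1 7 (by decide), ha₁.1 7 (by decide)]
    refine Halts.weaken (halts_nextCandidate hb hin₂ (by rw [h6, h3]; exact hr)) le_rfl
      fun s₃ ha₃ h₃ => ?_
    rw [h6, h7, h7'] at h₃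
    rw [ha₃.1 9 (by decide), ha₃.2 2 (by decide), ha₃.1 8 (by decide)]
    rcases h₂ with ⟨h8, h | h⟩
    · exact .inl h
    · exact .inr ⟨h.1, h.2.1, h.2.2, h₃.1, by rw [h₃.2.1, hj], h8, h₃.2.2⟩

/-- One iteration of the main loop. From stage `J` on, an exact solution is found if it is tried. -/
theorem halts_bodyProg {b n K m : ℕ} {a : ℕ → ℕ → ℝ} {y : ℕ → ℝ} {s : State}
    {Adm : Finset ℕ → Prop} {lam0 : ℝ} {j next J : ℕ} (hb : 1 ≤ b) (hK : 1 ≤ K)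
    (hlam0 : lam0 = ∑ i ∈ Finset.range m, y i ^ 2)
    (hstep : ∀ lam > 0, ∀ x U x' U', Adm U → (∀ p < n, p ∉ U → x p = 0) →
      Step b n m a y lam x x' U' → Adm U')
    (hJ : ∀ U, Adm U → U.card ≤ 4 * K → ∀ z : ℕ → ℝ, (∀ p < n, p ∉ U → z p = 0) →
      ∑ i ∈ Finset.range m, resid n a y z i ^ 2 ≤ 16 * m * K * (lam0 / 2 ^ J) →
      ∃ z' : ℕ → ℝ, (∀ p < n, p ∉ U → z' p = 0) ∧ ∀ i < m, resid n a y z' i = 0)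
    (h : Inv b n K m a y Adm lam0 j next s) :
    Halts bodyProg s (1700 * (m + b + 1) * (n + 1) +
        if next ≤ j then 2001 * (4 * K + 2) ^ 2 * (m + n + 1) else 0) (fun s' =>
      (s'.nat 9 0 = 1 ∧ Good b n m K a y Adm (s'.real 2)) ∨
      ((next ≤ j → j < J) ∧
        Inv b n K m a y Adm lam0 (j + 1) (if next ≤ j then 2 * j + 1 else next) s')) := by
  have inp : ∀ {s₁ s₂ N R}, HasInput b n K m a y s₁ → Agree N R s₁ s₂ → 0 ∉ N → 0 ∉ R → 1 ∉ R →
    HasInput b n K m a y s₂ := fun h ha => h.of_agree ha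
  obtain ⟨U, hU, hAdm, hUn, hsupp, hcand⟩ := h.cand
  have hlam_nonneg : 0 ≤ lam0 := by
    rw [hlam0]; exact Finset.sum_nonneg fun i _ => sq_nonneg _
  refine halts_seq (halts_residualProg h.inp) (1200 * (m + b + 1) * (n + 1) + 30 +
    if next ≤ j then 2001 * (4 * K + 2) ^ 2 * (m + n + 1) else 0) (by nlinarith) fun s₁ ha₁ h₁ => ?_
  have hin₁ := inp h.inp ha₁ (by decide) (by decide) (by decide)
  have hr : ∀ i < m, s₁.real 3 i = resid n a y (s.real 6) i := h₁.1
  have hν : s₁.real 12 0 = ∑ i ∈ Finset.range m, resid n a y (s.real 6) i ^ 2 := h₁.2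
  have h6 : s₁.real 6 = s.real 6 := ha₁.2 6 (by decide)
  have h7 : s₁.real 7 = s.real 7 := ha₁.2 7 (by decide)
  have hU₁ := hU.of_agree ha₁ (by decide) (by decide)
  have htest : Test.eval s₁ (.conj (.natLE (nvar 6) (.mul (.const 4) inK))
      (.realLE (rvar 12) (.mul (.mul (.mul (.const 16) (.cast inM)) (.cast inK)) (rvar 7)))) ↔
      Pass n m K a y (s.real 7 0) (s.real 6) U := by
    have e1 := hU₁.card
    have e2 := hin₁.nm
    have e3 := hin₁.nK
    simp only [Test.eval, NExp.eval, RExp.eval]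
    rw [e1, e2, e3, hν, h7, Pass]
    norm_num
  refine halts_cond (1200 * (m + b + 1) * (n + 1) + 
    if next ≤ j then 2001 * (4 * K + 2) ^ 2 * (m + n + 1) else 0)
    (by simp only [Test.cost, NExp.cost, RExp.cost]; omega) (fun hc => ?_)
    fun hc => halts_setNat ?_ ?_
  · rw [htest] at hc
    refine Halts.weaken (halts_stageProg hb hin₁ hU₁ hUn hc.1
      (by rw [ha₁.1 7 (by decide), h.stage]) (by rw [ha₁.1 8 (by decide), h.next_eq])
      (by rw [h6]; exact hr)) le_rfl fun s₂ ha₂ h₂ => ?_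
    rw [h6, h7] at h₂
    rcases h₂ with ⟨hd, hs, hz⟩ | ⟨hd, hout, hno, hlam, hj, hnx, U', hU', hst⟩
    · exact .inl ⟨hd, U, hAdm, hc.1, hs, .inl hz⟩
    · right
      have hpos : 0 < lam0 := by
        rcases hcand with ⟨rfl, rfl, rfl⟩ | ⟨hpos, _⟩
        · refine lt_of_le_of_ne hlam_nonneg fun h0 => ?_
          refine hno le_rfl (fun _ => 0) (fun _ _ _ => rfl) fun i hi => ?_
          have := (Finset.sum_eq_zero_iff_of_nonneg fun i _ => sq_nonneg (y i)).mp
            (hlam0.symm.trans h0.symm) i (Finset.mem_range.mpr hi)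
          simp [resid, pow_eq_zero_iff] at this ⊢
          exact this
        · exact hpos
      have hlampos : 0 < s.real 7 0 := by rw [h.pen]; positivity
      have hdouble : 2 * s₂.real 7 0 = s.real 7 0 := by rw [hlam]; ring
      have hrc : resid n a y (s₂.real 2) = resid n a y (s.real 6) := resid_congr hout
      have hst' : Step b n m a y (s.real 7 0) (s₂.real 2) (s₂.real 6) U' := by
        obtain ⟨w, hw, hsel, hx⟩ := hst
        have hg : ∀ p < n, gradStep n m a y (s₂.real 2) p = gradStep n m a y (s.real 6) p := by
          intro p hp
          rw [gradStep, gradStep, hrc, hout p hp]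
        refine ⟨w, fun p hp => ?_, hsel, fun p hp => ?_⟩
        · rw [hw p hp, hg p hp]
        · rw [hx p hp, hg p hp]
      refine ⟨fun hnj => ?_, ?_, ?_, hj, ?_, ?_, ?_⟩
      · by_contra hjJ
        have hle : lam0 / 2 ^ j ≤ lam0 / 2 ^ J :=
          div_le_div_of_nonneg_left hlam_nonneg (by positivity)
            (pow_le_pow_right₀ (by norm_num) (not_lt.mp hjJ))
        obtain ⟨z, hz, hz'⟩ := hJ U hAdm hc.1 (s.real 6) hsupp (hc.2.trans (by
          rw [h.pen]; gcongr))
        exact hno hnj z hz hz'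
      · exact inp hin₁ ha₂ (by decide) (by decide) (by decide)
      · rw [hd, ha₁.1 9 (by decide), h.undone]
      · exact hnx
      · rw [hlam, h.pen, pow_succ]; field_simp
      · refine ⟨U', hU', hstep _ hlampos _ _ _ _ hAdm hsupp hst, ?_, ?_,
          .inr ⟨hpos, U, hAdm, ?_, ?_, ?_⟩⟩
        · obtain ⟨w, hw, hsel, hx⟩ := hst
          exact hsel.lt
        · obtain ⟨w, hw, hsel, hx⟩ := hst
          intro p hp hpU
          rw [hx p hp, if_neg hpU]
        · intro p hp hpU
          rw [hout p hp, hsupp p hp hpU]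
        · rw [hdouble, Pass, hrc]; exact hc
        · rw [hdouble]; exact hst'
  · have : 1 ≤ (m + b + 1) * (n + 1) := Nat.mul_pos (by omega) (by omega)
    simp only [NExp.cost, mul_assoc]
    omega
  · rw [htest] at hc
    left
    refine ⟨by simp [State.writeNat, NExp.eval], ?_⟩
    rw [show (s₁.writeNat 9 _ _).real = s₁.real from rfl, ha₁.2 2 (by decide)]
    rcases hcand with ⟨rfl, rfl, rfl⟩ | ⟨hpos, U₀, hAdm₀, hs₀, hp₀, hst⟩
    · -- the candidate `0` passes the first test
      refine absurd ⟨by simp, ?_⟩ hc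
      have hres : ∀ i, resid n a y (s.real 6) i = y i := by
        intro i
        rw [resid, Finset.sum_eq_zero, sub_zero]
        intro q hq
        rw [hsupp q (Finset.mem_range.mp hq) (Finset.notMem_empty _), mul_zero]
      simp only [hres]
      rw [← hlam0, h.pen, pow_zero, div_one]
      rcases Nat.eq_zero_or_pos m with rfl | hm
      · simp [hlam0]
      · have h1 : (1 : ℝ) ≤ m := by exact_mod_cast hm
        have h2 : (1 : ℝ) ≤ K := by exact_mod_cast hK
        have h3 : (1 : ℝ) ≤ 16 * m * K := by nlinarith
        nlinarith
    · have hlampos : 0 < s.real 7 0 := by rw [h.pen]; positivity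
      refine ⟨U₀, hAdm₀, hp₀.1, hs₀, .inr ⟨_, by positivity, hp₀, _, U, hst, ?_⟩⟩
      rwa [mul_div_cancel_left₀ _ (two_ne_zero)]

/-- Exact solutions are tried when `next ≤ j`, and then `next` becomes `2 * j + 1`; this is the
number of attempts that are left before stage `2 * J + 1`. -/
def attempts (J next : ℕ) : ℕ := Nat.log 2 (2 * J + 1) + 1 - Nat.log 2 (next + 1)

theorem attempts_pos {J next : ℕ} (h : next ≤ 2 * J) : 1 ≤ attempts J next := by
  have : Nat.log 2 (next + 1) ≤ Nat.log 2 (2 * J + 1) := Nat.log_mono_right (by omega)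
  unfold attempts
  omega

theorem attempts_succ {J next j : ℕ} (h : next ≤ j) (hj : j < J) :
    attempts J (2 * j + 1) + 1 ≤ attempts J next := by
  have h1 : Nat.log 2 (2 * j + 1 + 1) ≤ Nat.log 2 (2 * J + 1) := Nat.log_mono_right (by omega)
  have h2 : Nat.log 2 ((next + 1) * 2) ≤ Nat.log 2 (2 * j + 1 + 1) :=
    Nat.log_mono_right (by omega)
  rw [Nat.log_mul_base (by norm_num) (by omega)] at h2
  unfold attempts
  omega

theorem halts_mainLoop {b n K m : ℕ} {a : ℕ → ℕ → ℝ} {y : ℕ → ℝ}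
    {Adm : Finset ℕ → Prop} {lam0 : ℝ} {J : ℕ} (hb : 1 ≤ b) (hK : 1 ≤ K)
    (hlam0 : lam0 = ∑ i ∈ Finset.range m, y i ^ 2)
    (hstep : ∀ lam > 0, ∀ x U x' U', Adm U → (∀ p < n, p ∉ U → x p = 0) →
      Step b n m a y lam x x' U' → Adm U')
    (hJ : ∀ U, Adm U → U.card ≤ 4 * K → ∀ z : ℕ → ℝ, (∀ p < n, p ∉ U → z p = 0) →
      ∑ i ∈ Finset.range m, resid n a y z i ^ 2 ≤ 16 * m * K * (lam0 / 2 ^ J) →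
      ∃ z' : ℕ → ℝ, (∀ p < n, p ∉ U → z' p = 0) ∧ ∀ i < m, resid n a y z' i = 0) :
    ∀ d j next s, j + d = 2 * J + 1 → next ≤ 2 * J →
      Inv b n K m a y Adm lam0 j next s →
      Halts mainLoop s ((d + 1) * (1800 * (m + b + 1) * (n + 1)) +
        attempts J next * (2001 * (4 * K + 2) ^ 2 * (m + n + 1)) + 10)
        (fun s' => Good b n m K a y Adm (s'.real 2)) := by
  intro d
  set T₁ := (m + b + 1) * (n + 1) with hT₁
  have hT₁pos : 1 ≤ T₁ := Nat.mul_pos (by omega) (by omega)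
  set T₂ := 2001 * (4 * K + 2) ^ 2 * (m + n + 1) with hT₂
  have hcost : ∀ k, k * (1800 * (m + b + 1) * (n + 1)) = 1800 * (k * T₁) := by
    intro k; rw [hT₁]; ring
  have hbcost : 1700 * (m + b + 1) * (n + 1) = 1700 * T₁ := by rw [hT₁]; ring
  have hguard : (Test.natLE (nvar 9) (.const 0)).cost = 4 := rfl
  have exits : ∀ s, s.nat 9 0 = 1 → Runs mainLoop s 4 s := by
    intro s hs
    refine hguard ▸ Runs.loopFalse _ _ _ ?_
    simp only [Test.eval, NExp.eval]; rw [hs]; norm_num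
  have go : ∀ {s}, s.nat 9 0 = 0 → Test.eval s (.natLE (nvar 9) (.const 0)) := by
    intro s hs
    simp only [Test.eval, NExp.eval]; rw [hs]
  induction d with
  | zero =>
    intro j next s hj hnext hI
    obtain ⟨t, s₁, hr, ht, ⟨hd, hg⟩ | ⟨hlt, _⟩⟩ := halts_bodyProg hb hK hlam0 hstep hJ hI
    · refine ⟨_, s₁, .loopTrue _ _ _ _ _ _ _ (go hI.undone) hr (exits _ hd), ?_, hg⟩
      rw [if_pos (by omega), hbcost] at ht
      have := Nat.mul_le_mul_right T₂ (attempts_pos hnext)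
      rw [hcost]
      omega
    · exact absurd (hlt (by omega)) (by omega)
  | succ d ih =>
    intro j next s hj hnext hI
    obtain ⟨t, s₁, hr, ht, ⟨hd, hg⟩ | ⟨hlt, hI'⟩⟩ := halts_bodyProg hb hK hlam0 hstep hJ hI
    · refine ⟨_, s₁, .loopTrue _ _ _ _ _ _ _ (go hI.undone) hr (exits _ hd), ?_, hg⟩
      have := Nat.mul_le_mul_right T₂ (attempts_pos hnext)
      have h1 : T₁ ≤ (d + 1 + 1) * T₁ := Nat.le_mul_of_pos_left _ (by omega)
      rw [hbcost] at ht
      rw [hcost]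
      split_ifs at ht <;> omega
    · obtain ⟨t', s₂, hr₂, ht₂, hg⟩ := ih _ _ s₁ (by omega)
        (by split_ifs with h
            · have := hlt h; omega
            · exact hnext) hI'
      refine ⟨_, s₂, .loopTrue _ _ _ _ _ _ _ (go hI.undone) hr hr₂, ?_, hg⟩
      have h2 : (d + 1 + 1) * T₁ = (d + 1) * T₁ + T₁ := by ring
      rw [hcost] at ht₂ ⊢
      rw [hbcost] at ht
      split_ifs at ht ht₂ with h
      · have := Nat.mul_le_mul_right T₂ (attempts_succ h (hlt h))
        rw [add_mul] at this
        omega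
      · omega

/-- The specification of the recovery program. The number `J` bounds the number of stages after
which an approximate fit of the sketch on an admissible support can be replaced by an exact one. -/
theorem halts_recoveryProg {b n K m : ℕ} {a : ℕ → ℕ → ℝ} {y : ℕ → ℝ}
    {Adm : Finset ℕ → Prop} {J : ℕ} {s : State} (hb : 1 ≤ b) (hK : 1 ≤ K)
    (hempty : Adm ∅)
    (hstep : ∀ lam > 0, ∀ x U x' U', Adm U → (∀ p < n, p ∉ U → x p = 0) →
      Step b n m a y lam x x' U' → Adm U')
    (hJ : ∀ U, Adm U → U.card ≤ 4 * K → ∀ z : ℕ → ℝ, (∀ p < n, p ∉ U → z p = 0) →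
      ∑ i ∈ Finset.range m, resid n a y z i ^ 2 ≤
        16 * m * K * ((∑ i ∈ Finset.range m, y i ^ 2) / 2 ^ J) →
      ∃ z' : ℕ → ℝ, (∀ p < n, p ∉ U → z' p = 0) ∧ ∀ i < m, resid n a y z' i = 0)
    (h : HasInput b n K m a y s) (hnat : ∀ c, c ≠ 0 → s.nat c = fun _ => 0)
    (hreal : s.real 6 = fun _ => 0) :
    Halts recoveryProg s ((2 * J + 3) * (1800 * (m + b + 1) * (n + 1)) +
        (Nat.log 2 (2 * J + 1) + 1) * (2001 * (4 * K + 2) ^ 2 * (m + n + 1)) + 30)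
        (fun s' => Good b n m K a y Adm (s'.real 2)) := by
  have inp : ∀ {s₁ s₂ N R}, HasInput b n K m a y s₁ → Agree N R s₁ s₂ → 0 ∉ N → 0 ∉ R → 1 ∉ R →
    HasInput b n K m a y s₂ := fun h ha => h.of_agree ha
  have e : (2 * J + 3) * (1800 * (m + b + 1) * (n + 1)) =
    (2 * J + 2) * (1800 * (m + b + 1) * (n + 1)) + 1800 * ((m + b + 1) * (n + 1)) := by ring
  refine halts_seq (halts_residualProg h) ((2 * J + 2) * (1800 * (m + b + 1) * (n + 1)) +
    (Nat.log 2 (2 * J + 1) + 1) * (2001 * (4 * K + 2) ^ 2 * (m + n + 1)) + 30) ?_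
    fun s₁ ha₁ h₁ => halts_setReal_seq ((2 * J + 2) * (1800 * (m + b + 1) * (n + 1)) +
    (Nat.log 2 (2 * J + 1) + 1) * (2001 * (4 * K + 2) ^ 2 * (m + n + 1)) + 10)
    (by simp only [NExp.cost, RExp.cost]; omega) fun s₂ ha₂ h₂ => ?_
  · have : 400 * (m + 1) * (n + 1) ≤ 1800 * ((m + b + 1) * (n + 1)) := by
      rw [← mul_assoc]
      exact Nat.mul_le_mul_right _ (by omega)
    omega
  have hin₂ := inp (inp h ha₁ (by decide) (by decide) (by decide)) ha₂ (by decide) (by decide)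
    (by decide)
  have hz : ∀ c, c ≠ 0 → c ≠ 1 → c ≠ 2 → s₂.nat c = fun _ => 0 := by
    intro c h0 h1 h2
    rw [ha₂.1 c (by simp), ha₁.1 c (by
      simp [residualProg, forLoop, sumLoop, Program.modNat]; tauto), hnat c h0]
  have h6 : s₂.real 6 = fun _ => 0 := by
    rw [ha₂.2 6 (by decide), ha₁.2 6 (by decide), hreal]
  refine Halts.weaken (halts_mainLoop hb hK rfl hstep hJ (2 * J + 1) 0 0 s₂ (by omega) (by omega)
    ⟨hin₂, ?_, ?_, ?_, ?_, ∅, ⟨?_, by simp, by simp⟩, hempty, by simp, ?_, .inl ⟨rfl, rfl, rfl⟩⟩)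
    ?_ fun _ _ h => h
  · rw [hz 9 (by norm_num) (by norm_num) (by norm_num)]
  · rw [hz 7 (by norm_num) (by norm_num) (by norm_num)]
  · rw [hz 8 (by norm_num) (by norm_num) (by norm_num)]
  · rw [h₂]
    simp only [NExp.eval, RExp.eval, Function.update_self, pow_zero, div_one]
    rw [h₁.2, hreal]
    simp
  · rw [hz 6 (by norm_num) (by norm_num) (by norm_num)]; rfl
  · intro p _ _
    rw [h6]
  · have : attempts J 0 = Nat.log 2 (2 * J + 1) + 1 := by
      rw [attempts, zero_add, Nat.log_one_right, Nat.sub_zero]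
    rw [this]

end RealRAM

/-! ### Parent-closed sets of nodes -/

namespace TreeSparse

open RealRAM

/-- The parent of a node; the root `0` is its own parent. -/
def par (b j : ℕ) : ℕ := (j - 1) / b

/-- A set of nodes that contains the parent of each of its members: a rooted subtree or the empty
set. -/
def PClosed (b : ℕ) (W : Finset ℕ) : Prop := ∀ j ∈ W, par b j ∈ W

theorem par_zero (b : ℕ) : par b 0 = 0 := by simp [par]

theorem par_child {b p c : ℕ} (hc : c < b) : par b (b * p + 1 + c) = p := by
  have h : b * p + 1 + c - 1 = c + b * p := by omega
  rw [par, h, Nat.add_mul_div_left _ _ (by omega), Nat.div_eq_of_lt hc, zero_add]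

theorem eq_child {b j : ℕ} (hb : 0 < b) (hj : j ≠ 0) :
    ∃ c < b, b * par b j + 1 + c = j := by
  refine ⟨(j - 1) % b, Nat.mod_lt _ hb, ?_⟩
  have := Nat.div_add_mod (j - 1) b
  unfold par
  omega

theorem par_le (b j : ℕ) : par b j ≤ j - 1 := Nat.div_le_self _ _

theorem par_lt {b j : ℕ} (hj : j ≠ 0) : par b j < j := by
  have := par_le b j
  omega

theorem PClosed.union {b : ℕ} {W W' : Finset ℕ} (h : PClosed b W) (h' : PClosed b W') :
    PClosed b (W ∪ W') := by
  intro j hj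
  rcases Finset.mem_union.mp hj with hj | hj
  · exact Finset.mem_union_left _ (h j hj)
  · exact Finset.mem_union_right _ (h' j hj)

theorem PClosed.iterate {b : ℕ} {W : Finset ℕ} (h : PClosed b W) {j : ℕ} (hj : j ∈ W) (k : ℕ) :
    (par b)^[k] j ∈ W := by
  induction k with
  | zero => exact hj
  | succ k ih => rw [Function.iterate_succ_apply']; exact h _ ih

theorem iterate_par_le (b j k : ℕ) : (par b)^[k] j ≤ j - k := by
  induction k with
  | zero => simp
  | succ k ih =>
    rw [Function.iterate_succ_apply']
    have := par_le b ((par b)^[k] j)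
    omega

theorem PClosed.zero_mem {b : ℕ} {W : Finset ℕ} (h : PClosed b W) (hne : W.Nonempty) : 0 ∈ W := by
  obtain ⟨j, hj⟩ := hne
  have h1 := h.iterate hj j
  have h2 := iterate_par_le b j j
  rwa [show (par b)^[j] j = 0 by omega] at h1

/-- Summation over the children that belong to `R` of all nodes in `R`. -/
theorem sum_children {b : ℕ} (hb : 0 < b) (R : Finset ℕ) (f : ℕ → ℝ) :
    ∑ p ∈ R, ∑ c ∈ Finset.range b, (if b * p + 1 + c ∈ R then f (b * p + 1 + c) else 0) =
      ∑ q ∈ R.filter (fun q => q ≠ 0 ∧ par b q ∈ R), f q := by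
  have h1 : ∀ p, ∑ c ∈ Finset.range b, (if b * p + 1 + c ∈ R then f (b * p + 1 + c) else 0) =
      ∑ q ∈ R.filter (fun q => q ≠ 0 ∧ par b q = p), f q := by
    intro p
    rw [← Finset.sum_filter]
    refine Finset.sum_nbij (fun c => b * p + 1 + c) ?_ ?_ ?_ fun _ _ => rfl
    · intro c hc
      simp only [Finset.mem_filter, Finset.mem_range] at hc ⊢
      exact ⟨hc.2, by omega, par_child hc.1⟩
    · intro c _ c' _ h
      simpa using h
    · intro q hq
      simp only [Finset.coe_filter, Set.mem_ofPred_eq] at hq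
      obtain ⟨c, hc, hqc⟩ := eq_child hb hq.2.1
      rw [hq.2.2] at hqc
      exact ⟨c, by simp [hc, hqc, hq.1], hqc⟩
  simp only [h1, Finset.sum_filter]
  rw [Finset.sum_comm]
  refine Finset.sum_congr rfl fun q _ => ?_
  by_cases hq : q = 0
  · simp [hq]
  · simp only [hq, ne_eq, not_false_eq_true, true_and, Finset.sum_ite_eq]

section Optimality

variable {b n : ℕ} {u w : ℕ → ℝ} {lam : ℝ} {U : Finset ℕ}

theorem selected_pClosed (hb : 0 < b) (hU : Selected b n w U) : PClosed b U := by
  intro j hj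
  rcases eq_or_ne j 0 with rfl | hj0
  · rwa [par_zero]
  · obtain ⟨c, hc, hjc⟩ := eq_child hb hj0
    have hjn := hU.lt j hj
    have := (hU.child (par b j) ((par_lt hj0).trans hjn) c hc (by omega)).mp (by rwa [hjc])
    exact this.1

theorem selected_pos (hb : 0 < b) (hU : Selected b n w U) {j : ℕ} (hj : j ∈ U) : 0 < w j := by
  have hjn := hU.lt j hj
  rcases eq_or_ne j 0 with rfl | hj0
  · exact (hU.root hjn).mp hj
  · obtain ⟨c, hc, hjc⟩ := eq_child hb hj0
    have := (hU.child (par b j) ((par_lt hj0).trans hjn) c hc (by omega)).mp (by rwa [hjc])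
    rw [← hjc]
    exact this.2

/-- Removing a set of selected nodes that is closed under selected children does not pay. -/
theorem penalty_le_of_subset (hb : 0 < b) (hw : TreeValue b n u lam w) (hU : Selected b n w U)
    {R : Finset ℕ} (hR : R ⊆ U) (hdesc : ∀ j ∈ U, j ≠ 0 → par b j ∈ R → j ∈ R) :
    lam * R.card ≤ ∑ p ∈ R, u p ^ 2 := by
  have h1 : ∀ p ∈ R, u p ^ 2 - lam = w p - ∑ c ∈ Finset.range b,
      (if b * p + 1 + c ∈ R then w (b * p + 1 + c) else 0) := by
    intro p hp
    rw [hw p (hU.lt p (hR hp)), eq_sub_iff_add_eq, add_right_inj]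
    refine Finset.sum_congr rfl fun c hc => ?_
    have hc := Finset.mem_range.mp hc
    by_cases hn : b * p + 1 + c < n
    · rw [if_pos hn]
      by_cases hq : b * p + 1 + c ∈ R
      · rw [if_pos hq, max_eq_right (selected_pos hb hU (hR hq)).le]
      · rw [if_neg hq, max_eq_left]
        by_contra hpos
        refine hq (hdesc _ ((hU.child p (hU.lt p (hR hp)) c hc hn).mpr ⟨hR hp, not_le.mp hpos⟩)
          (by omega) ?_)
        rwa [par_child hc]
    · rw [if_neg hn, if_neg fun hq => hn (hU.lt _ (hR hq))]
  have h2 : ∑ p ∈ R, (u p ^ 2 - lam) = ∑ p ∈ R, w p -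
      ∑ q ∈ R.filter (fun q => q ≠ 0 ∧ par b q ∈ R), w q := by
    rw [Finset.sum_congr rfl h1, Finset.sum_sub_distrib, sum_children hb]
  have h3 : ∑ q ∈ R.filter (fun q => q ≠ 0 ∧ par b q ∈ R), w q ≤ ∑ p ∈ R, w p :=
    Finset.sum_le_sum_of_subset_of_nonneg (Finset.filter_subset _ _)
      fun q hq _ => (selected_pos hb hU (hR hq)).le
  rw [Finset.sum_sub_distrib, Finset.sum_const, nsmul_eq_mul] at h2
  linarith

/-- Adding a set of nodes to the selected ones does not pay. -/
theorem sum_le_penalty_of_disjoint (hb : 0 < b) (hw : TreeValue b n u lam w)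
    (hU : Selected b n w U) {R : Finset ℕ} (hR : Disjoint R U) (hRn : ∀ p ∈ R, p < n)
    (hcl : PClosed b (U ∪ R)) : ∑ p ∈ R, u p ^ 2 ≤ lam * R.card := by
  have h1 : ∀ p ∈ R, u p ^ 2 - lam ≤ w p - ∑ c ∈ Finset.range b,
      (if b * p + 1 + c ∈ R then max 0 (w (b * p + 1 + c)) else 0) := by
    intro p hp
    rw [hw p (hRn p hp)]
    have : ∑ c ∈ Finset.range b, (if b * p + 1 + c ∈ R then max 0 (w (b * p + 1 + c)) else 0) ≤
        ∑ c ∈ Finset.range b, if b * p + 1 + c < n then max 0 (w (b * p + 1 + c)) else 0 := by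
      refine Finset.sum_le_sum fun c _ => ?_
      by_cases hq : b * p + 1 + c ∈ R
      · rw [if_pos hq, if_pos (hRn _ hq)]
      · rw [if_neg hq]
        split_ifs
        · exact le_max_left _ _
        · exact le_rfl
    linarith
  have h2 : ∑ p ∈ R, (u p ^ 2 - lam) ≤ ∑ p ∈ R, w p -
      ∑ q ∈ R.filter (fun q => q ≠ 0 ∧ par b q ∈ R), max 0 (w q) := by
    rw [← sum_children hb R fun q => max 0 (w q), ← Finset.sum_sub_distrib]
    exact Finset.sum_le_sum h1
  have h3 : ∑ p ∈ R, w p ≤ ∑ q ∈ R.filter (fun q => q ≠ 0 ∧ par b q ∈ R), max 0 (w q) := by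
    rw [Finset.sum_filter]
    refine Finset.sum_le_sum fun q hq => ?_
    split_ifs with h
    · exact le_max_right _ _
    · have hqU : q ∉ U := Finset.disjoint_left.mp hR hq
      have hqn := hRn q hq
      rcases eq_or_ne q 0 with rfl | hq0
      · exact not_lt.mp fun hpos => hqU ((hU.root hqn).mpr hpos)
      · have hpU : par b q ∈ U := by
          rcases Finset.mem_union.mp (hcl q (Finset.mem_union_right _ hq)) with h' | h'
          · exact h'
          · exact absurd ⟨hq0, h'⟩ h
        obtain ⟨c, hc, hqc⟩ := eq_child hb hq0
        refine not_lt.mp fun hpos => hqU ?_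
        have := (hU.child (par b q) ((par_lt hq0).trans hqn) c hc (by omega)).mpr
          ⟨hpU, by rwa [hqc]⟩
        rwa [hqc] at this
  rw [Finset.sum_sub_distrib, Finset.sum_const, nsmul_eq_mul] at h2
  linarith

end Optimality

/-- The first `L` nodes on the path from `v` to the root. -/
def path (b L v : ℕ) : Finset ℕ := (Finset.range L).image fun k => (par b)^[k] v

theorem card_path_le (b L v : ℕ) : (path b L v).card ≤ L :=
  Finset.card_image_le.trans (by simp)

/-- A large set `U` of nodes outside `S` contains a branch `R` of moderate size, that is, a set
closed under children in `U`, which is attached to `S` by a single path. -/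
theorem exists_branch {b B : ℕ} {U S : Finset ℕ} (hb : 0 < b) (hU : PClosed b U) (hS : PClosed b S)
    (hB : 1 ≤ B) (hcard : B ≤ (U \ S).card) :
    ∃ v ∈ U, ∃ R ⊆ U \ S, B ≤ R.card ∧ R.card ≤ b * B ∧
      (∀ j ∈ U, j ≠ 0 → par b j ∈ R → j ∈ R) ∧ ∀ P, PClosed b (S ∪ P) → v ∈ S ∪ P →
        PClosed b (S ∪ P ∪ R) := by
  classical
  set D : ℕ → Finset ℕ := fun v => (U \ S).filter fun i => ∃ k, (par b)^[k] i = v with hD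
  have hmemD : ∀ v i, i ∈ D v ↔ (i ∈ U ∧ i ∉ S) ∧ ∃ k, (par b)^[k] i = v := by
    intro v i
    simp [hD]
  have hD0 : D 0 = U \ S := by
    refine Finset.filter_true_of_mem fun i _ => ⟨i, ?_⟩
    have := iterate_par_le b i i
    omega
  have hU0 : 0 ∈ U := hU.zero_mem (by
    have : (U \ S).Nonempty := Finset.card_pos.mp (by omega)
    exact this.mono Finset.sdiff_subset)
  obtain ⟨v, hv, hmax⟩ := (U.filter fun v => B ≤ (D v).card).exists_max_image id
    ⟨0, by rw [Finset.mem_filter]; exact ⟨hU0, by rwa [hD0]⟩⟩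
  rw [Finset.mem_filter] at hv
  refine ⟨v, hv.1, D v, Finset.filter_subset _ _, hv.2, ?_, ?_, ?_⟩
  · -- by the choice of `v`, the branches at the children of `v` have fewer than `B` nodes
    have hsub : D v ⊆ insert v ((Finset.range b).biUnion fun c => D (b * v + 1 + c)) := by
      intro i hi
      rw [hmemD] at hi
      obtain ⟨hi, hk⟩ := hi
      rw [Finset.mem_insert, Finset.mem_biUnion]
      have hk' := Nat.find_spec hk
      rcases hk0 : Nat.find hk with _ | k
      · rw [hk0] at hk'
        exact .inl hk'
      · right
        rw [hk0, Function.iterate_succ_apply'] at hk'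
        have hne : (par b)^[k] i ≠ v := Nat.find_min hk (m := k) (by omega)
        have hq0 : (par b)^[k] i ≠ 0 := by
          intro h0
          rw [h0, par_zero] at hk'
          exact hne (by rw [h0, hk'])
        obtain ⟨c, hc, hqc⟩ := eq_child hb hq0
        rw [hk'] at hqc
        refine ⟨c, Finset.mem_range.mpr hc, ?_⟩
        rw [hmemD]
        exact ⟨hi, k, hqc.symm⟩
    have hchild : ∀ c ∈ Finset.range b, (D (b * v + 1 + c)).card ≤ B - 1 := by
      intro c _
      by_contra hlt
      have hne : (D (b * v + 1 + c)).Nonempty := Finset.card_pos.mp (by omega)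
      obtain ⟨i, hi⟩ := hne
      rw [hmemD] at hi
      obtain ⟨⟨hiU, _⟩, k, hk⟩ := hi
      have := hmax (b * v + 1 + c) (by
        rw [Finset.mem_filter]
        exact ⟨hk ▸ hU.iterate hiU k, by omega⟩)
      have hle : 1 * v ≤ b * v := Nat.mul_le_mul_right _ hb
      simp only [id] at this
      omega
    have h1 := (Finset.card_le_card hsub).trans (Finset.card_insert_le _ _)
    have h2 := h1.trans (Nat.add_le_add_right
      (Finset.card_biUnion_le_card_mul _ _ _ hchild) 1)
    rw [Finset.card_range] at h2
    have h3 : b * B = b * (B - 1) + b := by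
      rw [← Nat.mul_succ]; congr 1; omega
    omega
  · intro j hj hj0 hp
    rw [hmemD] at hp ⊢
    obtain ⟨⟨_, hpS⟩, k, hk⟩ := hp
    exact ⟨⟨hj, fun h => hpS (hS j h)⟩, k + 1, by rwa [Function.iterate_succ_apply]⟩
  · intro P hP hvP i hi
    rcases Finset.mem_union.mp hi with hi | hi
    · exact Finset.mem_union_left _ (hP i hi)
    · rw [hmemD] at hi
      obtain ⟨hiU, k, hk⟩ := hi
      cases k with
      | zero =>
        rw [Function.iterate_zero, id] at hk
        subst hk
        exact Finset.mem_union_left _ (hP _ hvP)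
      | succ k =>
        by_cases hS' : par b i ∈ S
        · exact Finset.mem_union_left _ (Finset.mem_union_left _ hS')
        · refine Finset.mem_union_right _ ?_
          rw [hmemD]
          exact ⟨⟨hU i hiU.1, hS'⟩, k, by rwa [Function.iterate_succ_apply] at hk⟩

/-- There are at most `2 ^ (b * N)` rooted subtrees with at most `N` nodes: such a tree is
determined by the sets of children of its nodes, taken in increasing order. -/
theorem card_trees_le (b N : ℕ) (hb : 0 < b) (F : Finset (Finset ℕ))
    (hF : ∀ W ∈ F, PClosed b W ∧ W.Nonempty ∧ W.card ≤ N) : F.card ≤ 2 ^ (b * N) := by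
  classical
  set rank : Finset ℕ → ℕ → ℕ := fun W p => (W.filter fun i => i < p).card with hrank
  set code : Finset ℕ → Fin N → Fin b → Bool := fun W k c =>
    decide (∃ p ∈ W, rank W p = k ∧ b * p + 1 + c ∈ W) with hcode
  have hinj : ∀ W ∈ F, ∀ W' ∈ F, code W = code W' → ∀ j, (∀ i < j, i ∈ W ↔ i ∈ W') →
      j ∈ W → j ∈ W' := by
    intro W hW W' hW' heq j hlt hj
    obtain ⟨hcl, hne, hcard⟩ := hF W hW
    obtain ⟨hcl', hne', -⟩ := hF W' hW'
    rcases eq_or_ne j 0 with rfl | hj0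
    · exact hcl'.zero_mem hne'
    obtain ⟨c, hc, hjc⟩ := eq_child hb hj0
    have hp : par b j ∈ W := hcl j hj
    have hp' : par b j ∈ W' := (hlt _ (par_lt hj0)).mp hp
    have hr : rank W (par b j) = rank W' (par b j) := by
      have : W.filter (fun i => i < par b j) = W'.filter (fun i => i < par b j) := by
        ext i
        simp only [Finset.mem_filter]
        have := par_lt (b := b) hj0
        exact ⟨fun h => ⟨(hlt i (by omega)).mp h.1, h.2⟩,
          fun h => ⟨(hlt i (by omega)).mpr h.1, h.2⟩⟩
      simp only [hrank, this]
    have hrN : rank W (par b j) < N := by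
      refine lt_of_lt_of_le (Finset.card_lt_card ?_) hcard
      refine Finset.filter_ssubset.mpr ⟨par b j, hp, lt_irrefl _⟩
    have h1 : code W ⟨_, hrN⟩ ⟨c, hc⟩ = true := by
      simp only [hcode, decide_eq_true_eq]
      exact ⟨par b j, hp, rfl, by rwa [hjc]⟩
    rw [heq] at h1
    simp only [hcode, decide_eq_true_eq] at h1
    obtain ⟨p', hp'W, hrk, hmem⟩ := h1
    have : p' = par b j := by
      rw [hr] at hrk
      -- the rank is strictly increasing on the members of a set
      have mono : ∀ p q, p ∈ W' → p < q → rank W' p < rank W' q := by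
        intro p q hpW hpq
        refine Finset.card_lt_card ⟨fun i hi => ?_, fun hsub => ?_⟩
        · simp only [Finset.mem_filter] at hi ⊢
          exact ⟨hi.1, hi.2.trans hpq⟩
        · have := hsub (Finset.mem_filter.mpr ⟨hpW, hpq⟩)
          simp at this
      rcases lt_trichotomy p' (par b j) with h | h | h
      · exact absurd hrk (mono _ _ hp'W h).ne
      · exact h
      · exact absurd hrk (mono _ _ hp' h).ne'
    rw [this] at hmem
    rwa [hjc] at hmem
  have hle := Finset.card_le_card_of_injOn (s := F) (t := Finset.univ) code
    (fun _ _ => Finset.mem_coe.mpr (Finset.mem_univ _)) (by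
      intro W hW W' hW' heq
      ext j
      induction j using Nat.strong_induction_on with
      | _ j ih =>
        exact ⟨hinj W hW W' hW' heq j ih, hinj W' hW' W hW heq.symm j fun i hi => (ih i hi).symm⟩)
  refine hle.trans (le_of_eq ?_)
  simp [Finset.card_univ, ← pow_mul]

end TreeSparse

/-! ### Random sign matrices -/

namespace TreeSparse

/-- The sign `±1` encoded by a Boolean. -/
def sg (e : Bool) : ℝ := if e then 1 else -1

theorem sg_sq (e : Bool) : sg e ^ 2 = 1 := by cases e <;> simp [sg]

/-- Both exponential moments, for positive and negative `lam`, of the square of a Rademacher sum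
around its mean: the deviation from `exp (lam * E)` is of second order in `lam`. -/
theorem sum_exp_sq_le (d : ℕ) (v : Fin d → ℝ) (lam s : ℝ) (hlam : |lam| ≤ 1 / 10)
    (hv : ∑ j, v j ^ 2 ≤ 1) :
    ∑ e : Fin d → Bool, Real.exp (lam * (s + ∑ j, sg (e j) * v j) ^ 2) ≤
      2 ^ d * Real.exp ((lam + 4 * lam ^ 2 * ∑ j, v j ^ 2) * (s ^ 2 + ∑ j, v j ^ 2)) := by
  induction d generalizing s with
  | zero => simp
  | succ d ih =>
    set v' : Fin d → ℝ := fun j => v j.succ with hv'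
    set t := ∑ j, v' j ^ 2 with ht
    have ht0 : 0 ≤ t := Finset.sum_nonneg fun _ _ => sq_nonneg _
    have hsum : ∑ j, v j ^ 2 = v 0 ^ 2 + t := by rw [Fin.sum_univ_succ]
    rw [hsum] at hv ⊢
    have ht1 : t ≤ 1 := by nlinarith [sq_nonneg (v 0)]
    set nu := lam + 4 * lam ^ 2 * t with hnu
    have hsplit : ∑ e : Fin (d + 1) → Bool, Real.exp (lam * (s + ∑ j, sg (e j) * v j) ^ 2) =
        ∑ e₀ : Bool, ∑ e : Fin d → Bool,
          Real.exp (lam * ((s + sg e₀ * v 0) + ∑ j, sg (e j) * v' j) ^ 2) := by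
      rw [← Fintype.sum_prod_type']
      refine Fintype.sum_equiv (Fin.consEquiv fun _ => Bool).symm _ _ fun e => ?_
      simp only [Fin.consEquiv, Equiv.coe_fn_symm_mk, Fin.sum_univ_succ, Fin.tail, hv']
      rw [add_assoc]
    rw [hsplit]
    have hcosh : Real.exp (2 * nu * s * v 0) + Real.exp (-(2 * nu * s * v 0)) ≤
        2 * Real.exp (2 * nu ^ 2 * s ^ 2 * v 0 ^ 2) := by
      have := Real.cosh_le_exp_half_sq (2 * nu * s * v 0)
      rw [Real.cosh_eq] at this
      rw [show 2 * nu ^ 2 * s ^ 2 * v 0 ^ 2 = (2 * nu * s * v 0) ^ 2 / 2 by ring]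
      linarith
    have hnusq : nu ^ 2 ≤ 2 * lam ^ 2 := by
      have h := abs_le.mp hlam
      have h1 : 0 ≤ 1 + 4 * lam * t := by nlinarith
      have h2 : 1 + 4 * lam * t ≤ 7 / 5 := by nlinarith
      have h3 : (1 + 4 * lam * t) ^ 2 ≤ 2 := by nlinarith
      calc nu ^ 2 = lam ^ 2 * (1 + 4 * lam * t) ^ 2 := by rw [hnu]; ring
        _ ≤ lam ^ 2 * 2 := mul_le_mul_of_nonneg_left h3 (sq_nonneg _)
        _ = 2 * lam ^ 2 := mul_comm _ _
    calc _ ≤ ∑ e₀ : Bool, 2 ^ d * Real.exp (nu * ((s + sg e₀ * v 0) ^ 2 + t)) :=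
          Finset.sum_le_sum fun e₀ _ => ih v' _ ht1
      _ = 2 ^ d * (Real.exp (nu * (s ^ 2 + v 0 ^ 2 + t)) *
          (Real.exp (2 * nu * s * v 0) + Real.exp (-(2 * nu * s * v 0)))) := by
          rw [Fintype.sum_bool, mul_add (Real.exp (nu * (s ^ 2 + v 0 ^ 2 + t))), ← Real.exp_add,
            ← Real.exp_add, mul_add]
          simp only [sg, if_true, Bool.false_eq_true, if_false]
          ring_nf
      _ ≤ 2 ^ d * (Real.exp (nu * (s ^ 2 + v 0 ^ 2 + t)) *
          (2 * Real.exp (2 * nu ^ 2 * s ^ 2 * v 0 ^ 2))) := by gcongr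
      _ = 2 ^ (d + 1) * Real.exp (nu * (s ^ 2 + v 0 ^ 2 + t) + 2 * nu ^ 2 * s ^ 2 * v 0 ^ 2) := by
          rw [Real.exp_add]; ring
      _ ≤ _ := by
          gcongr
          have h1 : nu ^ 2 * (s ^ 2 * v 0 ^ 2) ≤ 2 * lam ^ 2 * (s ^ 2 * v 0 ^ 2) :=
            mul_le_mul_of_nonneg_right hnusq (by positivity)
          have h2 : 0 ≤ lam ^ 2 * v 0 ^ 2 * (v 0 ^ 2 + t) := by positivity
          nlinarith

/-- Markov's inequality for the exponential moments of a sign matrix applied to one vector. -/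
theorem card_bad_le (d m : ℕ) (v : Fin d → ℝ) (lam c : ℝ) (hlam : |lam| ≤ 1 / 10)
    (hv : ∑ j, v j ^ 2 ≤ 1) (B : Finset (Fin m → Fin d → Bool))
    (hB : ∀ w ∈ B, m * c ≤ lam * ∑ i, (∑ j, sg (w i j) * v j) ^ 2) :
    (B.card : ℝ) ≤ 2 ^ (d * m) *
      Real.exp (m * ((lam + 4 * lam ^ 2 * ∑ j, v j ^ 2) * (∑ j, v j ^ 2) - c)) := by
  have h1 : (B.card : ℝ) * Real.exp (m * c) ≤
      ∑ w : Fin m → Fin d → Bool, Real.exp (lam * ∑ i, (∑ j, sg (w i j) * v j) ^ 2) := by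
    calc (B.card : ℝ) * Real.exp (m * c) = ∑ w ∈ B, Real.exp (m * c) := by simp
      _ ≤ ∑ w ∈ B, Real.exp (lam * ∑ i, (∑ j, sg (w i j) * v j) ^ 2) :=
          Finset.sum_le_sum fun w hw => Real.exp_le_exp.mpr (hB w hw)
      _ ≤ _ := Finset.sum_le_sum_of_subset_of_nonneg (Finset.subset_univ _)
          fun _ _ _ => (Real.exp_pos _).le
  have h2 : ∑ w : Fin m → Fin d → Bool, Real.exp (lam * ∑ i, (∑ j, sg (w i j) * v j) ^ 2) =
      (∑ e : Fin d → Bool, Real.exp (lam * (0 + ∑ j, sg (e j) * v j) ^ 2)) ^ m := by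
    rw [Fintype.sum_pow]
    refine Finset.sum_congr rfl fun w _ => ?_
    rw [Finset.mul_sum, Real.exp_sum]
    simp
  have h3 := pow_le_pow_left₀ (Finset.sum_nonneg fun _ _ => (Real.exp_pos _).le)
    (sum_exp_sq_le d v lam 0 hlam hv) m
  rw [← h2, mul_pow, ← pow_mul, ← Real.exp_nat_mul] at h3
  have h4 := h1.trans h3
  rw [← le_div_iff₀ (Real.exp_pos _), mul_div_assoc, ← Real.exp_sub] at h4
  refine h4.trans (le_of_eq ?_)
  congr 2
  ring

/-- A sign matrix that approximately preserves the norms of finitely many vectors. -/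
theorem exists_signs (d m : ℕ) (I : Finset (Fin d → ℝ)) (hI : ∀ v ∈ I, ∑ j, v j ^ 2 ≤ 1)
    (hcard : I.card * (2 * Real.exp (-(m / 4096 : ℝ))) < 1) :
    ∃ w : Fin m → Fin d → Bool, ∀ v ∈ I,
      |∑ i, (∑ j, sg (w i j) * v j) ^ 2 - m * ∑ j, v j ^ 2| ≤ m / 16 := by
  classical
  by_contra hcon
  push Not at hcon
  set X : (Fin m → Fin d → Bool) → (Fin d → ℝ) → ℝ :=
    fun w v => ∑ i, (∑ j, sg (w i j) * v j) ^ 2 with hX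
  set bad : (Fin d → ℝ) → Finset (Fin m → Fin d → Bool) := fun v =>
    (Finset.univ.filter fun w => m * (∑ j, v j ^ 2 + 1 / 16) ≤ X w v) ∪
    (Finset.univ.filter fun w => X w v ≤ m * (∑ j, v j ^ 2 - 1 / 16)) with hbad
  have hcover : (Finset.univ : Finset (Fin m → Fin d → Bool)) ⊆ I.biUnion bad := by
    intro w _
    obtain ⟨v, hv, hlt⟩ := hcon w
    rw [Finset.mem_biUnion]
    refine ⟨v, hv, ?_⟩
    simp only [hbad, Finset.mem_union, Finset.mem_filter, Finset.mem_univ, true_and]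
    rcases lt_abs.mp hlt with h | h
    · left
      simp only [hX]
      linarith
    · right
      simp only [hX]
      linarith
  have hone : ∀ v ∈ I, ((bad v).card : ℝ) ≤ 2 ^ (d * m) * (2 * Real.exp (-(m / 4096 : ℝ))) := by
    intro v hv
    have hv1 := hI v hv
    have hv0 : 0 ≤ ∑ j, v j ^ 2 := Finset.sum_nonneg fun _ _ => sq_nonneg _
    set t := ∑ j, v j ^ 2 with ht
    have ht2 : t ^ 2 ≤ 1 := by nlinarith
    have hm : (0 : ℝ) ≤ m := Nat.cast_nonneg _
    -- for `|lam| = 1 / 128` the second order term `4 * lam ^ 2` is half of `|lam| / 16`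
    have up := card_bad_le d m v (1 / 128) (1 / 128 * (t + 1 / 16)) (by norm_num [abs_le]) hv1
      (Finset.univ.filter fun w => m * (t + 1 / 16) ≤ X w v) (by
        intro w hw
        have := (Finset.mem_filter.mp hw).2
        simp only [hX] at this
        linarith)
    have lo := card_bad_le d m v (-(1 / 128)) (-(1 / 128) * (t - 1 / 16))
      (by norm_num) hv1
      (Finset.univ.filter fun w => X w v ≤ m * (t - 1 / 16)) (by
        intro w hw
        have := (Finset.mem_filter.mp hw).2
        simp only [hX] at this
        linarith)
    rw [← ht] at up lo
    have e1 : (m : ℝ) * ((1 / 128 + 4 * (1 / 128) ^ 2 * t) * t - 1 / 128 * (t + 1 / 16)) ≤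
        -(m / 4096) := by nlinarith
    have e2 : (m : ℝ) * ((-(1 / 128) + 4 * (-(1 / 128)) ^ 2 * t) * t - -(1 / 128) * (t - 1 / 16)) ≤
        -(m / 4096) := by nlinarith
    have up' := up.trans (mul_le_mul_of_nonneg_left (Real.exp_le_exp.mpr e1) (by positivity))
    have lo' := lo.trans (mul_le_mul_of_nonneg_left (Real.exp_le_exp.mpr e2) (by positivity))
    have hun : ((bad v).card : ℝ) ≤
        ((Finset.univ.filter fun w => m * (t + 1 / 16) ≤ X w v).card : ℝ) +
          ((Finset.univ.filter fun w => X w v ≤ m * (t - 1 / 16)).card : ℝ) := by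
      exact_mod_cast Finset.card_union_le (Finset.univ.filter fun w => m * (t + 1 / 16) ≤ X w v)
        (Finset.univ.filter fun w => X w v ≤ m * (t - 1 / 16))
    linarith
  have htotal : ((2 : ℝ) ^ (d * m)) ≤
      I.card * (2 ^ (d * m) * (2 * Real.exp (-(m / 4096 : ℝ)))) := by
    have hc : (Finset.univ : Finset (Fin m → Fin d → Bool)).card = 2 ^ (d * m) := by
      simp [Finset.card_univ, ← pow_mul]
    have h1 : ((Finset.univ : Finset (Fin m → Fin d → Bool)).card : ℝ) ≤ (I.biUnion bad).card := by
      exact_mod_cast Finset.card_le_card hcover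
    rw [hc] at h1
    push_cast at h1
    refine h1.trans ?_
    have h2 : ((I.biUnion bad).card : ℝ) ≤ ∑ v ∈ I, ((bad v).card : ℝ) := by
      exact_mod_cast Finset.card_biUnion_le
    refine h2.trans ((Finset.sum_le_sum hone).trans (le_of_eq ?_))
    rw [Finset.sum_const, nsmul_eq_mul]
  have hp : (0 : ℝ) < 2 ^ (d * m) := by positivity
  have : (2 : ℝ) ^ (d * m) * 1 ≤ 2 ^ (d * m) * (I.card * (2 * Real.exp (-(m / 4096 : ℝ)))) := by
    rw [mul_one]
    refine htotal.trans (le_of_eq (by ring))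
  exact absurd (le_of_mul_le_mul_left this hp) (not_le.mpr hcard)

theorem sum_half_pow_le (B : ℕ) :
    ∑ z ∈ Finset.Icc (-(B : ℤ)) B, (1 / 2 : ℝ) ^ z.natAbs = 3 - 2 * (1 / 2) ^ B := by
  induction B with
  | zero => norm_num
  | succ B ih =>
    have h : Finset.Icc (-((B + 1 : ℕ) : ℤ)) ((B + 1 : ℕ) : ℤ) =
        insert ((B + 1 : ℕ) : ℤ) (insert (-((B + 1 : ℕ) : ℤ)) (Finset.Icc (-(B : ℤ)) B)) := by
      ext z
      simp only [Finset.mem_Icc, Finset.mem_insert]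
      omega
    rw [h, Finset.sum_insert, Finset.sum_insert, ih, Int.natAbs_neg, Int.natAbs_natCast, pow_succ]
    · ring
    · simp only [Finset.mem_Icc]; omega
    · simp only [Finset.mem_insert, Finset.mem_Icc]; omega

/-- The integer vectors supported in `W` with `ℓ1` norm at most `B`. -/
noncomputable def intBall {d : ℕ} (W : Finset (Fin d)) (B : ℕ) : Finset (Fin d → ℤ) :=
  (Fintype.piFinset fun j => if j ∈ W then Finset.Icc (-(B : ℤ)) B else {0}).filter
    fun k => ∑ j, (k j).natAbs ≤ B

theorem card_intBall_le {d : ℕ} (W : Finset (Fin d)) (B : ℕ) :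
    ((intBall W B).card : ℝ) ≤ 2 ^ B * 3 ^ W.card := by
  have h1 : ∀ k ∈ intBall W B, (1 : ℝ) ≤ 2 ^ B * ∏ j, (1 / 2 : ℝ) ^ (k j).natAbs := by
    intro k hk
    have hk := (Finset.mem_filter.mp hk).2
    rw [Finset.prod_pow_eq_pow_sum]
    have h2 : (1 / 2 : ℝ) ^ B ≤ (1 / 2) ^ ∑ j, (k j).natAbs :=
      pow_le_pow_of_le_one (by norm_num) (by norm_num) hk
    calc (1 : ℝ) = 2 ^ B * (1 / 2) ^ B := by rw [← mul_pow]; norm_num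
      _ ≤ _ := by gcongr
  calc ((intBall W B).card : ℝ) = ∑ k ∈ intBall W B, 1 := by simp
    _ ≤ ∑ k ∈ intBall W B, 2 ^ B * ∏ j, (1 / 2 : ℝ) ^ (k j).natAbs := Finset.sum_le_sum h1
    _ ≤ ∑ k ∈ Fintype.piFinset fun j => if j ∈ W then Finset.Icc (-(B : ℤ)) B else {0},
          2 ^ B * ∏ j, (1 / 2 : ℝ) ^ (k j).natAbs :=
        Finset.sum_le_sum_of_subset_of_nonneg (Finset.filter_subset _ _)
          fun _ _ _ => by positivity
    _ = 2 ^ B * ∏ j, ∑ z ∈ (if j ∈ W then Finset.Icc (-(B : ℤ)) B else {0}),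
          (1 / 2 : ℝ) ^ z.natAbs := by
        rw [← Finset.mul_sum]
        exact congrArg _ (Finset.prod_univ_sum
          (fun j => if j ∈ W then Finset.Icc (-(B : ℤ)) B else {0})
          fun _ (z : ℤ) => (1 / 2 : ℝ) ^ z.natAbs).symm
    _ ≤ 2 ^ B * ∏ j : Fin d, if j ∈ W then 3 else 1 := by
        gcongr with j _
        split_ifs
        · rw [sum_half_pow_le]
          have : (0 : ℝ) ≤ (1 / 2) ^ B := by positivity
          linarith
        · simp
    _ = 2 ^ B * 3 ^ W.card := by
        rw [Finset.prod_ite_mem, Finset.univ_inter, Finset.prod_const]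

/-- Rounding towards zero. -/
theorem exists_round (r : ℝ) : ∃ k : ℤ, |(k : ℝ)| ≤ |r| ∧ |r - k| ≤ 1 := by
  rcases le_total 0 r with hr | hr
  · have h0 : (0 : ℝ) ≤ ⌊r⌋ := by exact_mod_cast Int.floor_nonneg.mpr hr
    refine ⟨⌊r⌋, ?_, ?_⟩
    · rw [abs_of_nonneg hr, abs_of_nonneg h0]
      exact Int.floor_le r
    · rw [abs_le]
      constructor <;> linarith [Int.floor_le r, Int.lt_floor_add_one r]
  · have h0 : (⌈r⌉ : ℝ) ≤ 0 := by exact_mod_cast Int.ceil_nonpos.mpr hr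
    refine ⟨⌈r⌉, ?_, ?_⟩
    · rw [abs_of_nonpos hr, abs_of_nonpos h0]
      linarith [Int.le_ceil r]
    · rw [abs_le]
      constructor <;> linarith [Int.le_ceil r, Int.ceil_lt_add_one r]

/-- The deviation of `∑ i, (w v)_i ^ 2` from its mean, for a sign matrix `w`. -/
noncomputable def dev {d m : ℕ} (w : Fin m → Fin d → Bool) (v : Fin d → ℝ) : ℝ :=
  ∑ i, (∑ j, sg (w i j) * v j) ^ 2 - m * ∑ j, v j ^ 2

theorem dev_smul {d m : ℕ} (w : Fin m → Fin d → Bool) (v : Fin d → ℝ) (r : ℝ) :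
    dev w (fun j => r * v j) = r ^ 2 * dev w v := by
  have h : ∀ i, ∑ j, sg (w i j) * (r * v j) = r * ∑ j, sg (w i j) * v j := fun i => by
    rw [Finset.mul_sum]
    exact Finset.sum_congr rfl fun j _ => by ring
  simp only [dev, h, mul_pow, ← Finset.mul_sum]
  ring

/-- A polarization identity. -/
theorem dev_sub_dev {d m : ℕ} (w : Fin m → Fin d → Bool) (x z : Fin d → ℝ) :
    32 * (dev w x - dev w z) =
      dev w (fun j => 9 * x j - 7 * z j) - dev w (fun j => 7 * x j - 9 * z j) := by
  have h : ∀ (r s : ℝ) i, ∑ j, sg (w i j) * (r * x j - s * z j) =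
      r * ∑ j, sg (w i j) * x j - s * ∑ j, sg (w i j) * z j := fun r s i => by
    rw [Finset.mul_sum, Finset.mul_sum, ← Finset.sum_sub_distrib]
    exact Finset.sum_congr rfl fun j _ => by ring
  simp only [dev, h]
  have e1 : ∑ i, (9 * ∑ j, sg (w i j) * x j - 7 * ∑ j, sg (w i j) * z j) ^ 2 -
      ∑ i, (7 * ∑ j, sg (w i j) * x j - 9 * ∑ j, sg (w i j) * z j) ^ 2 =
      32 * (∑ i, (∑ j, sg (w i j) * x j) ^ 2 - ∑ i, (∑ j, sg (w i j) * z j) ^ 2) := by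
    rw [← Finset.sum_sub_distrib, ← Finset.sum_sub_distrib, Finset.mul_sum]
    exact Finset.sum_congr rfl fun j _ => by ring
  have e2 : ∑ j, (9 * x j - 7 * z j) ^ 2 - ∑ j, (7 * x j - 9 * z j) ^ 2 =
      32 * (∑ j, x j ^ 2 - ∑ j, z j ^ 2) := by
    rw [← Finset.sum_sub_distrib, ← Finset.sum_sub_distrib, Finset.mul_sum]
    exact Finset.sum_congr rfl fun j _ => by ring
  linear_combination -e1 + m * e2

/-- A self-improving bound: if the deviation is at most `θ ‖x‖²` on a subspace, and small on a net
of its unit ball, then it is at most `(m / 16 + θ / 2) ‖x‖²`. The net consists of the multiples of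
`1 / (4 √N)`; rounding towards zero moves a unit vector by at most `1 / 4`. -/
theorem dev_le_of_net {d m N : ℕ} (w : Fin m → Fin d → Bool) (W : Finset (Fin d)) (hN : 1 ≤ N)
    (hW : W.card ≤ N)
    (hnet : ∀ k ∈ intBall W (4 * N), ∑ j, ((k j : ℝ) / (4 * √N)) ^ 2 ≤ 1 →
      |dev w fun j => (k j : ℝ) / (4 * √N)| ≤ m / 16)
    {θ : ℝ} (hθ : ∀ x : Fin d → ℝ, (∀ j ∉ W, x j = 0) → |dev w x| ≤ θ * ∑ j, x j ^ 2)
    (hθ0 : 0 ≤ θ) (x : Fin d → ℝ) (hx : ∀ j ∉ W, x j = 0) (hx1 : ∑ j, x j ^ 2 = 1) :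
    |dev w x| ≤ m / 16 + θ / 2 := by
  have hN' : (1 : ℝ) ≤ N := by exact_mod_cast hN
  have hs : 0 < √(N : ℝ) := Real.sqrt_pos.mpr (by linarith)
  have hs2 : √(N : ℝ) ^ 2 = N := Real.sq_sqrt (by linarith)
  set h : ℝ := 4 * √N with hh
  have hpos : 0 < h := by positivity
  choose k hk1 hk2 using fun j => exists_round (h * x j)
  set z : Fin d → ℝ := fun j => (k j : ℝ) / h with hz
  have hzx : ∀ j, |z j| ≤ |x j| := by
    intro j
    have := hk1 j
    rw [abs_mul, abs_of_pos hpos] at this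
    rw [hz, abs_div, abs_of_pos hpos, div_le_iff₀ hpos]
    linarith
  have hz0 : ∀ j ∉ W, z j = 0 := by
    intro j hj
    have := hzx j
    rw [hx j hj, abs_zero] at this
    exact abs_nonpos_iff.mp this
  have hdiff : ∑ j, (x j - z j) ^ 2 ≤ 1 / 16 := by
    have h1 : ∀ j ∈ W, (x j - z j) ^ 2 ≤ 1 / h ^ 2 := by
      intro j _
      have e : x j - z j = (h * x j - k j) / h := by rw [hz]; field_simp
      rw [e, div_pow]
      gcongr
      rw [← sq_abs]
      nlinarith [hk2 j, abs_nonneg (h * x j - k j)]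
    calc ∑ j, (x j - z j) ^ 2 = ∑ j ∈ W, (x j - z j) ^ 2 := by
          refine (Finset.sum_subset (Finset.subset_univ W) fun j _ hj => ?_).symm
          rw [hx j hj, hz0 j hj]; ring
      _ ≤ W.card • (1 / h ^ 2) := Finset.sum_le_card_nsmul _ _ _ h1
      _ ≤ N * (1 / h ^ 2) := by
          rw [nsmul_eq_mul]
          gcongr
      _ = 1 / 16 := by
          rw [hh, mul_pow, hs2]
          field_simp
          norm_num
  have hzn : ∑ j, z j ^ 2 ≤ 1 := by
    rw [← hx1]
    exact Finset.sum_le_sum fun j _ => sq_le_sq.mpr (hzx j)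
  have hkmem : k ∈ intBall W (4 * N) := by
    have hsum : ∑ j, (k j).natAbs ≤ 4 * N := by
      have h1 : ∑ j, |x j| ≤ √N := by
        refine Real.le_sqrt_of_sq_le ?_
        have e : ∑ j, |x j| = ∑ j ∈ W, |x j| := by
          refine (Finset.sum_subset (Finset.subset_univ W) fun j _ hj => ?_).symm
          rw [hx j hj, abs_zero]
        rw [e]
        calc (∑ j ∈ W, |x j|) ^ 2 ≤ W.card * ∑ j ∈ W, |x j| ^ 2 := sq_sum_le_card_mul_sum_sq
          _ ≤ N * 1 := by
              gcongr
              rw [← hx1]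
              simp only [sq_abs]
              exact Finset.sum_le_sum_of_subset_of_nonneg (Finset.subset_univ _)
                fun _ _ _ => sq_nonneg _
          _ = N := mul_one _
      have h2 : ((∑ j, (k j).natAbs : ℕ) : ℝ) ≤ ((4 * N : ℕ) : ℝ) := by
        push_cast
        calc ∑ j, (((k j).natAbs : ℕ) : ℝ) ≤ ∑ j, h * |x j| := by
              refine Finset.sum_le_sum fun j _ => ?_
              have := hk1 j
              rw [abs_mul, abs_of_pos hpos] at this
              rwa [Nat.cast_natAbs, Int.cast_abs]
          _ ≤ h * √N := by rw [← Finset.mul_sum]; gcongr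
          _ = 4 * N := by rw [hh, mul_assoc, ← sq, hs2]
      exact_mod_cast h2
    refine Finset.mem_filter.mpr ⟨Fintype.mem_piFinset.mpr fun j => ?_, hsum⟩
    split_ifs with hj
    · have := (Finset.single_le_sum (f := fun j => (k j).natAbs) (fun _ _ => Nat.zero_le _)
        (Finset.mem_univ j)).trans hsum
      rw [Finset.mem_Icc]
      omega
    · have := hz0 j hj
      rw [hz, div_eq_zero_iff] at this
      rcases this with h0 | h0
      · rw [Finset.mem_singleton]; exact_mod_cast h0
      · exact absurd h0 hpos.ne'
  have hQz := hnet k hkmem hzn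
  have hpol := dev_sub_dev w x z
  have a1 := hθ (fun j => 9 * x j - 7 * z j) fun j hj => by rw [hx j hj, hz0 j hj]; ring
  have a2 := hθ (fun j => 7 * x j - 9 * z j) fun j hj => by rw [hx j hj, hz0 j hj]; ring
  have hnorm : ∑ j, (9 * x j - 7 * z j) ^ 2 + ∑ j, (7 * x j - 9 * z j) ^ 2 ≤ 16 := by
    have e : ∑ j, (9 * x j - 7 * z j) ^ 2 + ∑ j, (7 * x j - 9 * z j) ^ 2 =
        126 * ∑ j, (x j - z j) ^ 2 + 4 * ∑ j, x j ^ 2 + 4 * ∑ j, z j ^ 2 := by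
      simp only [Finset.mul_sum, ← Finset.sum_add_distrib]
      exact Finset.sum_congr rfl fun j _ => by ring
    rw [e]
    linarith
  have hprod : θ * ∑ j, (9 * x j - 7 * z j) ^ 2 + θ * ∑ j, (7 * x j - 9 * z j) ^ 2 ≤ 16 * θ := by
    rw [← mul_add, mul_comm 16]
    exact mul_le_mul_of_nonneg_left hnorm hθ0
  rw [abs_le] at hQz a1 a2 ⊢
  constructor <;> linarith [hQz.1, hQz.2, a1.1, a1.2, a2.1, a2.2]

/-- The restricted isometry property of a sign matrix on a coordinate subspace, from its behaviour
on a net. -/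
theorem dev_le {d m N : ℕ} (w : Fin m → Fin d → Bool) (W : Finset (Fin d)) (hN : 1 ≤ N)
    (hW : W.card ≤ N)
    (hnet : ∀ k ∈ intBall W (4 * N), ∑ j, ((k j : ℝ) / (4 * √N)) ^ 2 ≤ 1 →
      |dev w fun j => (k j : ℝ) / (4 * √N)| ≤ m / 16)
    (x : Fin d → ℝ) (hx : ∀ j ∉ W, x j = 0) : |dev w x| ≤ m / 8 * ∑ j, x j ^ 2 := by
  set T : Set ℝ := {θ | 0 ≤ θ ∧ ∀ x : Fin d → ℝ, (∀ j ∉ W, x j = 0) →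
    |dev w x| ≤ θ * ∑ j, x j ^ 2} with hT
  have hbdd : BddBelow T := ⟨0, fun θ h => h.1⟩
  have hne : T.Nonempty := by
    refine ⟨m * d + m, by positivity, fun x _ => ?_⟩
    have hs0 : 0 ≤ ∑ j, x j ^ 2 := Finset.sum_nonneg fun _ _ => sq_nonneg _
    have h1 : ∑ i, (∑ j, sg (w i j) * x j) ^ 2 ≤ m * (d * ∑ j, x j ^ 2) := by
      calc ∑ i, (∑ j, sg (w i j) * x j) ^ 2 ≤ ∑ _i : Fin m, (d * ∑ j, x j ^ 2) := by
            refine Finset.sum_le_sum fun i _ => ?_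
            have := sq_sum_le_card_mul_sum_sq (s := (Finset.univ : Finset (Fin d)))
              (f := fun j => sg (w i j) * x j)
            simpa [mul_pow, sg_sq] using this
        _ = _ := by simp
    have h2 : 0 ≤ ∑ i, (∑ j, sg (w i j) * x j) ^ 2 := Finset.sum_nonneg fun _ _ => sq_nonneg _
    have h3 : 0 ≤ (m : ℝ) * ∑ j, x j ^ 2 := by positivity
    have h4 : 0 ≤ (m : ℝ) * (d * ∑ j, x j ^ 2) := by positivity
    rw [dev, abs_le]
    constructor <;> linarith
  have hmem : sInf T ∈ T := by
    refine ⟨le_csInf hne fun θ h => h.1, fun x hx => ?_⟩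
    have hs0 : 0 ≤ ∑ j, x j ^ 2 := Finset.sum_nonneg fun _ _ => sq_nonneg _
    rcases hs0.eq_or_lt with h0 | hpos
    · obtain ⟨θ, hθ⟩ := hne
      have := hθ.2 x hx
      rwa [← h0, mul_zero] at this ⊢
    · rw [← div_le_iff₀ hpos]
      exact le_csInf hne fun θ h => (div_le_iff₀ hpos).mpr (h.2 x hx)
  have himp : m / 16 + sInf T / 2 ∈ T := by
    refine ⟨add_nonneg (by positivity) (by linarith [hmem.1]), fun x hx => ?_⟩
    have hs0 : 0 ≤ ∑ j, x j ^ 2 := Finset.sum_nonneg fun _ _ => sq_nonneg _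
    rcases hs0.eq_or_lt with h0 | hpos
    · have := hmem.2 x hx
      rwa [← h0, mul_zero] at this ⊢
    · set r := √(∑ j, x j ^ 2) with hr
      have hr0 : 0 < r := Real.sqrt_pos.mpr hpos
      have hr2 : r ^ 2 = ∑ j, x j ^ 2 := Real.sq_sqrt hs0
      have := dev_le_of_net w W hN hW hnet hmem.2 hmem.1 (fun j => r⁻¹ * x j)
        (fun j hj => by rw [hx j hj, mul_zero]) (by
          simp only [mul_pow]
          rw [← Finset.mul_sum, ← hr2]
          field_simp)
      rw [dev_smul, abs_mul, abs_of_nonneg (by positivity), inv_pow, hr2,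
        inv_mul_le_iff₀ hpos] at this
      linarith
  have hle := csInf_le hbdd himp
  have h8 : sInf T ≤ m / 8 := by linarith
  exact (hmem.2 x hx).trans (mul_le_mul_of_nonneg_right h8
    (Finset.sum_nonneg fun _ _ => sq_nonneg _))

/-- A sign matrix with the restricted isometry property on finitely many coordinate subspaces. -/
theorem exists_signs_rip (d m N : ℕ) (hN : 1 ≤ N) (F : Finset (Finset (Fin d)))
    (hF : ∀ W ∈ F, W.card ≤ N)
    (hcard : F.card * (2 ^ (4 * N) * 3 ^ N) * (2 * Real.exp (-(m / 4096 : ℝ))) < 1) :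
    ∃ w : Fin m → Fin d → Bool, ∀ W ∈ F, ∀ x : Fin d → ℝ, (∀ j ∉ W, x j = 0) →
      |dev w x| ≤ m / 8 * ∑ j, x j ^ 2 := by
  classical
  set I : Finset (Fin d → ℝ) := (F.biUnion fun W => (intBall W (4 * N)).image
    fun k j => (k j : ℝ) / (4 * √N)).filter fun v => ∑ j, v j ^ 2 ≤ 1 with hI
  have hIcard : (I.card : ℝ) ≤ F.card * (2 ^ (4 * N) * 3 ^ N) := by
    calc (I.card : ℝ) ≤ ∑ W ∈ F, ((intBall W (4 * N)).card : ℝ) := by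
          have h1 : I.card ≤ ∑ W ∈ F, (intBall W (4 * N)).card :=
            (Finset.card_filter_le _ _).trans (Finset.card_biUnion_le.trans
              (Finset.sum_le_sum fun W _ => Finset.card_image_le))
          exact_mod_cast h1
      _ ≤ ∑ W ∈ F, (2 ^ (4 * N) * 3 ^ N : ℝ) := by
          refine Finset.sum_le_sum fun W hW => (card_intBall_le W _).trans ?_
          gcongr
          · norm_num
          · exact hF W hW
      _ = _ := by rw [Finset.sum_const, nsmul_eq_mul]
  obtain ⟨w, hw⟩ := exists_signs d m I (fun v hv => (Finset.mem_filter.mp hv).2)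
    (lt_of_le_of_lt (mul_le_mul_of_nonneg_right hIcard (by positivity)) hcard)
  refine ⟨w, fun W hW => dev_le w W hN (hF W hW) fun k hk hk1 => hw _ ?_⟩
  exact Finset.mem_filter.mpr ⟨Finset.mem_biUnion.mpr ⟨W, hW, Finset.mem_image_of_mem _ hk⟩, hk1⟩

/-- The restricted isometry property for the subtrees with at most `N` nodes among the first `n'`
nodes, for a matrix with entries `a i j`, `i < m`, `j < n`. -/
def TreeRIP (b n' N m n : ℕ) (a : ℕ → ℕ → ℝ) : Prop :=
  ∀ W : Finset ℕ, PClosed b W → (∀ p ∈ W, p < n') → W.card ≤ N → ∀ x : ℕ → ℝ, (∀ j ∉ W, x j = 0) →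
    |∑ i ∈ Finset.range m, (∑ j ∈ Finset.range n, a i j * x j) ^ 2 -
      m * ∑ j ∈ Finset.range n, x j ^ 2| ≤ m / 8 * ∑ j ∈ Finset.range n, x j ^ 2

/-- A matrix with the restricted isometry property for trees; its columns beyond the first `n'` ones
vanish, the other ones have entries `±1`. -/
theorem exists_treeRIP (b n' N m n : ℕ) (hb : 0 < b) (hn : n' ≤ n) (hN : 1 ≤ N)
    (hm : 4096 * ((b + 7) * N) ≤ m) :
    ∃ a : ℕ → ℕ → ℝ, (∀ i j, n' ≤ j → a i j = 0) ∧
      (∀ i j, ∃ e : ℤ, a i j = e ∧ |e| ≤ 1) ∧ TreeRIP b n' N m n a := by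
  classical
  set F : Finset (Finset ℕ) := (Finset.range n').powerset.filter
    fun W => PClosed b W ∧ W.Nonempty ∧ W.card ≤ N with hF
  have hFc : F.card ≤ 2 ^ (b * N) :=
    card_trees_le b N hb F fun W hW => (Finset.mem_filter.mp hW).2
  set lift : Finset ℕ → Finset (Fin n') := fun W => Finset.univ.filter fun j => (j : ℕ) ∈ W
  have hlift : ∀ W, (lift W).card ≤ W.card := fun W =>
    Finset.card_le_card_of_injOn (fun j => (j : ℕ)) (fun j hj => by
      simpa [lift] using hj) (fun i _ j _ h => Fin.ext h)
  obtain ⟨w, hw⟩ := exists_signs_rip n' m N hN (F.image lift) (by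
    intro W hW
    obtain ⟨W', hW', rfl⟩ := Finset.mem_image.mp hW
    exact (hlift W').trans (Finset.mem_filter.mp hW').2.2.2) (by
    have h1 : ((F.image lift).card : ℝ) ≤ 2 ^ (b * N) := by
      exact_mod_cast Finset.card_image_le.trans hFc
    have h2 : ((b + 7) * N : ℝ) ≤ m / 4096 := by
      rw [le_div_iff₀ (by norm_num)]
      have : ((4096 * ((b + 7) * N) : ℕ) : ℝ) ≤ m := by exact_mod_cast hm
      push_cast at this
      linarith
    have h3 : Real.exp (-(m / 4096 : ℝ)) ≤ Real.exp (-1) ^ ((b + 7) * N) := by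
      rw [← Real.exp_nat_mul]
      apply Real.exp_le_exp.mpr
      push_cast
      linarith
    have h4 : Real.exp (-1) < 1 / 2 := by
      have := Real.exp_one_gt_d9
      rw [Real.exp_neg, inv_eq_one_div]
      exact one_div_lt_one_div_of_lt (by norm_num) (by linarith)
    have h5 : Real.exp (-1) ^ ((b + 7) * N) < (1 / 2) ^ ((b + 7) * N) :=
      pow_lt_pow_left₀ h4 (Real.exp_pos _).le (Nat.mul_ne_zero (by omega) (by omega))
    have h6 : (3 : ℝ) ^ N ≤ 2 ^ (2 * N) := by
      rw [pow_mul]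
      exact pow_le_pow_left₀ (by norm_num) (by norm_num) N
    have h7 : (2 : ℝ) ≤ 2 ^ N := by
      calc (2 : ℝ) = 2 ^ 1 := (pow_one _).symm
        _ ≤ 2 ^ N := pow_le_pow_right₀ (by norm_num) hN
    calc ((F.image lift).card : ℝ) * (2 ^ (4 * N) * 3 ^ N) * (2 * Real.exp (-(m / 4096 : ℝ)))
        ≤ 2 ^ (b * N) * (2 ^ (4 * N) * 2 ^ (2 * N)) *
          (2 ^ N * Real.exp (-1) ^ ((b + 7) * N)) := by gcongr
      _ < 2 ^ (b * N) * (2 ^ (4 * N) * 2 ^ (2 * N)) * (2 ^ N * (1 / 2) ^ ((b + 7) * N)) := by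
          gcongr
      _ = 1 := by
          rw [one_div, inv_pow, ← pow_add, ← pow_add, ← mul_assoc, ← pow_add,
            show b * N + (4 * N + 2 * N) + N = (b + 7) * N by ring]
          exact mul_inv_cancel₀ (by positivity))
  set a : ℕ → ℕ → ℝ := fun i j => if h : i < m ∧ j < n' then sg (w ⟨i, h.1⟩ ⟨j, h.2⟩) else 0
    with ha
  refine ⟨a, fun i j hj => ?_, fun i j => ?_, ?_⟩
  · simp only [ha]
    rw [dif_neg (by omega)]
  · simp only [ha]
    split_ifs with h
    · cases w ⟨i, h.1⟩ ⟨j, h.2⟩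
      · exact ⟨-1, by simp [sg], by simp⟩
      · exact ⟨1, by simp [sg], by simp⟩
    · exact ⟨0, by simp, by simp⟩
  · intro W hW hWn hWN x hx
    rcases W.eq_empty_or_nonempty with rfl | hne
    · have : ∀ j, x j = 0 := fun j => hx j (Finset.notMem_empty j)
      simp [this]
    have hxn : ∀ j, n' ≤ j → x j = 0 := fun j hj => hx j fun h => by
      have := hWn j h
      omega
    have key := hw (lift W) (Finset.mem_image_of_mem _ (Finset.mem_filter.mpr
      ⟨Finset.mem_powerset.mpr fun p hp => Finset.mem_range.mpr (hWn p hp), hW, hne, hWN⟩))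
      (fun j => x j) (fun j hj => hx j fun h => hj (by simpa [lift] using h))
    have e1 : ∑ j ∈ Finset.range n, x j ^ 2 = ∑ j : Fin n', x j ^ 2 := by
      rw [Fin.sum_univ_eq_sum_range (fun j => x j ^ 2)]
      refine (Finset.sum_subset (Finset.range_subset_range.mpr hn) fun j _ hj => ?_).symm
      rw [hxn j (by simpa using hj)]; ring
    have e2 : ∀ i : Fin m, ∑ j ∈ Finset.range n, a i j * x j =
        ∑ j : Fin n', sg (w i j) * x j := by
      intro i
      rw [← Finset.sum_subset (Finset.range_subset_range.mpr hn) fun j _ hj => by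
        rw [hxn j (by simpa using hj), mul_zero],
        ← Fin.sum_univ_eq_sum_range (fun j => a i j * x j)]
      refine Finset.sum_congr rfl fun j _ => ?_
      simp only [ha]
      rw [dif_pos ⟨i.2, j.2⟩]
    rw [e1, ← Fin.sum_univ_eq_sum_range (fun i => (∑ j ∈ Finset.range n, a i j * x j) ^ 2)]
    simp only [e2]
    exact key

end TreeSparse

/-! ### Convergence of the iteration -/

namespace TreeSparse

open RealRAM

/-- The Euclidean norm of the restriction of `f` to `s`. -/
noncomputable def nrm (s : Finset ℕ) (f : ℕ → ℝ) : ℝ := √(∑ i ∈ s, f i ^ 2)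

theorem nrm_nonneg (s : Finset ℕ) (f : ℕ → ℝ) : 0 ≤ nrm s f := Real.sqrt_nonneg _

theorem nrm_sq (s : Finset ℕ) (f : ℕ → ℝ) : nrm s f ^ 2 = ∑ i ∈ s, f i ^ 2 :=
  Real.sq_sqrt (Finset.sum_nonneg fun _ _ => sq_nonneg _)

theorem nrm_le_of_sq_le {s : Finset ℕ} {f : ℕ → ℝ} {c : ℝ} (hc : 0 ≤ c)
    (h : ∑ i ∈ s, f i ^ 2 ≤ c ^ 2) : nrm s f ≤ c := Real.sqrt_le_iff.mpr ⟨hc, h⟩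

theorem nrm_mono {s t : Finset ℕ} (h : s ⊆ t) (f : ℕ → ℝ) : nrm s f ≤ nrm t f :=
  Real.sqrt_le_sqrt (Finset.sum_le_sum_of_subset_of_nonneg h fun _ _ _ => sq_nonneg _)

theorem nrm_congr {s : Finset ℕ} {f g : ℕ → ℝ} (h : ∀ i ∈ s, f i = g i) : nrm s f = nrm s g := by
  unfold nrm
  rw [Finset.sum_congr rfl fun i hi => by rw [h i hi]]

theorem sum_mul_le_nrm (s : Finset ℕ) (f g : ℕ → ℝ) :
    ∑ i ∈ s, f i * g i ≤ nrm s f * nrm s g := Real.sum_mul_le_sqrt_mul_sqrt s f g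

theorem nrm_add_le (s : Finset ℕ) (f g : ℕ → ℝ) :
    nrm s (fun i => f i + g i) ≤ nrm s f + nrm s g := by
  refine nrm_le_of_sq_le (add_nonneg (nrm_nonneg _ _) (nrm_nonneg _ _)) ?_
  have h := sum_mul_le_nrm s f g
  have e : ∑ i ∈ s, (f i + g i) ^ 2 =
      ∑ i ∈ s, f i ^ 2 + 2 * ∑ i ∈ s, f i * g i + ∑ i ∈ s, g i ^ 2 := by
    rw [Finset.mul_sum, ← Finset.sum_add_distrib, ← Finset.sum_add_distrib]
    exact Finset.sum_congr rfl fun i _ => by ring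
  rw [e, ← nrm_sq, ← nrm_sq]
  nlinarith

theorem nrm_neg (s : Finset ℕ) (f : ℕ → ℝ) : nrm s (fun i => -f i) = nrm s f := by
  simp [nrm]

theorem nrm_sub_le (s : Finset ℕ) (f g : ℕ → ℝ) :
    nrm s (fun i => f i - g i) ≤ nrm s f + nrm s g := by
  rw [← nrm_neg s g]
  simpa [sub_eq_add_neg] using nrm_add_le s f fun i => -g i

theorem eq_zero_of_nrm_eq_zero {s : Finset ℕ} {f : ℕ → ℝ} (h : nrm s f = 0) :
    ∀ i ∈ s, f i = 0 := by
  intro i hi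
  have h1 := nrm_sq s f
  rw [h, zero_pow two_ne_zero, eq_comm,
    Finset.sum_eq_zero_iff_of_nonneg fun _ _ => sq_nonneg _] at h1
  exact pow_eq_zero_iff two_ne_zero |>.mp (h1 i hi)

theorem sum_abs_le_nrm {s : Finset ℕ} (f : ℕ → ℝ) {k : ℝ} (hk : (s.card : ℝ) ≤ k) :
    ∑ i ∈ s, |f i| ≤ √k * nrm s f := by
  have h := sq_sum_le_card_mul_sum_sq (s := s) (f := fun i => |f i|)
  have hk0 : 0 ≤ k := (Nat.cast_nonneg _).trans hk
  simp only [sq_abs] at h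
  refine le_of_sq_le_sq ?_ (mul_nonneg (Real.sqrt_nonneg _) (nrm_nonneg _ _))
  rw [mul_pow, Real.sq_sqrt hk0, nrm_sq]
  exact h.trans (mul_le_mul_of_nonneg_right hk (Finset.sum_nonneg fun _ _ => sq_nonneg _))

/-- The matrix `a` applied to `x`. -/
noncomputable def app (n : ℕ) (a : ℕ → ℕ → ℝ) (x : ℕ → ℝ) (i : ℕ) : ℝ :=
  ∑ j ∈ Finset.range n, a i j * x j

theorem app_add (n : ℕ) (a : ℕ → ℕ → ℝ) (x z : ℕ → ℝ) (r s : ℝ) (i : ℕ) :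
    app n a (fun j => r * x j + s * z j) i = r * app n a x i + s * app n a z i := by
  unfold app
  rw [Finset.mul_sum, Finset.mul_sum, ← Finset.sum_add_distrib]
  exact Finset.sum_congr rfl fun j _ => by ring

theorem app_sub (n : ℕ) (a : ℕ → ℕ → ℝ) (x z : ℕ → ℝ) (i : ℕ) :
    app n a (fun j => x j - z j) i = app n a x i - app n a z i := by
  unfold app
  rw [← Finset.sum_sub_distrib]
  exact Finset.sum_congr rfl fun j _ => by ring

section RIP

variable {b n n' N m : ℕ} {a : ℕ → ℕ → ℝ} {W : Finset ℕ}

/-- Rooted subtrees with at most `N` nodes, all of them among the first `n'` ones. -/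
structure SmallTree (b n' N : ℕ) (W : Finset ℕ) : Prop where
  closed : PClosed b W
  lt : ∀ p ∈ W, p < n'
  card_le : W.card ≤ N

theorem TreeRIP.nrm_app_le (hR : TreeRIP b n' N m n a) (hW : SmallTree b n' N W) {x : ℕ → ℝ}
    (hx : ∀ j ∉ W, x j = 0) :
    nrm (Finset.range m) (app n a x) ≤ 17 / 16 * √m * nrm (Finset.range n) x := by
  have h := (abs_le.mp (hR W hW.closed hW.lt hW.card_le x hx)).2
  rw [← nrm_sq (Finset.range n)] at h
  refine nrm_le_of_sq_le (mul_nonneg (by positivity) (nrm_nonneg _ _)) ?_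
  rw [mul_pow, mul_pow, Real.sq_sqrt (Nat.cast_nonneg _)]
  have : 0 ≤ (m : ℝ) * nrm (Finset.range n) x ^ 2 := by positivity
  change ∑ i ∈ Finset.range m, (∑ j ∈ Finset.range n, a i j * x j) ^ 2 ≤ _
  linarith

theorem TreeRIP.nrm_le (hR : TreeRIP b n' N m n a) (hW : SmallTree b n' N W) {x : ℕ → ℝ}
    (hx : ∀ j ∉ W, x j = 0) :
    √m * nrm (Finset.range n) x ≤ 15 / 14 * nrm (Finset.range m) (app n a x) := by
  have h := (abs_le.mp (hR W hW.closed hW.lt hW.card_le x hx)).1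
  rw [← nrm_sq (Finset.range n)] at h
  have h' : nrm (Finset.range m) (app n a x) ^ 2 =
    ∑ i ∈ Finset.range m, (∑ j ∈ Finset.range n, a i j * x j) ^ 2 := nrm_sq _ _
  refine le_of_sq_le_sq ?_ (mul_nonneg (by norm_num) (nrm_nonneg _ _))
  rw [mul_pow, mul_pow, Real.sq_sqrt (Nat.cast_nonneg _), h']
  have : 0 ≤ (m : ℝ) * nrm (Finset.range n) x ^ 2 := by positivity
  linarith

/-- Inner products are approximately preserved. -/
theorem TreeRIP.inner_sub_le (hR : TreeRIP b n' N m n a) (hW : SmallTree b n' N W) {v z : ℕ → ℝ}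
    (hv : ∀ j ∉ W, v j = 0) (hz : ∀ j ∉ W, z j = 0) :
    m * ∑ p ∈ Finset.range n, v p * z p - ∑ i ∈ Finset.range m, app n a v i * app n a z i ≤
      m / 8 * (nrm (Finset.range n) v * nrm (Finset.range n) z) := by
  set V := nrm (Finset.range n) v with hV
  set Z := nrm (Finset.range n) z with hZ
  have hV0 : 0 ≤ V := nrm_nonneg _ _
  have hZ0 : 0 ≤ Z := nrm_nonneg _ _
  have zero : ∀ x : ℕ → ℝ, nrm (Finset.range n) x = 0 → ∀ i, app n a x i = 0 := fun x hx i =>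
    Finset.sum_eq_zero fun j hj => by rw [eq_zero_of_nrm_eq_zero hx j hj, mul_zero]
  rcases hV0.eq_or_lt with h0 | hVpos
  · rw [Finset.sum_eq_zero fun p hp => by rw [eq_zero_of_nrm_eq_zero h0.symm p hp, zero_mul],
      Finset.sum_eq_zero fun i _ => by rw [zero v h0.symm, zero_mul], ← h0]
    simp
  rcases hZ0.eq_or_lt with h0 | hZpos
  · rw [Finset.sum_eq_zero fun p hp => by rw [eq_zero_of_nrm_eq_zero h0.symm p hp, mul_zero],
      Finset.sum_eq_zero fun i _ => by rw [zero z h0.symm, mul_zero], ← h0]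
    simp
  have key : ∀ s : ℝ, |∑ i ∈ Finset.range m, (Z * app n a v i + s * app n a z i) ^ 2 -
      m * ∑ p ∈ Finset.range n, (Z * v p + s * z p) ^ 2| ≤
      m / 8 * ∑ p ∈ Finset.range n, (Z * v p + s * z p) ^ 2 := by
    intro s
    have h := hR W hW.closed hW.lt hW.card_le (fun j => Z * v j + s * z j)
      fun j hj => by rw [hv j hj, hz j hj]; ring
    have e : ∀ i, ∑ j ∈ Finset.range n, a i j * (Z * v j + s * z j) =
        Z * app n a v i + s * app n a z i := app_add n a v z Z s
    simp only [e] at h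
    exact h
  have exp : ∀ (t : Finset ℕ) (f g : ℕ → ℝ) (s : ℝ), ∑ p ∈ t, (Z * f p + s * g p) ^ 2 =
      Z ^ 2 * ∑ p ∈ t, f p ^ 2 + 2 * Z * s * ∑ p ∈ t, f p * g p + s ^ 2 * ∑ p ∈ t, g p ^ 2 := by
    intro t f g s
    simp only [Finset.mul_sum, ← Finset.sum_add_distrib]
    exact Finset.sum_congr rfl fun p _ => by ring
  have k1 := (abs_le.mp (key V)).1
  have k2 := (abs_le.mp (key (-V))).2
  simp only [exp] at k1 k2
  rw [← nrm_sq (Finset.range n), ← nrm_sq (Finset.range n), ← hV, ← hZ] at k1 k2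
  have hVZ : 0 < V * Z := mul_pos hVpos hZpos
  refine le_of_mul_le_mul_left ?_ hVZ
  nlinarith

/-- The gradient step nearly inverts the matrix on subtrees. -/
theorem TreeRIP.nrm_gradStep_sub_le (hR : TreeRIP b n' N m n a) (hn : n' ≤ n) (hm : 0 < m)
    (hW : SmallTree b n' N W) {x xb y eta : ℕ → ℝ} (hx : ∀ j ∉ W, x j = 0)
    (hxb : ∀ j ∉ W, xb j = 0) (hy : ∀ i < m, y i = app n a xb i + eta i) :
    √m * nrm W (fun p => gradStep n m a y x p - xb p) ≤
      √m / 8 * nrm (Finset.range n) (fun p => x p - xb p) +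
        17 / 16 * nrm (Finset.range m) eta := by
  classical
  set v : ℕ → ℝ := fun p => x p - xb p with hv
  set z : ℕ → ℝ := fun p => if p ∈ W then gradStep n m a y x p - xb p else 0 with hz
  have hvW : ∀ j ∉ W, v j = 0 := fun j hj => by rw [hv]; simp only [hx j hj, hxb j hj, sub_zero]
  have hzW : ∀ j ∉ W, z j = 0 := fun j hj => by simp only [hz, if_neg hj]
  have hWn : W ⊆ Finset.range n := fun p hp =>
    Finset.mem_range.mpr (lt_of_lt_of_le (hW.lt p hp) hn)
  have hm' : (0 : ℝ) < m := by exact_mod_cast hm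
  have hzn : nrm (Finset.range n) z = nrm W (fun p => gradStep n m a y x p - xb p) := by
    have h1 : nrm (Finset.range n) z = nrm W z := by
      unfold nrm
      rw [Finset.sum_subset hWn fun p _ hp => by rw [hzW p hp]; ring]
    rw [h1]
    exact nrm_congr fun p hp => by simp only [hz, if_pos hp]
  have hr : ∀ i < m, resid n a y x i = eta i - app n a v i := by
    intro i hi
    rw [hv, app_sub, resid, hy i hi, app, app]
    ring
  have hsq : nrm (Finset.range n) z ^ 2 = ∑ p ∈ Finset.range n, v p * z p +
      (∑ i ∈ Finset.range m, (eta i - app n a v i) * app n a z i) / m := by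
    have e1 : nrm (Finset.range n) z ^ 2 =
        ∑ p ∈ Finset.range n, (gradStep n m a y x p - xb p) * z p := by
      rw [nrm_sq]
      refine Finset.sum_congr rfl fun p _ => ?_
      by_cases hp : p ∈ W
      · simp only [hz, if_pos hp, sq]
      · rw [hzW p hp]; ring
    have e2 : ∑ i ∈ Finset.range m, (eta i - app n a v i) * app n a z i =
        ∑ p ∈ Finset.range n, (∑ i ∈ Finset.range m, a i p * resid n a y x i) * z p := by
      simp only [app, Finset.mul_sum, Finset.sum_mul]
      rw [Finset.sum_comm]
      refine Finset.sum_congr rfl fun p _ => Finset.sum_congr rfl fun i hi => ?_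
      rw [hr i (Finset.mem_range.mp hi)]
      simp only [app]
      ring
    rw [e1, e2, Finset.sum_div, ← Finset.sum_add_distrib]
    refine Finset.sum_congr rfl fun p _ => ?_
    rw [gradStep, hv]
    ring
  have h1 := hR.inner_sub_le hW hvW hzW
  have h2 := (sum_mul_le_nrm (Finset.range m) eta (app n a z)).trans
    (mul_le_mul_of_nonneg_left (hR.nrm_app_le hW hzW) (nrm_nonneg _ _))
  rw [← hzn]
  set Z := nrm (Finset.range n) z with hZ
  have hZ0 : 0 ≤ Z := nrm_nonneg _ _
  have hs0 : 0 < √(m : ℝ) := Real.sqrt_pos.mpr hm'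
  have hs2 : √(m : ℝ) ^ 2 = m := Real.sq_sqrt hm'.le
  rcases hZ0.eq_or_lt with h0 | hZpos
  · rw [← h0, mul_zero]
    have := nrm_nonneg (Finset.range n) v
    have := nrm_nonneg (Finset.range m) eta
    positivity
  have hsq' : m * Z ^ 2 = m * ∑ p ∈ Finset.range n, v p * z p -
      ∑ i ∈ Finset.range m, app n a v i * app n a z i +
        ∑ i ∈ Finset.range m, eta i * app n a z i := by
    rw [hsq, mul_add, mul_div_cancel₀ _ hm'.ne']
    simp only [sub_mul, Finset.sum_sub_distrib]
    ring
  have hmul : (√m * Z) * (√m * Z) ≤ (√m / 8 * nrm (Finset.range n) v +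
      17 / 16 * nrm (Finset.range m) eta) * (√m * Z) := by
    have e : (√m * Z) * (√m * Z) = m * Z ^ 2 := by linear_combination Z ^ 2 * hs2
    rw [e, hsq']
    have e3 : (√m / 8 * nrm (Finset.range n) v + 17 / 16 * nrm (Finset.range m) eta) * (√m * Z) =
        m / 8 * (nrm (Finset.range n) v * Z) +
          nrm (Finset.range m) eta * (17 / 16 * √m * Z) := by
      linear_combination nrm (Finset.range n) v * Z / 8 * hs2
    rw [e3]
    exact add_le_add h1 h2
  exact le_of_mul_le_mul_right hmul (mul_pos hs0 hZpos)

end RIP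

/-- A tree `S₀` with at most `K` nodes that is reached from each of the first `n'` nodes in at most
`L` steps towards the root. -/
structure Skeleton (b n' K L : ℕ) (S₀ : Finset ℕ) : Prop where
  closed : PClosed b S₀
  lt : ∀ p ∈ S₀, p < n'
  card_le : S₀.card ≤ K
  reach : ∀ v < n', (par b)^[L] v ∈ S₀

/-- Admissible supports of candidates. -/
def Adm (b n' : ℕ) (U : Finset ℕ) : Prop := PClosed b U ∧ ∀ p ∈ U, p < n'

section Trees

variable {b n' K L : ℕ} {S₀ : Finset ℕ}

theorem path_lt {v : ℕ} (hv : v < n') : ∀ p ∈ path b L v, p < n' := by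
  intro p hp
  obtain ⟨k, _, rfl⟩ := Finset.mem_image.mp hp
  have := iterate_par_le b v k
  omega

/-- Joining nodes to a tree that contains the skeleton. -/
theorem Skeleton.pClosed_union_paths (h : Skeleton b n' K L S₀) {S T : Finset ℕ} (hS : PClosed b S)
    (h₀ : S₀ ⊆ S) (hT : ∀ p ∈ T, p < n') : PClosed b (S ∪ T.biUnion (path b L)) := by
  intro j hj
  rcases Finset.mem_union.mp hj with hj | hj
  · exact Finset.mem_union_left _ (hS j hj)
  · obtain ⟨v, hv, hjv⟩ := Finset.mem_biUnion.mp hj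
    obtain ⟨k, hk, rfl⟩ := Finset.mem_image.mp hjv
    have hk := Finset.mem_range.mp hk
    rw [← Function.iterate_succ_apply' (par b) k v]
    rcases Nat.lt_or_ge (k + 1) L with hlt | hge
    · exact Finset.mem_union_right _ (Finset.mem_biUnion.mpr
        ⟨v, hv, Finset.mem_image.mpr ⟨k + 1, Finset.mem_range.mpr hlt, rfl⟩⟩)
    · rw [show k.succ = L by omega]
      exact Finset.mem_union_left _ (h₀ (h.reach v (hT v hv)))

theorem Skeleton.mem_union_paths (h : Skeleton b n' K L S₀) {S T : Finset ℕ}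
    (h₀ : S₀ ⊆ S) (hT : ∀ p ∈ T, p < n') : T ⊆ S ∪ T.biUnion (path b L) := by
  intro v hv
  rcases Nat.eq_zero_or_pos L with rfl | hL
  · exact Finset.mem_union_left _ (h₀ (h.reach v (hT v hv)))
  · exact Finset.mem_union_right _ (Finset.mem_biUnion.mpr
      ⟨v, hv, Finset.mem_image.mpr ⟨0, Finset.mem_range.mpr hL, rfl⟩⟩)

theorem biUnion_path_lt {T : Finset ℕ} (hT : ∀ p ∈ T, p < n') :
    ∀ p ∈ T.biUnion (path b L), p < n' := by
  intro p hp
  obtain ⟨v, hv, hpv⟩ := Finset.mem_biUnion.mp hp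
  exact path_lt (hT v hv) p hpv

theorem card_biUnion_path_le (T : Finset ℕ) : (T.biUnion (path b L)).card ≤ T.card * L :=
  Finset.card_biUnion_le_card_mul _ _ _ fun v _ => card_path_le b L v

end Trees

section Iteration

variable {b n n' K L m : ℕ} {a : ℕ → ℕ → ℝ} {y : ℕ → ℝ} {S₀ : Finset ℕ}

/-- Nodes at which the candidate and the matrix vanish are never selected. -/
theorem adm_step (hb : 0 < b) (ha : ∀ i j, n' ≤ j → a i j = 0) {lam : ℝ} (hlam : 0 < lam)
    {x x' : ℕ → ℝ} {U U' : Finset ℕ} (hU : Adm b n' U) (hx : ∀ p < n, p ∉ U → x p = 0)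
    (hstep : Step b n m a y lam x x' U') : Adm b n' U' := by
  obtain ⟨w, hw, hsel, _⟩ := hstep
  refine ⟨selected_pClosed hb hsel, fun p hp => ?_⟩
  by_contra hlt
  have h := penalty_le_of_subset hb hw hsel (R := U'.filter fun p => n' ≤ p)
    (Finset.filter_subset _ _) (by
      intro j hj hj0 hpar
      have h1 := (Finset.mem_filter.mp hpar).2
      have := par_lt (b := b) hj0
      exact Finset.mem_filter.mpr ⟨hj, by omega⟩)
  have h0 : ∑ p ∈ U'.filter (fun p => n' ≤ p), gradStep n m a y x p ^ 2 = 0 := by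
    refine Finset.sum_eq_zero fun q hq => ?_
    obtain ⟨hqU, hqn⟩ := Finset.mem_filter.mp hq
    have hxq : x q = 0 := hx q (hsel.lt q hqU) fun hq' => by
      have := hU.2 q hq'
      omega
    simp [gradStep, hxq, ha _ q hqn]
  rw [h0] at h
  have hpos : 0 < (U'.filter fun p => n' ≤ p).card :=
    Finset.card_pos.mpr ⟨p, Finset.mem_filter.mpr ⟨hp, by omega⟩⟩
  have : 0 < lam * ((U'.filter fun p => n' ≤ p).card : ℝ) :=
    mul_pos hlam (by exact_mod_cast hpos)
  linarith

/-- The iteration goes on as long as the penalty dominates the noise. In units of `√(K * lam)`,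
the candidate has error at most `22 / 5`, the gradient step on small trees at most `2 / 3`, and
the next candidate at most `5 / 2`, which leaves a residual of at most `14 / 5 < √8` after
division by `√m`. -/
theorem pass_next (hR : TreeRIP b n' ((8 + b) * K) m n a) (hn : n' ≤ n) (hm : 0 < m) (hb : 0 < b)
    (hK : 1 ≤ K) (hLK : L ≤ K) (hS₀ : Skeleton b n' K L S₀)
    (ha : ∀ i j, n' ≤ j → a i j = 0)
    {Sb : Finset ℕ} (hSb : SmallTree b n' (3 * K) Sb) (hsub : S₀ ⊆ Sb) {xb eta : ℕ → ℝ}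
    (hxb : ∀ j ∉ Sb, xb j = 0) (hy : ∀ i < m, y i = app n a xb i + eta i)
    {lam : ℝ} (hlam : 0 < lam) {x x' : ℕ → ℝ} {U U' : Finset ℕ} (hU : Adm b n' U)
    (hx : ∀ p ∉ U, x p = 0) (hpass : Pass n m K a y lam x U)
    (hstep : Step b n m a y lam x x' U')
    (heta : nrm (Finset.range m) eta ≤ √m * √(K * lam) / 10) :
    Pass n m K a y (lam / 2) x' U' := by
  classical
  have hU' := adm_step hb ha hlam hU (fun p _ hp => hx p hp) hstep
  obtain ⟨w, hw, hsel, hx'⟩ := hstep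
  obtain ⟨hUcard, hres⟩ := hpass
  set u := gradStep n m a y x with hu
  set s := √(K * lam) with hs
  have hm' : (0 : ℝ) < m := by exact_mod_cast hm
  have hK' : (1 : ℝ) ≤ K := by exact_mod_cast hK
  have hKlam : 0 < K * lam := by positivity
  have hs0 : 0 < s := Real.sqrt_pos.mpr hKlam
  have hs2 : s ^ 2 = K * lam := Real.sq_sqrt hKlam.le
  have hsm0 : 0 < √(m : ℝ) := Real.sqrt_pos.mpr hm'
  have hsm2 : √(m : ℝ) ^ 2 = m := Real.sq_sqrt hm'.le
  have hbK : 1 * K ≤ b * K := Nat.mul_le_mul_right _ hb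
  have hN : (8 + b) * K = 8 * K + b * K := by ring
  have hresn : nrm (Finset.range m) (resid n a y x) ≤ 4 * (√m * s) := by
    refine nrm_le_of_sq_le (by positivity) (hres.trans (le_of_eq ?_))
    rw [mul_pow, mul_pow, hsm2, hs2]; ring
  -- the error of the candidate
  have hSU : SmallTree b n' ((8 + b) * K) (Sb ∪ U) := by
    refine ⟨hSb.closed.union hU.1, fun p hp => ?_, ?_⟩
    · rcases Finset.mem_union.mp hp with hp | hp
      · exact hSb.lt p hp
      · exact hU.2 p hp
    · have := Finset.card_union_le Sb U
      have := hSb.card_le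
      omega
  have hv : nrm (Finset.range n) (fun p => x p - xb p) ≤ 22 / 5 * s := by
    have h1 := hR.nrm_le hSU (x := fun p => x p - xb p) fun j hj => by
      rw [Finset.mem_union, not_or] at hj
      rw [hx j hj.2, hxb j hj.1, sub_zero]
    have h2 : nrm (Finset.range m) (app n a fun p => x p - xb p) ≤
        nrm (Finset.range m) eta + nrm (Finset.range m) (resid n a y x) := by
      refine le_of_eq_of_le (nrm_congr fun i hi => ?_) (nrm_sub_le _ _ _)
      rw [app_sub, resid, hy i (Finset.mem_range.mp hi), app, app]
      ring
    have h3 : √m * nrm (Finset.range n) (fun p => x p - xb p) ≤ √m * (22 / 5 * s) := by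
      have : 0 < √m * s := by positivity
      linarith
    exact le_of_mul_le_mul_left h3 hsm0
  -- the error of the gradient step on trees
  have hrho : ∀ W, SmallTree b n' ((8 + b) * K) W → Sb ∪ U ⊆ W →
      nrm W (fun p => u p - xb p) ≤ 2 / 3 * s := by
    intro W hW hSW
    have h1 := hR.nrm_gradStep_sub_le hn hm hW (x := x) (xb := xb) (y := y) (eta := eta)
      (fun j hj => hx j fun h => hj (hSW (Finset.mem_union_right _ h)))
      (fun j hj => hxb j fun h => hj (hSW (Finset.mem_union_left _ h))) hy
    have h2 : √m / 8 * nrm (Finset.range n) (fun p => x p - xb p) ≤ √m / 8 * (22 / 5 * s) :=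
      mul_le_mul_of_nonneg_left hv (by positivity)
    have h3 : √m * nrm W (fun p => u p - xb p) ≤ √m * (2 / 3 * s) := by
      have : 0 < √m * s := by positivity
      linarith
    exact le_of_mul_le_mul_left h3 hsm0
  have hsqs : (2 / 3 * s) ^ 2 = 4 / 9 * (K * lam) := by rw [mul_pow, hs2]; norm_num
  -- few nodes are selected outside of `Sb`
  have hfew : (U' \ Sb).card < K := by
    by_contra hge
    obtain ⟨v, hvU, R, hRsub, hR1, hR2, hRdesc, hRcl⟩ :=
      exists_branch hb hU'.1 hSb.closed hK (not_lt.mp hge)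
    have hvn := hU'.2 v hvU
    have hT : ∀ p ∈ ({v} : Finset ℕ), p < n' := fun p hp => by
      rw [Finset.mem_singleton.mp hp]; exact hvn
    have hcl := hRcl _ (hS₀.pClosed_union_paths hSb.closed hsub hT)
      (hS₀.mem_union_paths hsub hT (Finset.mem_singleton_self v))
    have hW : SmallTree b n' ((8 + b) * K)
        (Sb ∪ ({v} : Finset ℕ).biUnion (path b L) ∪ R ∪ U) := by
      refine ⟨hcl.union hU.1, fun p hp => ?_, ?_⟩
      · simp only [Finset.mem_union] at hp
        rcases hp with ((hp | hp) | hp) | hp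
        · exact hSb.lt p hp
        · exact biUnion_path_lt hT p hp
        · exact hU'.2 p (Finset.mem_sdiff.mp (hRsub hp)).1
        · exact hU.2 p hp
      · have h1 := Finset.card_union_le (Sb ∪ ({v} : Finset ℕ).biUnion (path b L) ∪ R) U
        have h2 := Finset.card_union_le (Sb ∪ ({v} : Finset ℕ).biUnion (path b L)) R
        have h3 := Finset.card_union_le Sb (({v} : Finset ℕ).biUnion (path b L))
        have h4 := card_biUnion_path_le (b := b) (L := L) {v}
        have h5 := hSb.card_le
        rw [Finset.card_singleton, one_mul] at h4
        omega
    have h1 := hrho _ hW fun p hp => by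
      simp only [Finset.mem_union] at hp ⊢
      tauto
    have h2 := (nrm_mono (s := R) (by
      intro p hp
      simp only [Finset.mem_union]
      tauto) (fun p => u p - xb p)).trans h1
    have h3 : ∑ p ∈ R, u p ^ 2 ≤ 4 / 9 * (K * lam) := by
      rw [← hsqs]
      refine le_trans (le_of_eq ?_) (pow_le_pow_left₀ (nrm_nonneg _ _) h2 2)
      rw [nrm_sq]
      refine Finset.sum_congr rfl fun p hp => ?_
      rw [hxb p (Finset.mem_sdiff.mp (hRsub hp)).2, sub_zero]
    -- removing `R` saves at least `K * lam`, but costs only `4 / 9 * (K * lam)`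
    have h4 := penalty_le_of_subset hb hw hsel (hRsub.trans Finset.sdiff_subset) hRdesc
    have h5 : lam * (K : ℝ) ≤ lam * (R.card : ℝ) := by
      have : (K : ℝ) ≤ R.card := by exact_mod_cast hR1
      exact mul_le_mul_of_nonneg_left this hlam.le
    nlinarith
  have hcard' : (Sb ∪ U').card ≤ 4 * K := by
    have h1 : Sb ∪ U' = Sb ∪ (U' \ Sb) := Finset.union_sdiff_self_eq_union.symm
    rw [h1]
    have := Finset.card_union_le Sb (U' \ Sb)
    have := hSb.card_le
    omega
  refine ⟨(Finset.card_le_card Finset.subset_union_right).trans hcard', ?_⟩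
  -- the error of the next candidate
  have hW : SmallTree b n' ((8 + b) * K) (Sb ∪ U' ∪ U) := by
    refine ⟨(hSb.closed.union hU'.1).union hU.1, fun p hp => ?_, ?_⟩
    · simp only [Finset.mem_union] at hp
      rcases hp with (hp | hp) | hp
      · exact hSb.lt p hp
      · exact hU'.2 p hp
      · exact hU.2 p hp
    · have := Finset.card_union_le (Sb ∪ U') U
      omega
  have hrW := hrho _ hW fun p hp => by
    simp only [Finset.mem_union] at hp ⊢
    tauto
  have hdrop : nrm (Sb \ U') u ≤ 26 / 15 * s := by
    refine nrm_le_of_sq_le (by positivity) ?_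
    have h1 := sum_le_penalty_of_disjoint hb hw hsel (R := Sb \ U') Finset.sdiff_disjoint
      (fun p hp => lt_of_lt_of_le (hSb.lt p (Finset.mem_sdiff.mp hp).1) hn) (by
        rw [Finset.union_sdiff_self_eq_union]
        exact hU'.1.union hSb.closed)
    have h2 : ((Sb \ U').card : ℝ) ≤ 3 * K := by
      exact_mod_cast (Finset.card_le_card Finset.sdiff_subset).trans hSb.card_le
    have h3 := mul_le_mul_of_nonneg_left h2 hlam.le
    rw [mul_pow, hs2]
    linarith
  set x'' : ℕ → ℝ := fun p => if p ∈ U' then u p else 0 with hx''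
  have herr : nrm (Finset.range n) (fun p => x'' p - xb p) ≤ 5 / 2 * s := by
    refine nrm_le_of_sq_le (by positivity) ?_
    have hsplit : ∑ p ∈ Finset.range n, (x'' p - xb p) ^ 2 =
        ∑ p ∈ U', (u p - xb p) ^ 2 + ∑ p ∈ Sb \ U', xb p ^ 2 := by
      have h1 : ∑ p ∈ Finset.range n, (x'' p - xb p) ^ 2 = ∑ p ∈ U' ∪ Sb, (x'' p - xb p) ^ 2 := by
        refine (Finset.sum_subset (fun p hp => ?_) fun p _ hp => ?_).symm
        · rw [Finset.mem_range]
          rcases Finset.mem_union.mp hp with hp | hp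
          · exact lt_of_lt_of_le (hU'.2 p hp) hn
          · exact lt_of_lt_of_le (hSb.lt p hp) hn
        · rw [Finset.mem_union, not_or] at hp
          simp only [hx'', if_neg hp.1, hxb p hp.2]
          ring
      rw [h1, ← Finset.union_sdiff_self_eq_union, Finset.sum_union Finset.disjoint_sdiff]
      congr 1
      · exact Finset.sum_congr rfl fun p hp => by simp only [hx'', if_pos hp]
      · refine Finset.sum_congr rfl fun p hp => ?_
        simp only [hx'', if_neg (Finset.mem_sdiff.mp hp).2]
        ring
    have h1 : nrm U' (fun p => u p - xb p) ≤ 2 / 3 * s := (nrm_mono (by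
      intro p hp
      simp only [Finset.mem_union]
      tauto) _).trans hrW
    have h2 : nrm (Sb \ U') xb ≤ 26 / 15 * s + 2 / 3 * s := by
      have h3 : nrm (Sb \ U') (fun p => u p - xb p) ≤ 2 / 3 * s := (nrm_mono (by
        intro p hp
        simp only [Finset.mem_union]
        have := Finset.mem_sdiff.mp hp
        tauto) _).trans hrW
      have h4 := nrm_sub_le (Sb \ U') u (fun p => u p - xb p)
      rw [nrm_congr (g := xb) fun i _ => by ring] at h4
      linarith
    rw [hsplit, ← nrm_sq, ← nrm_sq]
    have h5 := pow_le_pow_left₀ (nrm_nonneg _ _) h1 2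
    have h6 := pow_le_pow_left₀ (nrm_nonneg _ _) h2 2
    nlinarith
  have hfin : nrm (Finset.range m) (resid n a y x') ≤ 14 / 5 * (√m * s) := by
    have h1 := hR.nrm_app_le hW (x := fun p => x'' p - xb p) fun j hj => by
      simp only [Finset.mem_union, not_or] at hj
      simp only [hx'', if_neg hj.1.2, hxb j hj.1.1, sub_zero]
    have h2 : nrm (Finset.range m) (resid n a y x') ≤
        nrm (Finset.range m) eta + nrm (Finset.range m) (app n a fun p => x'' p - xb p) := by
      refine le_of_eq_of_le (nrm_congr fun i hi => ?_) (nrm_sub_le _ _ _)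
      rw [resid_congr hx', app_sub, resid, hy i (Finset.mem_range.mp hi), app, app]
      ring
    have h3 : 17 / 16 * √m * nrm (Finset.range n) (fun p => x'' p - xb p) ≤
        17 / 16 * √m * (5 / 2 * s) := mul_le_mul_of_nonneg_left herr (by positivity)
    have : 0 < √m * s := by positivity
    linarith
  rw [← nrm_sq]
  have h1 := pow_le_pow_left₀ (nrm_nonneg _ _) hfin 2
  rw [mul_pow, mul_pow, hsm2, hs2] at h1
  have : 0 < (m : ℝ) * (K * lam) := by positivity
  nlinarith

/-- The output of the program fits the sketch as well as any tree-sparse vector does, up to a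
constant factor. -/
theorem nrm_resid_le_of_stopped (hR : TreeRIP b n' ((8 + b) * K) m n a) (hn : n' ≤ n) (hm : 0 < m)
    (hb : 0 < b) (hK : 1 ≤ K) (hLK : L ≤ K) (hS₀ : Skeleton b n' K L S₀)
    (ha : ∀ i j, n' ≤ j → a i j = 0)
    {Sb : Finset ℕ} (hSb : SmallTree b n' (3 * K) Sb) (hsub : S₀ ⊆ Sb) {xb eta : ℕ → ℝ}
    (hxb : ∀ j ∉ Sb, xb j = 0) (hy : ∀ i < m, y i = app n a xb i + eta i) {x : ℕ → ℝ}
    {U : Finset ℕ} (hU : Adm b n' U) (hx : ∀ p ∉ U, x p = 0)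
    (hgood : (∀ i < m, resid n a y x i = 0) ∨ ∃ lam > 0, Pass n m K a y lam x U ∧
        ∃ x' U', Step b n m a y lam x x' U' ∧ ¬ Pass n m K a y (lam / 2) x' U') :
    nrm (Finset.range m) (resid n a y x) ≤ 40 * nrm (Finset.range m) eta := by
  have he := nrm_nonneg (Finset.range m) eta
  rcases hgood with h0 | ⟨lam, hlam, hpass, x', U', hstep, hnot⟩
  · refine nrm_le_of_sq_le (by positivity) ?_
    rw [Finset.sum_eq_zero fun i hi => by rw [h0 i (Finset.mem_range.mp hi)]; ring]
    positivity
  · have hlt : √m * √(K * lam) / 10 < nrm (Finset.range m) eta := by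
      by_contra hle
      exact hnot (pass_next hR hn hm hb hK hLK hS₀ ha hSb hsub hxb hy hlam hU hx hpass hstep
        (not_lt.mp hle))
    have h1 : nrm (Finset.range m) (resid n a y x) ≤ 4 * (√m * √(K * lam)) := by
      refine nrm_le_of_sq_le (by positivity) (hpass.2.trans (le_of_eq ?_))
      rw [mul_pow, mul_pow, Real.sq_sqrt (by positivity), Real.sq_sqrt (by positivity)]
      ring
    linarith

end Iteration

end TreeSparse

/-! ### The `ℓ1` error of the output -/

namespace TreeSparse

open RealRAM

/-- The `k` largest entries of `w` on `P`. -/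
theorem exists_largest (k : ℕ) (P : Finset ℕ) (w : ℕ → ℝ) :
    ∃ T ⊆ P, T.card = min k P.card ∧ ∀ q ∈ P \ T, k * |w q| ≤ ∑ p ∈ T, |w p| := by
  have main : ∃ T ⊆ P, T.card = min k P.card ∧ ∀ p ∈ T, ∀ q ∈ P \ T, |w q| ≤ |w p| := by
    induction k generalizing P with
    | zero => exact ⟨∅, Finset.empty_subset _, by simp, by simp⟩
    | succ k ih =>
      rcases P.eq_empty_or_nonempty with rfl | hne
      · exact ⟨∅, Finset.empty_subset _, by simp, by simp⟩
      obtain ⟨p₀, hp₀, hmax⟩ := P.exists_max_image (fun p => |w p|) hne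
      obtain ⟨T, hT, hcard, hTw⟩ := ih (P.erase p₀)
      have hp₀T : p₀ ∉ T := fun h => Finset.notMem_erase p₀ P (hT h)
      have hPpos := Finset.card_pos.mpr hne
      refine ⟨insert p₀ T, Finset.insert_subset hp₀ (hT.trans (Finset.erase_subset _ _)), ?_, ?_⟩
      · rw [Finset.card_insert_of_notMem hp₀T, hcard, Finset.card_erase_of_mem hp₀]
        omega
      · intro p hp q hq
        rw [Finset.mem_sdiff, Finset.mem_insert, not_or] at hq
        rcases Finset.mem_insert.mp hp with rfl | hp
        · exact hmax q hq.1
        · exact hTw p hp q (Finset.mem_sdiff.mpr ⟨Finset.mem_erase.mpr ⟨hq.2.1, hq.1⟩, hq.2.2⟩)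
  obtain ⟨T, hT, hcard, hTw⟩ := main
  refine ⟨T, hT, hcard, fun q hq => ?_⟩
  have hlt : T.card < P.card := Finset.card_lt_card (Finset.ssubset_iff_subset_ne.mpr
    ⟨hT, fun h => by simp [h] at hq⟩)
  have hk : T.card = k := by omega
  rw [← hk, ← nsmul_eq_mul]
  exact Finset.card_nsmul_le_sum _ _ _ fun p hp => hTw p hp q hq

/-- The image of a vector without large entries: the vector is cut into blocks of `k` entries of
decreasing size, and the Euclidean norm of each block is bounded by the `ℓ1` norm of the one
before. -/
theorem TreeRIP.nrm_app_le_of_abs_le {b n n' N m k : ℕ} {a : ℕ → ℕ → ℝ} (hR : TreeRIP b n' N m n a)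
    (hn : n' ≤ n) (hk : 1 ≤ k)
    (hsmall : ∀ T : Finset ℕ, (∀ p ∈ T, p < n') → T.card ≤ k → ∃ W, SmallTree b n' N W ∧ T ⊆ W)
    (c : ℕ) (P : Finset ℕ) (hc : P.card ≤ c) (hP : ∀ p ∈ P, p < n') (w : ℕ → ℝ)
    (hw : ∀ j ∉ P, w j = 0) (θ : ℝ) (hθ0 : 0 ≤ θ) (hθ : ∀ p ∈ P, |w p| ≤ θ) :
    √k * nrm (Finset.range m) (app n a w) ≤ 17 / 16 * √m * (k * θ + ∑ p ∈ P, |w p|) := by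
  induction c generalizing P w θ with
  | zero =>
    have hP0 : P = ∅ := Finset.card_eq_zero.mp (by omega)
    have h0 : ∀ i, app n a w i = 0 := fun i => Finset.sum_eq_zero fun j _ => by
      rw [hw j (by simp [hP0]), mul_zero]
    have : nrm (Finset.range m) (app n a w) = 0 := by simp [nrm, h0]
    rw [this, mul_zero, hP0, Finset.sum_empty]
    positivity
  | succ c ih =>
    have hk' : (0 : ℝ) < k := by exact_mod_cast hk
    have hsk : √(k : ℝ) * √k = k := Real.mul_self_sqrt hk'.le
    obtain ⟨T, hT, hTc, hTw⟩ := exists_largest k P w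
    obtain ⟨W, hW, hTW⟩ := hsmall T (fun p hp => hP p (hT hp)) (by omega)
    set w₁ : ℕ → ℝ := fun p => if p ∈ T then w p else 0 with hw₁
    set w₂ : ℕ → ℝ := fun p => if p ∈ T then 0 else w p with hw₂
    have h1 : √k * nrm (Finset.range m) (app n a w₁) ≤ 17 / 16 * √m * (k * θ) := by
      have h := hR.nrm_app_le hW (x := w₁) fun j hj => by
        simp only [hw₁]
        rw [if_neg fun h => hj (hTW h)]
      have h' : nrm (Finset.range n) w₁ ≤ √k * θ := by
        refine nrm_le_of_sq_le (by positivity) ?_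
        rw [mul_pow, sq √(k : ℝ), hsk]
        calc ∑ p ∈ Finset.range n, w₁ p ^ 2 = ∑ p ∈ T, w₁ p ^ 2 := by
              refine (Finset.sum_subset (fun p hp => Finset.mem_range.mpr
                (lt_of_lt_of_le (hP p (hT hp)) hn)) fun p _ hp => ?_).symm
              simp only [hw₁, if_neg hp]
              ring
          _ ≤ T.card • θ ^ 2 := Finset.sum_le_card_nsmul _ _ _ fun p hp => by
              simp only [hw₁, if_pos hp]
              rw [← sq_abs]
              exact pow_le_pow_left₀ (abs_nonneg _) (hθ p (hT hp)) 2
          _ ≤ k * θ ^ 2 := by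
              rw [nsmul_eq_mul]
              have : (T.card : ℝ) ≤ k := by exact_mod_cast (by omega : T.card ≤ k)
              gcongr
      calc √k * nrm (Finset.range m) (app n a w₁) ≤ √k * (17 / 16 * √m * (√k * θ)) :=
            mul_le_mul_of_nonneg_left (h.trans (mul_le_mul_of_nonneg_left h' (by positivity)))
              (Real.sqrt_nonneg _)
        _ = 17 / 16 * √m * ((√k * √k) * θ) := by ring
        _ = _ := by rw [hsk]
    have hsum0 : 0 ≤ ∑ p ∈ T, |w p| := Finset.sum_nonneg fun _ _ => abs_nonneg _
    have h2 : √k * nrm (Finset.range m) (app n a w₂) ≤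
        17 / 16 * √m * (∑ p ∈ T, |w p| + ∑ p ∈ P \ T, |w p|) := by
      have hcard : (P \ T).card ≤ c := by
        rw [Finset.card_sdiff_of_subset hT]
        omega
      have h := ih (P \ T) hcard (fun p hp => hP p (Finset.mem_sdiff.mp hp).1) w₂ (fun j hj => by
        simp only [hw₂]
        split_ifs with hjT
        · rfl
        · exact hw j fun hjP => hj (Finset.mem_sdiff.mpr ⟨hjP, hjT⟩))
        ((∑ p ∈ T, |w p|) / k) (by positivity) (fun p hp => by
          simp only [hw₂, if_neg (Finset.mem_sdiff.mp hp).2]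
          rw [le_div_iff₀ hk']
          linarith [hTw p hp])
      rw [mul_div_cancel₀ _ hk'.ne'] at h
      refine h.trans (le_of_eq ?_)
      congr 2
      exact Finset.sum_congr rfl fun p hp => by simp only [hw₂, if_neg (Finset.mem_sdiff.mp hp).2]
    have h3 : nrm (Finset.range m) (app n a w) ≤
        nrm (Finset.range m) (app n a w₁) + nrm (Finset.range m) (app n a w₂) := by
      refine le_of_eq_of_le (nrm_congr fun i _ => ?_) (nrm_add_le _ _ _)
      simp only [app, ← Finset.sum_add_distrib]
      refine Finset.sum_congr rfl fun j _ => ?_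
      by_cases hj : j ∈ T <;> simp [hw₁, hw₂, hj]
    have h4 := mul_le_mul_of_nonneg_left h3 (Real.sqrt_nonneg (k : ℝ))
    have h5 : ∑ p ∈ T, |w p| + ∑ p ∈ P \ T, |w p| = ∑ p ∈ P, |w p| := by
      rw [add_comm]
      exact Finset.sum_sdiff hT
    rw [h5] at h2
    linarith

theorem gradStep_congr {n m : ℕ} {a : ℕ → ℕ → ℝ} {y x x' : ℕ → ℝ} (h : ∀ p < n, x p = x' p) :
    ∀ p < n, gradStep n m a y x p = gradStep n m a y x' p := by
  intro p hp
  rw [gradStep, gradStep, h p hp, resid_congr h]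

theorem step_congr {b n m : ℕ} {a : ℕ → ℕ → ℝ} {y x x' x₁ : ℕ → ℝ} {lam : ℝ} {U : Finset ℕ}
    (h : ∀ p < n, x p = x' p) (hs : Step b n m a y lam x x₁ U) : Step b n m a y lam x' x₁ U := by
  obtain ⟨w, hw, hsel, hx₁⟩ := hs
  refine ⟨w, fun p hp => ?_, hsel, fun p hp => ?_⟩
  · rw [hw p hp, gradStep_congr h p hp]
  · rw [hx₁ p hp, gradStep_congr h p hp]

/-- The recovery guarantee, relative to a subtree `S`. -/
theorem sum_abs_sub_le {b n n' K L k m : ℕ} {a : ℕ → ℕ → ℝ} {y : ℕ → ℝ} {S₀ S : Finset ℕ}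
    (hR : TreeRIP b n' ((8 + b) * K) m n a) (hn : n' ≤ n) (hm : 0 < m) (hb : 0 < b)
    (hK : 1 ≤ K) (hL : 1 ≤ L) (hk : 1 ≤ k) (hkL : k * L ≤ K) (hKk : K ≤ 2 * (k * L))
    (hS₀ : Skeleton b n' K L S₀) (ha : ∀ i j, n' ≤ j → a i j = 0) (hS : SmallTree b n' K S)
    {x z : ℕ → ℝ} (hy : ∀ i < m, y i = app n a x i) (hz : Good b n m K a y (Adm b n') z) :
    ∑ p ∈ Finset.range n, |x p - z p| ≤ 189 * √L * ∑ p ∈ Finset.range n \ S, |x p| := by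
  classical
  obtain ⟨U, hU, hUcard, hzU, hgood⟩ := hz
  have hLK : L ≤ K := le_trans (by nlinarith) hkL
  have hbK : 1 * K ≤ b * K := Nat.mul_le_mul_right _ hb
  have hN : (8 + b) * K = 8 * K + b * K := by ring
  have hk' : (0 : ℝ) < k := by exact_mod_cast hk
  have hm' : (0 : ℝ) < m := by exact_mod_cast hm
  have hL' : (1 : ℝ) ≤ L := by exact_mod_cast hL
  have hsk0 : 0 < √(k : ℝ) := Real.sqrt_pos.mpr hk'
  have hsm0 : 0 < √(m : ℝ) := Real.sqrt_pos.mpr hm'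
  -- the tree `Sb` consists of `S`, of the skeleton, and of the paths to the `k` largest entries
  obtain ⟨T, hT, hTc, hTw⟩ := exists_largest k (Finset.range n' \ S) x
  have hTn : ∀ p ∈ T, p < n' := fun p hp =>
    Finset.mem_range.mp (Finset.mem_sdiff.mp (hT hp)).1
  set Sb := S ∪ S₀ ∪ T.biUnion (path b L) with hSb
  have hSbt : SmallTree b n' (3 * K) Sb := by
    refine ⟨hS₀.pClosed_union_paths (hS.closed.union hS₀.closed) Finset.subset_union_right hTn,
      fun p hp => ?_, ?_⟩
    · rcases Finset.mem_union.mp hp with hp | hp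
      · rcases Finset.mem_union.mp hp with hp | hp
        · exact hS.lt p hp
        · exact hS₀.lt p hp
      · exact biUnion_path_lt hTn p hp
    · have h1 := Finset.card_union_le (S ∪ S₀) (T.biUnion (path b L))
      have h2 := Finset.card_union_le S S₀
      have h3 := card_biUnion_path_le (b := b) (L := L) T
      have h4 : T.card * L ≤ k * L := Nat.mul_le_mul_right _ (by omega)
      have h5 := hS.card_le
      have h6 := hS₀.card_le
      rw [← hSb] at h1
      omega
  have hsub : S₀ ⊆ Sb := fun p hp =>
    Finset.mem_union_left _ (Finset.mem_union_right _ hp)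
  have hSsub : S ⊆ Sb := fun p hp => Finset.mem_union_left _ (Finset.mem_union_left _ hp)
  have hTsub : T ⊆ Sb :=
    hS₀.mem_union_paths (S := S ∪ S₀) Finset.subset_union_right hTn
  have hsmall : ∀ T : Finset ℕ, (∀ p ∈ T, p < n') → T.card ≤ k →
      ∃ W, SmallTree b n' ((8 + b) * K) W ∧ T ⊆ W := by
    intro T hT hTc
    refine ⟨S₀ ∪ T.biUnion (path b L), ⟨hS₀.pClosed_union_paths hS₀.closed subset_rfl hT,
      fun p hp => ?_, ?_⟩, hS₀.mem_union_paths subset_rfl hT⟩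
    · rcases Finset.mem_union.mp hp with hp | hp
      · exact hS₀.lt p hp
      · exact biUnion_path_lt hT p hp
    · have h1 := Finset.card_union_le S₀ (T.biUnion (path b L))
      have h3 := card_biUnion_path_le (b := b) (L := L) T
      have h4 : T.card * L ≤ k * L := Nat.mul_le_mul_right _ hTc
      have h6 := hS₀.card_le
      omega
  set xb : ℕ → ℝ := fun p => if p ∈ Sb then x p else 0 with hxb
  set w : ℕ → ℝ := fun p => if p ∈ Finset.range n' \ Sb then x p else 0 with hw
  set σ := ∑ p ∈ Finset.range n \ S, |x p| with hσ
  have hσ0 : 0 ≤ σ := Finset.sum_nonneg fun _ _ => abs_nonneg _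
  have hdecomp : ∀ i < m, y i = app n a xb i + app n a w i := by
    intro i hi
    rw [hy i hi]
    simp only [app, ← Finset.sum_add_distrib]
    refine Finset.sum_congr rfl fun j _ => ?_
    by_cases hjn : j < n'
    · by_cases hj : j ∈ Sb <;> simp [hxb, hw, hj, hjn]
    · simp [ha i j (not_lt.mp hjn)]
  have hxb0 : ∀ j ∉ Sb, xb j = 0 := fun j hj => by simp only [hxb, if_neg hj]
  -- the noise
  have heta : √k * nrm (Finset.range m) (app n a w) ≤ 17 / 16 * √m * σ := by
    have h := hR.nrm_app_le_of_abs_le hn hk hsmall _ (Finset.range n' \ Sb) le_rfl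
      (fun p hp => Finset.mem_range.mp (Finset.mem_sdiff.mp hp).1) w
      (fun j hj => by simp only [hw, if_neg hj]) ((∑ p ∈ T, |x p|) / k)
      (div_nonneg (Finset.sum_nonneg fun _ _ => abs_nonneg _) hk'.le) (fun p hp => by
        simp only [hw, if_pos hp]
        rw [le_div_iff₀ hk', mul_comm]
        obtain ⟨hpn, hpS⟩ := Finset.mem_sdiff.mp hp
        exact hTw p (Finset.mem_sdiff.mpr
          ⟨Finset.mem_sdiff.mpr ⟨hpn, fun h => hpS (hSsub h)⟩, fun h => hpS (hTsub h)⟩))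
    rw [mul_div_cancel₀ _ hk'.ne'] at h
    refine h.trans (mul_le_mul_of_nonneg_left ?_ (by positivity))
    have hdis : Disjoint T (Finset.range n' \ Sb) :=
      Finset.disjoint_left.mpr fun p hp hp' => (Finset.mem_sdiff.mp hp').2 (hTsub hp)
    have e : ∑ p ∈ Finset.range n' \ Sb, |w p| = ∑ p ∈ Finset.range n' \ Sb, |x p| :=
      Finset.sum_congr rfl fun p hp => by simp only [hw, if_pos hp]
    rw [e, ← Finset.sum_union hdis]
    refine Finset.sum_le_sum_of_subset_of_nonneg (fun p hp => ?_) fun _ _ _ => abs_nonneg _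
    rw [Finset.mem_sdiff, Finset.mem_range]
    rcases Finset.mem_union.mp hp with hp | hp
    · exact ⟨lt_of_lt_of_le (hTn p hp) hn, (Finset.mem_sdiff.mp (hT hp)).2⟩
    · obtain ⟨hpn, hpS⟩ := Finset.mem_sdiff.mp hp
      exact ⟨lt_of_lt_of_le (Finset.mem_range.mp hpn) hn, fun h => hpS (hSsub h)⟩
  -- the output, cut off beyond the first `n` cells
  set z' : ℕ → ℝ := fun p => if p < n then z p else 0 with hz'
  have hzz : ∀ p < n, z p = z' p := fun p hp => by simp only [hz', if_pos hp]
  have hz'U : ∀ p ∉ U, z' p = 0 := by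
    intro p hp
    simp only [hz']
    split_ifs with hpn
    · exact hzU p hpn hp
    · rfl
  have hres : nrm (Finset.range m) (resid n a y z') ≤
      40 * nrm (Finset.range m) (app n a w) := by
    refine nrm_resid_le_of_stopped hR hn hm hb hK hLK hS₀ ha hSbt hsub hxb0 hdecomp hU hz'U ?_
    rcases hgood with h0 | ⟨lam, hlam, hpass, x', U', hstep, hnot⟩
    · left
      rwa [← resid_congr hzz]
    · refine .inr ⟨lam, hlam, ?_, x', U', step_congr hzz hstep, hnot⟩
      unfold Pass
      rwa [← resid_congr hzz]
  have hUS : SmallTree b n' (7 * K) (U ∪ Sb) := by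
    refine ⟨hU.1.union hSbt.closed, fun p hp => ?_, ?_⟩
    · rcases Finset.mem_union.mp hp with hp | hp
      · exact hU.2 p hp
      · exact hSbt.lt p hp
    · have := Finset.card_union_le U Sb
      have := hSbt.card_le
      omega
  have hdiff0 : ∀ j ∉ U ∪ Sb, z' j - xb j = 0 := by
    intro j hj
    rw [Finset.mem_union, not_or] at hj
    rw [hz'U j hj.1, hxb0 j hj.2, sub_zero]
  have herr : √k * nrm (Finset.range n) (fun p => z' p - xb p) ≤ 47 * σ := by
    have h1 := hR.nrm_le ⟨hUS.closed, hUS.lt, hUS.card_le.trans (by omega)⟩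
      (x := fun p => z' p - xb p) hdiff0
    have h2 : nrm (Finset.range m) (app n a fun p => z' p - xb p) ≤
        nrm (Finset.range m) (app n a w) + nrm (Finset.range m) (resid n a y z') := by
      refine le_of_eq_of_le (nrm_congr fun i hi => ?_) (nrm_sub_le _ _ _)
      rw [app_sub, resid, hdecomp i (Finset.mem_range.mp hi), app, app]
      ring
    have h3 : √m * nrm (Finset.range n) (fun p => z' p - xb p) ≤
        44 * nrm (Finset.range m) (app n a w) := by
      have := nrm_nonneg (Finset.range m) (app n a w)
      linarith
    have h4 := mul_le_mul_of_nonneg_left h3 hsk0.le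
    have h5 : √m * (√k * nrm (Finset.range n) (fun p => z' p - xb p)) ≤ √m * (47 * σ) := by
      have : 0 ≤ √m * σ := by positivity
      linarith
    exact le_of_mul_le_mul_left h5 hsm0
  have hUn : U ∪ Sb ⊆ Finset.range n := fun p hp =>
    Finset.mem_range.mpr (lt_of_lt_of_le (hUS.lt p hp) hn)
  have hl1 : ∑ p ∈ Finset.range n, |z' p - xb p| ≤ 188 * √L * σ := by
    have e : ∑ p ∈ Finset.range n, |z' p - xb p| = ∑ p ∈ U ∪ Sb, |z' p - xb p| :=
      (Finset.sum_subset hUn fun p _ hp => by rw [hdiff0 p hp, abs_zero]).symm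
    have hcard : ((U ∪ Sb).card : ℝ) ≤ 4 ^ 2 * (k * L) := by
      have h1 : (U ∪ Sb).card ≤ 7 * K := hUS.card_le
      have h2 : (U ∪ Sb).card ≤ 4 ^ 2 * (k * L) := by omega
      exact_mod_cast h2
    rw [e]
    have h1 := sum_abs_le_nrm (fun p => z' p - xb p) hcard
    have h2 := nrm_mono hUn (fun p => z' p - xb p)
    have h3 : √(4 ^ 2 * (k * L : ℝ)) = 4 * (√k * √L) := by
      rw [Real.sqrt_mul (by norm_num), Real.sqrt_mul hk'.le, Real.sqrt_sq (by norm_num)]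
    rw [h3] at h1
    calc ∑ p ∈ U ∪ Sb, |z' p - xb p| ≤ 4 * (√k * √L) * nrm (U ∪ Sb) (fun p => z' p - xb p) := h1
      _ ≤ 4 * (√k * √L) * nrm (Finset.range n) (fun p => z' p - xb p) := by gcongr
      _ = 4 * √L * (√k * nrm (Finset.range n) (fun p => z' p - xb p)) := by ring
      _ ≤ 4 * √L * (47 * σ) := by gcongr
      _ = 188 * √L * σ := by ring
  have hoff : ∑ p ∈ Finset.range n, |x p - xb p| ≤ σ := by
    have e : ∑ p ∈ Finset.range n, |x p - xb p| = ∑ p ∈ Finset.range n \ Sb, |x p| := by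
      rw [← Finset.sum_sdiff (s₁ := Finset.range n ∩ Sb) (Finset.inter_subset_left),
        Finset.sdiff_inter_self_left]
      rw [Finset.sum_eq_zero (s := Finset.range n ∩ Sb) fun p hp => by
        simp only [hxb, if_pos (Finset.mem_inter.mp hp).2, sub_self, abs_zero], add_zero]
      exact Finset.sum_congr rfl fun p hp => by
        rw [hxb0 p (Finset.mem_sdiff.mp hp).2, sub_zero]
    rw [e]
    exact Finset.sum_le_sum_of_subset_of_nonneg (Finset.sdiff_subset_sdiff subset_rfl hSsub)
      fun _ _ _ => abs_nonneg _
  have hsL : 1 ≤ √(L : ℝ) := Real.one_le_sqrt.mpr hL'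
  calc ∑ p ∈ Finset.range n, |x p - z p| ≤
        ∑ p ∈ Finset.range n, (|x p - xb p| + |z' p - xb p|) := by
        refine Finset.sum_le_sum fun p hp => ?_
        rw [hzz p (Finset.mem_range.mp hp), abs_sub_comm (z' p)]
        exact abs_sub_le _ _ _
    _ = ∑ p ∈ Finset.range n, |x p - xb p| + ∑ p ∈ Finset.range n, |z' p - xb p| :=
        Finset.sum_add_distrib
    _ ≤ σ + 188 * √L * σ := add_le_add hoff hl1
    _ ≤ 189 * √L * σ := by nlinarith

end TreeSparse

/-! ### Exact solutions from small residuals -/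

namespace TreeSparse

open RealRAM Matrix

section Defect

variable {ι R : Type*} [Fintype ι] [DecidableEq ι] [CommRing R] {m : ℕ}

/-- The residual of the least squares problem `B z = y`, multiplied by the Gram determinant: a
polynomial in the entries of `B` and `y`. -/
def defect (B : Matrix (Fin m) ι R) (y : Fin m → R) : Fin m → R :=
  (Bᵀ * B).det • y - B *ᵥ ((Bᵀ * B).adjugate *ᵥ (Bᵀ *ᵥ y))

theorem map_defect {S : Type*} [CommRing S] (f : R →+* S) (B : Matrix (Fin m) ι R)
    (y : Fin m → R) (i : Fin m) :
    defect (B.map f) (fun i => f (y i)) i = f (defect B y i) := by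
  have hG : (B.map f)ᵀ * B.map f = f.mapMatrix (Bᵀ * B) := by
    rw [RingHom.mapMatrix_apply, Matrix.map_mul, Matrix.transpose_map]
  have h1 : (B.map f)ᵀ *ᵥ (fun i => f (y i)) = fun p => f ((Bᵀ *ᵥ y) p) := by
    funext p
    rw [RingHom.map_mulVec, Matrix.transpose_map]
    rfl
  have h2 : (f.mapMatrix (Bᵀ * B)).adjugate *ᵥ (fun p => f ((Bᵀ *ᵥ y) p)) =
      fun p => f (((Bᵀ * B).adjugate *ᵥ (Bᵀ *ᵥ y)) p) := by
    funext p
    rw [RingHom.map_mulVec, ← RingHom.map_adjugate]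
    rfl
  simp only [defect, Pi.sub_apply, Pi.smul_apply, smul_eq_mul]
  rw [hG, h1, h2, map_sub, map_mul, RingHom.map_det, RingHom.map_mulVec]
  rfl

theorem transpose_mulVec_defect (B : Matrix (Fin m) ι R) (y : Fin m → R) :
    Bᵀ *ᵥ defect B y = 0 := by
  rw [defect, Matrix.mulVec_sub, Matrix.mulVec_smul, Matrix.mulVec_mulVec, Matrix.mulVec_mulVec,
    Matrix.mul_adjugate, Matrix.smul_mulVec, Matrix.one_mulVec, sub_self]

end Defect

section Real

variable {ι : Type*} [Fintype ι] [DecidableEq ι] {m : ℕ}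

/-- If the residual of some `z` is too small compared to the defect, then `y` is in the range. -/
theorem exists_exact (B : Matrix (Fin m) ι ℝ) (y : Fin m → ℝ) (hdet : (Bᵀ * B).det ≠ 0)
    (z : ι → ℝ)
    (h : (Bᵀ * B).det ^ 2 * ∑ i, (y i - (B *ᵥ z) i) ^ 2 < ∑ i, defect B y i ^ 2 ∨
      defect B y = 0) : ∃ z' : ι → ℝ, B *ᵥ z' = y := by
  rcases h with h | h
  · exfalso
    set d := (Bᵀ * B).det with hd
    set w := defect B y with hw
    have horth : ∀ v : ι → ℝ, ∑ i, w i * (B *ᵥ v) i = 0 := by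
      intro v
      have h1 : w ⬝ᵥ B *ᵥ v = 0 := by
        rw [Matrix.dotProduct_mulVec, ← Matrix.mulVec_transpose, transpose_mulVec_defect,
          zero_dotProduct]
      exact h1
    have h1 : ∑ i, w i ^ 2 = ∑ i, w i * (d * (y i - (B *ᵥ z) i)) := by
      have e1 : ∑ i, w i ^ 2 = d * ∑ i, w i * y i := by
        have e2 : ∀ i, w i ^ 2 = d * (w i * y i) -
            w i * (B *ᵥ ((Bᵀ * B).adjugate *ᵥ (Bᵀ *ᵥ y))) i := by
          intro i
          have : w i = d * y i - (B *ᵥ ((Bᵀ * B).adjugate *ᵥ (Bᵀ *ᵥ y))) i := by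
            simp [hw, defect, hd]
          linear_combination w i * this
        rw [Finset.sum_congr rfl fun i _ => e2 i, Finset.sum_sub_distrib, horth, sub_zero,
          Finset.mul_sum]
      have e3 : ∑ i, w i * (d * (y i - (B *ᵥ z) i)) =
          d * ∑ i, w i * y i - d * ∑ i, w i * (B *ᵥ z) i := by
        rw [Finset.mul_sum, Finset.mul_sum, ← Finset.sum_sub_distrib]
        exact Finset.sum_congr rfl fun i _ => by ring
      rw [e1, e3, horth, mul_zero, sub_zero]
    have h2 := Finset.sum_mul_sq_le_sq_mul_sq Finset.univ w fun i => d * (y i - (B *ᵥ z) i)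
    rw [← h1] at h2
    simp only [mul_pow, ← Finset.mul_sum] at h2
    have h0 : 0 ≤ d ^ 2 * ∑ i, (y i - (B *ᵥ z) i) ^ 2 :=
      mul_nonneg (sq_nonneg _) (Finset.sum_nonneg fun _ _ => sq_nonneg _)
    nlinarith
  · refine ⟨(Bᵀ * B).det⁻¹ • ((Bᵀ * B).adjugate *ᵥ (Bᵀ *ᵥ y)), ?_⟩
    rw [Matrix.mulVec_smul, ← sub_eq_zero.mp h, smul_smul, inv_mul_cancel₀ hdet, one_smul]

end Real

/-- The columns of `a` that belong to `U`. -/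
def cols {R : Type*} (m : ℕ) (a : ℕ → ℕ → R) (U : Finset ℕ) : Matrix (Fin m) U R :=
  fun i p => a i p

section Cols

variable {b n n' N m : ℕ} {a : ℕ → ℕ → ℝ} {y : ℕ → ℝ} {U : Finset ℕ}

theorem cols_mulVec (hU : ∀ p ∈ U, p < n) {z : ℕ → ℝ} (hz : ∀ p < n, p ∉ U → z p = 0) (i : Fin m) :
    (cols m a U *ᵥ fun p => z p) i = ∑ j ∈ Finset.range n, a i j * z j := by
  rw [← Finset.sum_subset (s₁ := U) (fun p hp => Finset.mem_range.mpr (hU p hp)) fun p hp hpU => by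
    rw [hz p (Finset.mem_range.mp hp) hpU, mul_zero]]
  exact Finset.sum_coe_sort U fun p => a i p * z p

/-- The restricted isometry property makes the columns of a small tree linearly independent. -/
theorem TreeRIP.det_ne_zero (hR : TreeRIP b n' N m n a) (hn : n' ≤ n) (hm : 0 < m)
    (hU : SmallTree b n' N U) : ((cols m a U)ᵀ * cols m a U).det ≠ 0 := by
  intro hdet
  obtain ⟨v, hv0, hv⟩ := Matrix.exists_mulVec_eq_zero_iff.mpr hdet
  set x : ℕ → ℝ := fun p => if h : p ∈ U then v ⟨p, h⟩ else 0 with hx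
  have hxU : ∀ j ∉ U, x j = 0 := fun j hj => by simp only [hx, dif_neg hj]
  have hxv : (fun p : U => x p) = v := by
    funext p
    simp [hx]
  have hUn : ∀ p ∈ U, p < n := fun p hp => lt_of_lt_of_le (hU.lt p hp) hn
  have h1 : ∑ i, (cols m a U *ᵥ v) i ^ 2 = 0 := by
    have : (cols m a U *ᵥ v) ⬝ᵥ (cols m a U *ᵥ v) = 0 := by
      rw [Matrix.dotProduct_mulVec, ← Matrix.mulVec_transpose, Matrix.mulVec_mulVec, hv,
        zero_dotProduct]
    rw [← this]
    exact Finset.sum_congr rfl fun i _ => sq _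
  have h2 : nrm (Finset.range m) (app n a x) = 0 := by
    have h3 : ∑ i ∈ Finset.range m, app n a x i ^ 2 = 0 := by
      rw [← Fin.sum_univ_eq_sum_range (fun i => app n a x i ^ 2), ← h1]
      refine Finset.sum_congr rfl fun i _ => ?_
      rw [← hxv, cols_mulVec hUn fun p _ hp => hxU p hp, app]
    rw [nrm, h3, Real.sqrt_zero]
  have h4 := hR.nrm_le hU hxU
  have hs : 0 < √(m : ℝ) := Real.sqrt_pos.mpr (by exact_mod_cast hm)
  rw [h2, mul_zero] at h4
  have h5 : nrm (Finset.range n) x = 0 :=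
    le_antisymm (by by_contra hlt; exact absurd (mul_pos hs (not_le.mp hlt)) (not_lt.mpr h4))
      (nrm_nonneg _ _)
  refine hv0 (funext fun p => ?_)
  rw [← hxv]
  exact eq_zero_of_nrm_eq_zero h5 p (Finset.mem_range.mpr (hUn p p.2))

/-- The form of `exists_exact` that is used: `y` is in the span of the columns in `U` if some vector
supported in `U` has a small residual. -/
theorem exists_resid_eq_zero (hR : TreeRIP b n' N m n a) (hn : n' ≤ n) (hm : 0 < m)
    (hU : SmallTree b n' N U) {z : ℕ → ℝ} (hz : ∀ p < n, p ∉ U → z p = 0)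
    (h : ((cols m a U)ᵀ * cols m a U).det ^ 2 * ∑ i ∈ Finset.range m, resid n a y z i ^ 2 <
      ∑ i, defect (cols m a U) (fun i => y i) i ^ 2 ∨ defect (cols m a U) (fun i => y i) = 0) :
    ∃ z' : ℕ → ℝ, (∀ p < n, p ∉ U → z' p = 0) ∧ ∀ i < m, resid n a y z' i = 0 := by
  have hUn : ∀ p ∈ U, p < n := fun p hp => lt_of_lt_of_le (hU.lt p hp) hn
  have e : ∑ i ∈ Finset.range m, resid n a y z i ^ 2 =
      ∑ i : Fin m, (y i - (cols m a U *ᵥ fun p => z p) i) ^ 2 := by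
    rw [← Fin.sum_univ_eq_sum_range (fun i => resid n a y z i ^ 2)]
    exact Finset.sum_congr rfl fun i _ => by rw [cols_mulVec hUn hz, resid]
  rw [e] at h
  obtain ⟨v, hv⟩ := exists_exact (cols m a U) (fun i => y i) (hR.det_ne_zero hn hm hU) _ h
  set x : ℕ → ℝ := fun p => if h : p ∈ U then v ⟨p, h⟩ else 0 with hx
  have hxU : ∀ j < n, j ∉ U → x j = 0 := fun j _ hj => by simp only [hx, dif_neg hj]
  have hxv : (fun p : U => x p) = v := by
    funext p
    simp [hx]
  refine ⟨x, hxU, fun i hi => ?_⟩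
  have h1 := congrFun hv ⟨i, hi⟩
  rw [← hxv, cols_mulVec hUn hxU] at h1
  rw [resid, h1, sub_self]

end Cols

/-- After `J` halvings of the penalty `∑ i, y i ^ 2`, a candidate can pass the test only if some
vector with the same support fits the sketch exactly. -/
def EnoughHalvings (b n n' K m : ℕ) (a : ℕ → ℕ → ℝ) (y : ℕ → ℝ) (J : ℕ) : Prop :=
  ∀ U, Adm b n' U → U.card ≤ 4 * K → ∀ z : ℕ → ℝ, (∀ p < n, p ∉ U → z p = 0) →
    ∑ i ∈ Finset.range m, resid n a y z i ^ 2 ≤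
      16 * m * K * ((∑ i ∈ Finset.range m, y i ^ 2) / 2 ^ J) →
    ∃ z' : ℕ → ℝ, (∀ p < n, p ∉ U → z' p = 0) ∧ ∀ i < m, resid n a y z' i = 0

section Halvings

variable {b n n' N K m : ℕ} {a : ℕ → ℕ → ℝ}

theorem exists_enoughHalvings (hR : TreeRIP b n' N m n a) (hn : n' ≤ n) (hm : 0 < m)
    (hN : 4 * K ≤ N) (y : ℕ → ℝ) : ∃ J, EnoughHalvings b n n' K m a y J := by
  classical
  set Y := ∑ i ∈ Finset.range m, y i ^ 2 with hY
  have hY0 : 0 ≤ Y := Finset.sum_nonneg fun _ _ => sq_nonneg _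
  set f : Finset ℕ → ℝ := fun U => ∑ i, defect (cols m a U) (fun i => y i) i ^ 2 with hf
  set d : Finset ℕ → ℝ := fun U => ((cols m a U)ᵀ * cols m a U).det with hd
  have hone : ∀ U ∈ (Finset.range n').powerset, ∃ J : ℕ, ∀ J' ≥ J, 0 < f U →
      d U ^ 2 * (16 * m * K * (Y / 2 ^ J')) < f U := by
    intro U _
    by_cases h0 : 0 < f U
    · obtain ⟨J, hJ⟩ := pow_unbounded_of_one_lt (d U ^ 2 * (16 * m * K * Y) / f U)
        (one_lt_two (α := ℝ))
      refine ⟨J, fun J' hJ' _ => ?_⟩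
      have h1 : d U ^ 2 * (16 * m * K * Y) / f U < 2 ^ J' :=
        lt_of_lt_of_le hJ (pow_le_pow_right₀ one_le_two hJ')
      rw [div_lt_iff₀ h0] at h1
      rw [show d U ^ 2 * (16 * m * K * (Y / 2 ^ J')) = d U ^ 2 * (16 * m * K * Y) / 2 ^ J' by ring,
        div_lt_iff₀ (by positivity)]
      linarith
    · exact ⟨0, fun _ _ h => absurd h h0⟩
  choose! J hJ using hone
  refine ⟨(Finset.range n').powerset.sup J, fun U hU hUc z hz hres => ?_⟩
  have hmem : U ∈ (Finset.range n').powerset :=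
    Finset.mem_powerset.mpr fun p hp => Finset.mem_range.mpr (hU.2 p hp)
  refine exists_resid_eq_zero hR hn hm ⟨hU.1, hU.2, hUc.trans hN⟩ hz ?_
  have hf0 : 0 ≤ f U := Finset.sum_nonneg fun _ _ => sq_nonneg _
  rcases hf0.eq_or_lt with h0 | hpos
  · right
    funext i
    have h1 := (Finset.sum_eq_zero_iff_of_nonneg fun _ _ => sq_nonneg _).mp h0.symm i
      (Finset.mem_univ i)
    exact pow_eq_zero_iff two_ne_zero |>.mp h1
  · left
    exact lt_of_le_of_lt (mul_le_mul_of_nonneg_left hres (sq_nonneg _))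
      (hJ U hmem _ (Finset.le_sup hmem) hpos)

/-- For integer data the defect is an integer vector, hence not small unless it vanishes, while the
Gram determinant is bounded. -/
theorem enoughHalvings_of_int (hR : TreeRIP b n' N m n a) (hn : n' ≤ n) (hm : 0 < m)
    (hN : 4 * K ≤ N) (hK : 1 ≤ K) {α : ℕ → ℕ → ℤ} (hα : ∀ i j, a i j = α i j)
    (hα1 : ∀ i j, |α i j| ≤ 1) {y : ℕ → ℝ} {η : ℕ → ℤ} (hη : ∀ i, y i = η i) {Y : ℝ}
    (hY : ∀ i < m, y i ^ 2 ≤ Y) {J : ℕ}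
    (hJ : ((4 * K * m : ℝ)) ^ (8 * K) * (16 * m * K * (m * Y)) < 2 ^ J) :
    EnoughHalvings b n n' K m a y J := by
  classical
  intro U hU hUc z hz hres
  refine exists_resid_eq_zero hR hn hm ⟨hU.1, hU.2, hUc.trans hN⟩ hz ?_
  have hm' : (1 : ℝ) ≤ m := by exact_mod_cast hm
  have hK' : (1 : ℝ) ≤ K := by exact_mod_cast hK
  have hcols : cols m a U = (cols m α U).map (Int.castRingHom ℝ) := by
    ext i p
    exact hα i p
  have hdef : ∀ i, defect (cols m a U) (fun i => y i) i =
      ((defect (cols m α U) (fun i : Fin m => η i) i : ℤ) : ℝ) := by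
    intro i
    rw [hcols, show (fun i : Fin m => y i) = fun i : Fin m => Int.castRingHom ℝ (η i) from
      funext fun i => hη i, map_defect]
    rfl
  by_cases h0 : defect (cols m a U) (fun i => y i) = 0
  · exact .inr h0
  left
  have hge : (1 : ℝ) ≤ ∑ i, defect (cols m a U) (fun i => y i) i ^ 2 := by
    obtain ⟨i, hi⟩ := Function.ne_iff.mp h0
    rw [hdef i, Pi.zero_apply, Int.cast_ne_zero] at hi
    refine le_trans ?_ (Finset.single_le_sum (fun _ _ => sq_nonneg _) (Finset.mem_univ i))
    rw [hdef i]
    have h1 : 1 ≤ (defect (cols m α U) (fun i : Fin m => η i) i) ^ 2 :=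
      Order.one_le_iff_pos.mpr (by positivity)
    exact_mod_cast h1
  refine lt_of_lt_of_le ?_ hge
  have ha1 : ∀ i j, |a i j| ≤ 1 := fun i j => by
    rw [hα i j]
    exact_mod_cast hα1 i j
  have hdet : |((cols m a U)ᵀ * cols m a U).det| ≤ (4 * K * m : ℝ) ^ (4 * K) := by
    have hent : ∀ p q, AbsoluteValue.abs (((cols m a U)ᵀ * cols m a U) p q) ≤ (m : ℝ) := by
      intro p q
      rw [AbsoluteValue.abs_apply, Matrix.mul_apply]
      calc |∑ i, (cols m a U)ᵀ p i * cols m a U i q| ≤ ∑ i, |(cols m a U)ᵀ p i * cols m a U i q| :=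
            Finset.abs_sum_le_sum_abs _ _
        _ ≤ ∑ _i : Fin m, (1 : ℝ) := Finset.sum_le_sum fun i _ => by
            rw [abs_mul]
            exact mul_le_one₀ (ha1 i p) (abs_nonneg _) (ha1 i q)
        _ = m := by simp
    have h1 := Matrix.det_le hent
    rw [AbsoluteValue.abs_apply, Fintype.card_coe, nsmul_eq_mul] at h1
    have h2 : ((U.card.factorial : ℕ) : ℝ) ≤ (4 * K) ^ U.card := by
      calc ((U.card.factorial : ℕ) : ℝ) ≤ ((U.card ^ U.card : ℕ) : ℝ) := by
            exact_mod_cast Nat.factorial_le_pow U.card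
        _ = (U.card : ℝ) ^ U.card := by push_cast; rfl
        _ ≤ (4 * K) ^ U.card := by
            have : (U.card : ℝ) ≤ 4 * K := by exact_mod_cast hUc
            gcongr
    calc _ ≤ ((U.card.factorial : ℕ) : ℝ) * m ^ U.card := h1
      _ ≤ (4 * K) ^ U.card * m ^ U.card := by gcongr
      _ = (4 * K * m : ℝ) ^ U.card := (mul_pow _ _ _).symm
      _ ≤ (4 * K * m : ℝ) ^ (4 * K) := pow_le_pow_right₀ (by nlinarith) hUc
  have hdet2 : ((cols m a U)ᵀ * cols m a U).det ^ 2 ≤ (4 * K * m : ℝ) ^ (8 * K) := by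
    rw [← sq_abs, show 8 * K = 4 * K * 2 by ring, pow_mul]
    exact pow_le_pow_left₀ (abs_nonneg _) hdet 2
  have hYs : ∑ i ∈ Finset.range m, y i ^ 2 ≤ m * Y := by
    have := Finset.sum_le_card_nsmul (Finset.range m) (fun i => y i ^ 2) Y
      fun i hi => hY i (Finset.mem_range.mp hi)
    rwa [Finset.card_range, nsmul_eq_mul] at this
  calc ((cols m a U)ᵀ * cols m a U).det ^ 2 * ∑ i ∈ Finset.range m, resid n a y z i ^ 2 ≤
        (4 * K * m : ℝ) ^ (8 * K) * (16 * m * K * ((m * Y) / 2 ^ J)) := by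
        refine mul_le_mul hdet2 (hres.trans ?_) (Finset.sum_nonneg fun _ _ => sq_nonneg _)
          (by positivity)
        gcongr
    _ = (4 * K * m : ℝ) ^ (8 * K) * (16 * m * K * (m * Y)) / 2 ^ J := by ring
    _ < 1 := by
        rw [div_lt_one (by positivity)]
        exact hJ

end Halvings

end TreeSparse

/-! ### The full tree -/

namespace TreeSparse

section Size

variable {b : ℕ}

theorem treeSize_succ (hb : 2 ≤ b) (u : ℕ) : treeSize b (u + 1) = b * treeSize b u + 1 := by
  rw [treeSize_eq_sum b _ hb, treeSize_eq_sum b _ hb, Finset.sum_range_succ', Finset.mul_sum,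
    pow_zero]
  simp only [pow_succ, mul_comm b]

theorem treeSize_zero (b : ℕ) : treeSize b 0 = 0 := by simp [treeSize]

theorem treeSize_mono (hb : 2 ≤ b) : Monotone (treeSize b) := by
  refine monotone_nat_of_le_succ fun u => ?_
  rw [treeSize_succ hb]
  nlinarith

theorem two_pow_mul_treeSize_le (hb : 2 ≤ b) (u v : ℕ) :
    2 ^ v * treeSize b u ≤ treeSize b (u + v) := by
  induction v with
  | zero => simp
  | succ v ih =>
    rw [← add_assoc, treeSize_succ hb, pow_succ]
    nlinarith [Nat.mul_le_mul_right (treeSize b (u + v)) hb]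

theorem par_lt_treeSize (hb : 2 ≤ b) {u j : ℕ} (hu : 1 ≤ u) (hj : j < treeSize b (u + 1)) :
    par b j < treeSize b u := by
  rw [treeSize_succ hb] at hj
  rcases Nat.eq_zero_or_pos j with rfl | hj0
  · have h1 := treeSize_mono hb hu
    have h2 : treeSize b 1 = 1 := by rw [treeSize_succ hb, treeSize_zero, mul_zero]
    rw [par_zero]
    omega
  · rw [par, Nat.div_lt_iff_lt_mul (by omega), mul_comm]
    omega

theorem treeSize_le_par (hb : 2 ≤ b) {u j : ℕ} (hj : treeSize b (u + 1) ≤ j) :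
    treeSize b u ≤ par b j := by
  rw [treeSize_succ hb] at hj
  rw [par, Nat.le_div_iff_mul_le (by omega), mul_comm]
  omega

theorem iterate_par_lt_treeSize (hb : 2 ≤ b) {u : ℕ} (hu : 1 ≤ u) (L : ℕ) {j : ℕ}
    (hj : j < treeSize b (u + L)) : (par b)^[L] j < treeSize b u := by
  induction L generalizing j with
  | zero => exact hj
  | succ L ih =>
    rw [Function.iterate_succ_apply]
    exact ih (par_lt_treeSize hb (by omega) hj)

/-- A rooted subtree with a node at depth `u` or below has more than `u` nodes. -/
theorem PClosed.lt_card (hb : 2 ≤ b) {W : Finset ℕ} (hW : PClosed b W) (u : ℕ) {j : ℕ}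
    (hj : j ∈ W) (huj : treeSize b u ≤ j) : u < (W.filter fun i => i ≤ j).card := by
  induction u generalizing j with
  | zero => exact Finset.card_pos.mpr ⟨j, Finset.mem_filter.mpr ⟨hj, le_rfl⟩⟩
  | succ u ih =>
    have hj0 : j ≠ 0 := by
      rw [treeSize_succ hb] at huj
      omega
    have hlt := par_lt (b := b) hj0
    refine Nat.lt_of_le_of_lt (ih (hW j hj) (treeSize_le_par hb huj)) (Finset.card_lt_card ?_)
    refine ⟨fun i hi => ?_, fun hsub => ?_⟩
    · rw [Finset.mem_filter] at hi ⊢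
      exact ⟨hi.1, by omega⟩
    · have := (Finset.mem_filter.mp (hsub (Finset.mem_filter.mpr ⟨hj, le_rfl⟩))).2
      omega

/-- The skeleton consists of the top levels with at most `K` nodes in total. Only `L` further levels
matter, since subtrees with `K` nodes have depth at most `K`, and the tree has about
`L = log (n / K)` levels below the skeleton. -/
theorem exists_skeleton (hb : 2 ≤ b) {l K : ℕ} (hK : 1 ≤ K) (hKn : K < treeSize b l) :
    ∃ n' L S₀, n' ≤ treeSize b l ∧ 1 ≤ L ∧ L ≤ K ∧ Skeleton b n' K L S₀ ∧
      2 ^ L * K < 2 * treeSize b l ∧ (treeSize b K ≤ n' ∨ n' = treeSize b l) := by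
  have h1 : treeSize b 1 = 1 := by rw [treeSize_succ hb, treeSize_zero, mul_zero]
  have hl : 1 ≤ l := by
    by_contra h0
    rw [show l = 0 by omega, treeSize_zero] at hKn
    omega
  set t := Nat.findGreatest (fun u => treeSize b u ≤ K) l with ht
  have ht1 : 1 ≤ t := Nat.le_findGreatest hl (by rwa [h1])
  have htK : treeSize b t ≤ K :=
    Nat.findGreatest_spec (P := fun u => treeSize b u ≤ K) hl (by rwa [h1])
  have htl : t < l := lt_of_le_of_ne (Nat.findGreatest_le l) fun h => by
    rw [h] at htK
    omega
  have ht' : K < treeSize b (t + 1) :=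
    not_le.mp (Nat.findGreatest_is_greatest (P := fun u => treeSize b u ≤ K)
      (Nat.lt_succ_self t) htl)
  have hn' : treeSize b (t + min (l - t) K) ≤ treeSize b l := treeSize_mono hb (by omega)
  refine ⟨treeSize b (t + min (l - t) K), min (l - t) K, Finset.range (treeSize b t), hn',
    by omega, min_le_right _ _, ⟨fun j hj => ?_, fun p hp => ?_, by rwa [Finset.card_range],
      fun v hv => Finset.mem_range.mpr (iterate_par_lt_treeSize hb ht1 _ hv)⟩, ?_, ?_⟩
  · have := par_le b j
    rw [Finset.mem_range] at hj ⊢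
    omega
  · exact lt_of_lt_of_le (Finset.mem_range.mp hp) (treeSize_mono hb (by omega))
  · have h2 := two_pow_mul_treeSize_le hb (t + 1) (l - t - 1)
    rw [show t + 1 + (l - t - 1) = l by omega] at h2
    have h3 : 2 ^ (l - t - 1) * K < 2 ^ (l - t - 1) * treeSize b (t + 1) :=
      Nat.mul_lt_mul_of_pos_left ht' (by positivity)
    have h4 : (2 : ℕ) ^ min (l - t) K ≤ 2 ^ (l - t - 1 + 1) :=
      Nat.pow_le_pow_right (by omega) (by omega)
    rw [pow_succ] at h4
    have h5 := Nat.mul_le_mul_right K h4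
    nlinarith
  · rcases le_total (l - t) K with h | h
    · right
      rw [min_eq_left h, show t + (l - t) = l by omega]
    · left
      rw [min_eq_right h]
      exact treeSize_mono hb (by omega)

end Size

section Graph

variable {b l K : ℕ}

theorem fullTree_adj {i j : Fin (treeSize b l)} (h : (fullTree b l).Adj i j) :
    i.val = par b j.val ∨ j.val = par b i.val := by
  rw [fullTree, SimpleGraph.fromRel_adj] at h
  rcases h.2 with h | h
  · exact .inl h.2
  · exact .inr h.2

/-- A connected set of nodes that contains the root is closed under taking parents: a walk from
`j` to the root has to leave the set of descendants of `j`, which is possible from `j` to its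
parent only. -/
theorem pClosed_of_mem_rootedSubtrees {S : Finset (Fin (treeSize b l))}
    (hS : S ∈ rootedSubtrees b l K) : PClosed b (S.map Fin.valEmbedding) := by
  obtain ⟨_, ⟨r, hrS, hr0⟩, hconn⟩ := hS
  intro j hj
  obtain ⟨v, hvS, rfl⟩ := Finset.mem_map.mp hj
  rw [Fin.valEmbedding_apply] at hj ⊢
  rcases eq_or_ne v.val 0 with hv0 | hv0
  · rwa [hv0, par_zero, ← hv0]
  obtain ⟨walk⟩ := hconn.preconnected ⟨v, hvS⟩ ⟨r, hrS⟩
  obtain ⟨d, _, hd1, hd2⟩ := walk.exists_boundary_dart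
    {i | ∃ k, (par b)^[k] i.val.val = v.val} ⟨0, rfl⟩ (by
      rintro ⟨k, hk⟩
      change (par b)^[k] r.val = v.val at hk
      have := iterate_par_le b r.val k
      omega)
  have hadj : (fullTree b l).Adj d.fst.val d.snd.val := d.adj
  obtain ⟨k, hk⟩ := hd1
  rcases fullTree_adj hadj with h | h
  · exact absurd ⟨k + 1, by rw [Function.iterate_succ_apply, ← h, hk]⟩ hd2
  · cases k with
    | zero =>
      rw [Function.iterate_zero, id] at hk
      rw [← hk, ← h]
      exact Finset.mem_map_of_mem Fin.valEmbedding d.snd.prop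
    | succ k =>
      rw [Function.iterate_succ_apply, ← h] at hk
      exact absurd ⟨k, hk⟩ hd2

theorem smallTree_of_mem_rootedSubtrees (hb : 2 ≤ b) {n' : ℕ}
    (hn' : treeSize b K ≤ n' ∨ n' = treeSize b l) {S : Finset (Fin (treeSize b l))}
    (hS : S ∈ rootedSubtrees b l K) : SmallTree b n' K (S.map Fin.valEmbedding) := by
  have hcard : (S.map Fin.valEmbedding).card ≤ K := by
    rw [Finset.card_map]
    exact hS.1
  have hcl := pClosed_of_mem_rootedSubtrees hS
  refine ⟨hcl, fun p hp => ?_, hcard⟩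
  rcases hn' with h | h
  · by_contra hle
    have h1 := hcl.lt_card hb K hp (by omega)
    have h2 := Finset.card_filter_le (S.map Fin.valEmbedding) fun i => i ≤ p
    omega
  · obtain ⟨v, _, rfl⟩ := Finset.mem_map.mp hp
    rw [h]
    exact v.isLt

end Graph

end TreeSparse

/-! ### The recovery theorem -/

namespace TreeSparse

open RealRAM

/-- The number of rows per unit of sparsity, as required by `exists_treeRIP` for trees with
`(8 + b) * K` nodes. -/
def rowFactor (b : ℕ) : ℕ := 4096 * ((b + 7) * (8 + b))

/-- The number of halvings, up to the factor `K log n`, for integer coordinates of size `n ^ e`. -/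
def halvingFactor (b e : ℕ) : ℕ := 40 * rowFactor b + 21 + 2 * e

/-- The constant in the time bound. -/
def timeFactor (b e : ℕ) : ℕ :=
  3 * (halvingFactor b e * (18000 * (rowFactor b + b + 1) + 360180 * (rowFactor b + 2) + 30))

theorem timeFactor_mono (b : ℕ) : Monotone (timeFactor b) := by
  intro e e' h
  refine Nat.mul_le_mul_left _ (Nat.mul_le_mul_right _ ?_)
  unfold halvingFactor
  omega

theorem one_le_rowFactor (b : ℕ) : 1 ≤ rowFactor b := by
  unfold rowFactor
  have : 1 ≤ (b + 7) * (8 + b) := by nlinarith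
  omega

/-- The running time in terms of the binary logarithm of `n`. -/
theorem time_le {b n K m M E ν J : ℕ} (hm : m = M * K) (hK : 1 ≤ K) (hKn : K ≤ n)
    (hν : ν = Nat.log 2 n + 1) (hE : 5 ≤ E) (hJ : J = K * ν * E) :
    (2 * J + 3) * (1800 * (m + b + 1) * (n + 1)) +
        (Nat.log 2 (2 * J + 1) + 1) * (2001 * (4 * K + 2) ^ 2 * (m + n + 1)) + 30 ≤
      K ^ 2 * n * ν * (E * (18000 * (M + b + 1) + 360180 * (M + 2) + 30)) := by
  have hν1 : 1 ≤ ν := by omega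
  have hn : 1 ≤ n := by omega
  have hνn : ν ≤ n := by
    have := Nat.log_lt_self 2 (x := n) (by omega)
    omega
  have hJ1 : 1 ≤ J := by
    rw [hJ]
    exact Nat.mul_pos (Nat.mul_pos hK hν1) (by omega)
  have hlog : Nat.log 2 (2 * J + 1) + 1 ≤ 5 * (E * ν) := by
    have h1 : 2 * J + 1 < 2 ^ (3 * E + 2 * ν) := by
      have h2 : n < 2 ^ ν := by rw [hν]; exact Nat.lt_pow_succ_log_self (by omega) n
      have h3 : J ≤ n * n * E := by
        rw [hJ]
        exact Nat.mul_le_mul_right _ (Nat.mul_le_mul hKn hνn)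
      have h4 : 3 * E < 2 ^ (3 * E) := Nat.lt_two_pow_self
      have h5 : n * n < 2 ^ (2 * ν) := by
        rw [two_mul, pow_add]
        exact Nat.mul_lt_mul_of_lt_of_lt h2 h2
      rw [pow_add]
      calc 2 * J + 1 ≤ 3 * E * (n * n) := by nlinarith
        _ < 2 ^ (3 * E) * 2 ^ (2 * ν) := Nat.mul_lt_mul_of_lt_of_lt h4 h5
    have h2 := Nat.log_lt_of_lt_pow (by omega) h1
    nlinarith
  have hmn : m + n + 1 ≤ (M + 2) * n := by
    rw [hm]
    nlinarith [Nat.mul_le_mul_left M hKn]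
  have hmb : m + b + 1 ≤ (M + b + 1) * K := by
    rw [hm]
    nlinarith [Nat.mul_le_mul_left (b + 1) hK]
  have t1 : (2 * J + 3) * (1800 * (m + b + 1) * (n + 1)) ≤
      K ^ 2 * n * ν * (E * (18000 * (M + b + 1))) := by
    calc (2 * J + 3) * (1800 * (m + b + 1) * (n + 1)) ≤
          (5 * J) * (1800 * ((M + b + 1) * K) * (2 * n)) := by gcongr <;> omega
      _ = K ^ 2 * n * ν * (E * (18000 * (M + b + 1))) := by rw [hJ]; ring
  have t2 : (Nat.log 2 (2 * J + 1) + 1) * (2001 * (4 * K + 2) ^ 2 * (m + n + 1)) ≤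
      K ^ 2 * n * ν * (E * (360180 * (M + 2))) := by
    calc (Nat.log 2 (2 * J + 1) + 1) * (2001 * (4 * K + 2) ^ 2 * (m + n + 1)) ≤
          (5 * (E * ν)) * (2001 * (6 * K) ^ 2 * ((M + 2) * n)) := by gcongr; omega
      _ = K ^ 2 * n * ν * (E * (360180 * (M + 2))) := by ring
  have t3 : 30 ≤ K ^ 2 * n * ν * (E * 30) := by
    have h1 : 1 ≤ K ^ 2 * n * ν := Nat.mul_pos (Nat.mul_pos (by positivity) hn) hν1
    nlinarith
  calc _ ≤ K ^ 2 * n * ν * (E * (18000 * (M + b + 1))) +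
        K ^ 2 * n * ν * (E * (360180 * (M + 2))) + K ^ 2 * n * ν * (E * 30) :=
        add_le_add (add_le_add t1 t2) t3
    _ = _ := by ring

/-- The number of halvings suffices for integer coordinates of size `n ^ e`. -/
theorem pow_halvings {n K m M e ν J : ℕ} (hm : m = M * K) (hK : 1 ≤ K) (hKn : K ≤ n)
    (hν : ν = Nat.log 2 n + 1) (hJ : J = K * ν * (40 * M + 21 + 2 * e)) :
    ((4 * K * m : ℝ)) ^ (8 * K) * (16 * m * K * (m * ((n : ℝ) ^ (e + 1)) ^ 2)) < 2 ^ J := by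
  have hn : 1 ≤ n := by omega
  have hν1 : 1 ≤ ν := by omega
  have h2 : n < 2 ^ ν := by rw [hν]; exact Nat.lt_pow_succ_log_self (by omega) n
  have hmn : m ≤ M * n := by rw [hm]; exact Nat.mul_le_mul_left _ hKn
  have key : (4 * K * m) ^ (8 * K) * (16 * m * K * (m * (n ^ (e + 1)) ^ 2)) < 2 ^ J := by
    calc (4 * K * m) ^ (8 * K) * (16 * m * K * (m * (n ^ (e + 1)) ^ 2)) ≤
          (4 * n * (M * n)) ^ (8 * K) * (16 * (M * n) * n * ((M * n) * (n ^ (e + 1)) ^ 2)) := by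
          gcongr
      _ = (4 * M) ^ (8 * K + 2) * n ^ (16 * K + 2 * e + 5) := by
          rw [show 4 * n * (M * n) = 4 * M * n ^ 2 by ring, mul_pow, ← pow_mul,
            show 2 * (8 * K) = 16 * K by ring]
          ring
      _ < (2 ^ (4 * M)) ^ (8 * K + 2) * (2 ^ ν) ^ (16 * K + 2 * e + 5) := by
          refine Nat.mul_lt_mul_of_lt_of_lt ?_ ?_
          · exact Nat.pow_lt_pow_left Nat.lt_two_pow_self (by omega)
          · exact Nat.pow_lt_pow_left h2 (by omega)
      _ ≤ 2 ^ J := by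
          rw [← pow_mul, ← pow_mul, ← pow_add]
          refine Nat.pow_le_pow_right (by omega) ?_
          rw [hJ]
          have hKν : K ≤ K * ν := Nat.le_mul_of_pos_right K hν1
          have hKν' : ν ≤ K * ν := Nat.le_mul_of_pos_left ν hK
          have e1 : 4 * M * (8 * K + 2) ≤ 40 * M * (K * ν) := by nlinarith
          have e2 : ν * (16 * K + 2 * e + 5) ≤ (21 + 2 * e) * (K * ν) := by nlinarith
          nlinarith
  exact_mod_cast key

theorem hasInput_input {b l K m : ℕ} (a : ℕ → ℕ → ℝ) (y : ℕ → ℝ) :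
    HasInput b (treeSize b l) K m a y
      (input b l K (fun (i : Fin m) (j : Fin (treeSize b l)) => a i j) fun i => y i) := by
  refine ⟨by simp [input], by simp [input], by simp [input], by simp [input], ?_, ?_⟩
  · intro i hi j hj
    have hlt : i * treeSize b l + j < m * treeSize b l := by
      calc i * treeSize b l + j < i * treeSize b l + treeSize b l := by omega
        _ = (i + 1) * treeSize b l := by ring
        _ ≤ m * treeSize b l := Nat.mul_le_mul_right _ hi
    have h0 : 0 < treeSize b l := by omega
    simp only [input, if_true, dif_pos hlt, Fin.coe_divNat, Fin.coe_modNat]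
    rw [mul_comm i, Nat.mul_add_div h0, Nat.div_eq_of_lt hj, add_zero, Nat.mul_add_mod,
      Nat.mod_eq_of_lt hj]
  · intro i hi
    simp [input, hi]

theorem sqrt_le_of_two_pow_mul_lt {n K L : ℕ} (hK : 1 ≤ K) (hKn : 2 * K < n)
    (hL : 2 ^ L * K < 2 * n) : √L ≤ 2 * √(Real.log ((n : ℝ) / K)) := by
  have hK' : (0 : ℝ) < K := by exact_mod_cast hK
  have h1 : (2 : ℝ) ^ L ≤ 2 * ((n : ℝ) / K) := by
    rw [← mul_div_assoc, le_div_iff₀ hK']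
    exact_mod_cast hL.le
  have h2 : (2 : ℝ) ≤ (n : ℝ) / K := by
    rw [le_div_iff₀ hK']
    exact_mod_cast hKn.le
  have h3 := Real.log_le_log (by positivity) h1
  rw [Real.log_pow, Real.log_mul (by norm_num) (by positivity)] at h3
  have h4 := Real.log_le_log (by norm_num) h2
  have h5 := Real.log_two_gt_d9
  have h6 : (L : ℝ) ≤ 2 ^ 2 * Real.log ((n : ℝ) / K) := by nlinarith
  calc √L ≤ √(2 ^ 2 * Real.log ((n : ℝ) / K)) := Real.sqrt_le_sqrt h6
    _ = 2 * √(Real.log ((n : ℝ) / K)) := by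
        rw [Real.sqrt_mul (by norm_num), Real.sqrt_sq (by norm_num)]

theorem natLog_succ_le {n : ℕ} (hn : 3 ≤ n) : ((Nat.log 2 n + 1 : ℕ) : ℝ) ≤ 3 * Real.log n := by
  have hn' : (3 : ℝ) ≤ n := by exact_mod_cast hn
  have h1 : (1 : ℝ) ≤ Real.log n := by
    rw [Real.le_log_iff_exp_le (by linarith)]
    linarith [Real.exp_one_lt_d9]
  have h2 : (2 : ℝ) ^ Nat.log 2 n ≤ n := by exact_mod_cast Nat.pow_log_le_self 2 (by omega)
  have h3 := Real.log_le_log (by positivity) h2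
  rw [Real.log_pow] at h3
  have h5 := Real.log_two_gt_d9
  push_cast
  nlinarith

theorem mulVec_eq_app {m n : ℕ} (a : ℕ → ℕ → ℝ) (x : Fin n → ℝ) (i : Fin m) :
    Matrix.mulVec (fun (i : Fin m) (j : Fin n) => a i j) x i =
      app n a (fun p => if h : p < n then x ⟨p, h⟩ else 0) i := by
  rw [app, ← Fin.sum_univ_eq_sum_range
    (fun j => a i j * if h : j < n then x ⟨j, h⟩ else 0)]
  change ∑ j : Fin n, a i j * x j = _
  exact Finset.sum_congr rfl fun j _ => by rw [dif_pos j.isLt]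

/-- The error bound for the program in terms of vectors indexed by the nodes of the tree. -/
theorem l1Norm_sub_output_le {b l K n' L m : ℕ} {a : ℕ → ℕ → ℝ} {S₀ : Finset ℕ} (hb : 2 ≤ b)
    (hK : 1 ≤ K) (hKn : 2 * K < treeSize b l) (hm : 0 < m)
    (hR : TreeRIP b n' ((8 + b) * K) m (treeSize b l) a) (hn : n' ≤ treeSize b l) (hL : 1 ≤ L)
    (hLK : L ≤ K) (hS₀ : Skeleton b n' K L S₀) (hLn : 2 ^ L * K < 2 * treeSize b l)
    (hn' : treeSize b K ≤ n' ∨ n' = treeSize b l) (ha : ∀ i j, n' ≤ j → a i j = 0)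
    {x : Fin (treeSize b l) → ℝ} {y : ℕ → ℝ} (hy : ∀ i < m, y i = app (treeSize b l) a
      (fun p => if h : p < treeSize b l then x ⟨p, h⟩ else 0) i) {s : State}
    (hs : Good b (treeSize b l) m K a y (Adm b n') (s.real 2))
    {x' : Fin (treeSize b l) → ℝ} (hx' : x' ∈ treeSparse b l K) :
    l1Norm (x - output (treeSize b l) s) ≤
      400 * √(Real.log ((treeSize b l : ℝ) / K)) * l1Norm (x - x') := by
  obtain ⟨S, hS, hsupp⟩ := hx'
  set xN : ℕ → ℝ := fun p => if h : p < treeSize b l then x ⟨p, h⟩ else 0 with hxN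
  have hk : 1 ≤ K / L := (Nat.one_le_div_iff hL).mpr hLK
  have hkL : K / L * L ≤ K := Nat.div_mul_le_self K L
  have hKk : K ≤ 2 * (K / L * L) := by
    have h1 := Nat.lt_div_mul_add hL (a := K)
    have h2 := Nat.mul_le_mul_right L hk
    omega
  have main := sum_abs_sub_le hR hn hm (by omega) hK hL hk hkL hKk hS₀ ha
    (smallTree_of_mem_rootedSubtrees hb hn' hS) hy hs
  have e1 : ∑ p ∈ Finset.range (treeSize b l), |xN p - s.real 2 p| =
      l1Norm (x - output (treeSize b l) s) := by
    rw [← Fin.sum_univ_eq_sum_range (fun p => |xN p - s.real 2 p|), l1Norm]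
    exact Finset.sum_congr rfl fun i _ => by simp [hxN, output]
  have e2 : ∑ p ∈ Finset.range (treeSize b l) \ S.map Fin.valEmbedding, |xN p| ≤
      l1Norm (x - x') := by
    have h1 : Finset.range (treeSize b l) \ S.map Fin.valEmbedding =
        Sᶜ.map Fin.valEmbedding := by
      ext p
      simp only [Finset.mem_sdiff, Finset.mem_range, Finset.mem_map, Finset.mem_compl,
        Fin.valEmbedding_apply]
      constructor
      · rintro ⟨hp, hpS⟩
        exact ⟨⟨p, hp⟩, fun h => hpS ⟨⟨p, hp⟩, h, rfl⟩, rfl⟩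
      · rintro ⟨v, hv, rfl⟩
        refine ⟨v.isLt, ?_⟩
        rintro ⟨v', hv', h⟩
        exact hv (Fin.ext h ▸ hv')
    rw [h1, Finset.sum_map, l1Norm]
    refine le_trans (le_of_eq (Finset.sum_congr rfl fun i hi => ?_))
      (Finset.sum_le_sum_of_subset_of_nonneg (Finset.subset_univ Sᶜ) fun _ _ _ => abs_nonneg _)
    have h0 : x' i = 0 := by
      by_contra h
      exact Finset.mem_compl.mp hi (Finset.mem_coe.mp (hsupp h))
    simp [hxN, h0]
  have h0 : 0 ≤ l1Norm (x - x') := Finset.sum_nonneg fun _ _ => abs_nonneg _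
  have hsq := sqrt_le_of_two_pow_mul_lt hK hKn hLn
  rw [e1] at main
  calc l1Norm (x - output (treeSize b l) s) ≤
        189 * √L * ∑ p ∈ Finset.range (treeSize b l) \ S.map Fin.valEmbedding, |xN p| := main
    _ ≤ 189 * √L * l1Norm (x - x') := by gcongr
    _ ≤ 189 * (2 * √(Real.log ((treeSize b l : ℝ) / K))) * l1Norm (x - x') := by gcongr
    _ ≤ 400 * √(Real.log ((treeSize b l : ℝ) / K)) * l1Norm (x - x') := by
        have : 0 ≤ √(Real.log ((treeSize b l : ℝ) / K)) * l1Norm (x - x') :=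
          mul_nonneg (Real.sqrt_nonneg _) h0
        linarith

end TreeSparse

open RealRAM TreeSparse in
theorem mainTheorem3 :
    ∃ C : ℝ, 1 < C ∧ ∃ (p : RealRAM.Program) (c : ℕ),
      ∀ b : ℕ, 2 ≤ b → ∃ (M : ℕ) (D : ℕ → ℕ),
        ∀ l K : ℕ, 1 ≤ K → 2 * K < treeSize b l →
          ∃ m : ℕ, m ≤ M * K ∧ ∃ A : Matrix (Fin m) (Fin (treeSize b l)) ℝ,
            ∀ x : Fin (treeSize b l) → ℝ, ∃ (t : ℕ) (s : RealRAM.State),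
              RealRAM.Runs p (RealRAM.input b l K A (A.mulVec x)) t s ∧
              (∀ x' ∈ treeSparse b l K,
                l1Norm (x - RealRAM.output (treeSize b l) s) ≤
                  C * Real.sqrt (Real.log ((treeSize b l : ℝ) / (K : ℝ))) * l1Norm (x - x')) ∧
              (∀ a : ℕ, (∀ i, ∃ z : ℤ, x i = (z : ℝ) ∧ |z| ≤ (treeSize b l : ℤ) ^ a) →
                (t : ℝ) ≤ (D a : ℝ) * ((K : ℝ) ^ 2 * (treeSize b l : ℝ) *
                  Real.log (treeSize b l : ℝ) ^ c)) := by
  classical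
  refine ⟨400, by norm_num, recoveryProg, 1, fun b hb => ⟨rowFactor b, timeFactor b,
    fun l K hK hKn => ?_⟩⟩
  set n := treeSize b l with hn
  obtain ⟨n', L, S₀, hn'n, hL, hLK, hS₀, hLn, hn'⟩ := exists_skeleton hb hK (l := l) (by omega)
  obtain ⟨a, ha0, ha1, hR⟩ := exists_treeRIP b n' ((8 + b) * K) (rowFactor b * K) n (by omega)
    hn'n (Nat.mul_pos (by omega) hK) (le_of_eq (by unfold rowFactor; ring))
  choose α hα hα1 using ha1
  set m := rowFactor b * K with hm
  have hm0 : 0 < m := Nat.mul_pos (one_le_rowFactor b) hK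
  have hN : 4 * K ≤ (8 + b) * K := Nat.mul_le_mul_right _ (by omega)
  refine ⟨m, le_rfl, fun i j => a i j, fun x => ?_⟩
  set y : ℕ → ℝ := app n a fun p => if h : p < n then x ⟨p, h⟩ else 0 with hy
  have hyA : Matrix.mulVec (fun (i : Fin m) (j : Fin n) => a i j) x = fun i : Fin m => y i :=
    funext fun i => mulVec_eq_app a x i
  -- the run of the program, with a bound on its length for each sufficient number of halvings
  have run : ∀ J, EnoughHalvings b n n' K m a y J →
      Halts recoveryProg (input b l K (fun (i : Fin m) (j : Fin n) => a i j) fun i => y i)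
        ((2 * J + 3) * (1800 * (m + b + 1) * (n + 1)) +
          (Nat.log 2 (2 * J + 1) + 1) * (2001 * (4 * K + 2) ^ 2 * (m + n + 1)) + 30)
        fun s' => Good b n m K a y (Adm b n') (s'.real 2) := fun J hJ =>
    halts_recoveryProg (by omega) hK ⟨by simp [PClosed], by simp⟩
      (fun lam hlam x U x' U' hU hx hstep => adm_step (by omega) ha0 hlam hU hx hstep) hJ
      (hasInput_input a y) (fun c hc => by simp [input, hc]) (by simp [input])
  rw [hyA]
  by_cases hint : ∃ e : ℕ, ∀ i, ∃ z : ℤ, x i = (z : ℝ) ∧ |z| ≤ (n : ℤ) ^ e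
  · -- the bound for the least exponent implies the bounds for all larger ones
    have hspec := Nat.find_spec hint
    set e := Nat.find hint with he
    choose ξ hξ hξ1 using hspec
    have hJ : EnoughHalvings b n n' K m a y (K * (Nat.log 2 n + 1) * halvingFactor b e) := by
      refine enoughHalvings_of_int hR hn'n hm0 hN hK hα hα1
        (η := fun i => ∑ j : Fin n, α i j * ξ j) (Y := ((n : ℝ) ^ (e + 1)) ^ 2) (fun i => ?_)
        (fun i _ => ?_) (pow_halvings hm hK (by omega) rfl (by rw [halvingFactor]))
      · rw [hy, app, ← Fin.sum_univ_eq_sum_range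
          (fun j => a i j * if h : j < n then x ⟨j, h⟩ else 0)]
        push_cast
        exact Finset.sum_congr rfl fun j _ => by simp [hα, hξ]
      · rw [hy, app, ← Fin.sum_univ_eq_sum_range
          (fun j => a i j * if h : j < n then x ⟨j, h⟩ else 0), ← sq_abs]
        refine pow_le_pow_left₀ (abs_nonneg _) ((Finset.abs_sum_le_sum_abs _ _).trans ?_) 2
        calc ∑ j : Fin n, |a i j * if h : (j : ℕ) < n then x ⟨j, h⟩ else 0| ≤
              ∑ _j : Fin n, (n : ℝ) ^ e := by
              refine Finset.sum_le_sum fun j _ => ?_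
              rw [dif_pos j.isLt, abs_mul, hα i j, Fin.eta, hξ j]
              have h1 : |((α i j : ℤ) : ℝ)| ≤ 1 := by exact_mod_cast hα1 i j
              have h2 : |((ξ j : ℤ) : ℝ)| ≤ (n : ℝ) ^ e := by exact_mod_cast hξ1 j
              calc |((α i j : ℤ) : ℝ)| * |((ξ j : ℤ) : ℝ)| ≤ 1 * (n : ℝ) ^ e :=
                    mul_le_mul h1 h2 (abs_nonneg _) zero_le_one
                _ = _ := one_mul _
          _ = (n : ℝ) ^ (e + 1) := by simp [pow_succ']
    obtain ⟨t, s, hrun, ht, hgood⟩ := run _ hJ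
    refine ⟨t, s, hrun, fun x' hx' => l1Norm_sub_output_le hb hK hKn hm0 hR hn'n hL hLK hS₀ hLn hn'
      ha0 (fun i _ => rfl) hgood hx', fun e' he' => ?_⟩
    have hee' : e ≤ e' := Nat.find_min' hint he'
    have h1 := ht.trans (time_le (b := b) hm hK (by omega) rfl
      (by unfold halvingFactor; omega) rfl)
    have h2 := natLog_succ_le (n := n) (by omega)
    have h3 : (timeFactor b e : ℝ) ≤ timeFactor b e' := by exact_mod_cast timeFactor_mono b hee'
    have h4 : 0 ≤ Real.log (n : ℝ) := Real.log_natCast_nonneg n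
    set F := halvingFactor b e * (18000 * (rowFactor b + b + 1) + 360180 * (rowFactor b + 2) + 30)
      with hF
    have h5 : (timeFactor b e : ℝ) = 3 * F := by
      rw [timeFactor, ← hF]
      push_cast
      rfl
    calc (t : ℝ) ≤ ((K ^ 2 * n * (Nat.log 2 n + 1) * F : ℕ) : ℝ) := by exact_mod_cast h1
      _ = (K : ℝ) ^ 2 * n * ((Nat.log 2 n + 1 : ℕ) : ℝ) * F := by push_cast; ring
      _ ≤ (K : ℝ) ^ 2 * n * (3 * Real.log n) * F :=
          mul_le_mul_of_nonneg_right (mul_le_mul_of_nonneg_left h2 (by positivity))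
            (Nat.cast_nonneg F)
      _ = timeFactor b e * ((K : ℝ) ^ 2 * n * Real.log n ^ 1) := by rw [h5, pow_one]; ring
      _ ≤ timeFactor b e' * ((K : ℝ) ^ 2 * n * Real.log n ^ 1) := by gcongr
  · obtain ⟨J, hJ⟩ := exists_enoughHalvings hR hn'n hm0 hN y
    obtain ⟨t, s, hrun, _, hgood⟩ := run J hJ
    exact ⟨t, s, hrun, fun x' hx' => l1Norm_sub_output_le hb hK hKn hm0 hR hn'n hL hLK hS₀ hLn hn'
      ha0 (fun i _ => rfl) hgood hx', fun e he => absurd ⟨e, he⟩ hint⟩
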